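/- **Conventions.** A PPT algorithm is a classical (uniform) probabilistic polynomial-time algorithm; a QPT algorithm is a quantum polynomial-time algorithm, i.e. a polynomial-time uniform family of quantum circuits over a fixed universal gate set followed by measurement and polynomial-time classical post-processing. For an algorithm $\mathcal{A}$ with input $1^\lambda$ and classical output, $\mathcal{A}(1^\lambda)$ also denotes its output distribution on bit strings. $\mathsf{SD}(P,Q)=\frac12\sum_x|P(x)-Q(x)|$ is the statistical distance. All polynomials are positive on $\mathbb{N}$. Let $\Sigma\subseteq\mathbb{N}$. *Quantum advantage samplers.* A QPT algorithm $\mathcal{A}$ that takes $1^\lambda$ as input and outputs a classical bit string is a quantum advantage sampler (QAS) on $\Sigma$ if there is a polynomial $p$ such that for every PPT algorithm $\mathcal{B}$ there is $\lambda^*\in\mathbb{N}$ with $$\mathsf{SD}(\mathcal{A}(1^\lambda),\mathcal{B}(1^\lambda))>\frac1{p(\lambda)}\qquad\text{for all }\lambda\ge\lambda^*\text{ in }\Sigma .$$ *Non-interactive IV-PoQ.* A non-interactive inefficient-verifier proof of quantumness (IV-PoQ) on $\Sigma$ is a pair $(\mathcal{P},\mathcal{V})$, where the prover $\mathcal{P}$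 is a QPT algorithm that on input $1^\lambda$ outputs a bit string $\tau$, and the verifier $\mathcal{V}$ is an algorithm without time bound (always halting, possibly randomized) that on input $1^\lambda$ and $\tau$ outputs $\top$ or $\bot$, such that for some functions $c,s:\mathbb{N}\to\mathbb{R}$ and some polynomial $q$ with $c(\lambda)-s(\lambda)\ge 1/q(\lambda)$ for all $\lambda$: - (completeness) there is $\lambda^*$ such that $\Pr[\top\gets\mathcal{V}(1^\lambda,\tau):\tau\gets\mathcal{P}(1^\lambda)]\ge c(\lambda)$ for all $\lambda\ge\lambda^*$; - (soundness on $\Sigma$) for every PPT algorithm $\mathcal{P}^*$ there is $\lambda^{**}$ such that $\Pr[\top\gets\mathcal{V}(1^\lambda,\tau):\tau\gets\mathcal{P}^*(1^\lambda)]\le s(\lambda)$ for all $\lambda\ge\lambda^{**}$ in $\Sigma$. For $\Sigma=\mathbb{N}$ one omits "on $\Sigma$". **Theorem.** Quantum advantage samplers exist if and only if non-interactive IV-PoQ exist. More generally, for every infinite set $\Sigma\subseteq\mathbb{N}$, quantum advantage samplers on $\Sigma$ exist if and only if non-interactive IV-PoQ on $\Sigma$ exist. -/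

import Mathlib

namespace QAdv

/-! ### Classical computation with a step count

A multi-tape Turing machine whose tapes are stacks of bits, written as a structured program.
A program mentions finitely many stacks, each elementary step inspects or changes only the top
of one stack, and each elementary step costs one unit of time. -/

/-- Programs acting on bit stacks indexed by natural numbers. -/
inductive Prog : Type
  /-- do nothing -/
  | skip : Prog
  /-- push the bit `b` on stack `i` -/
  | push (i : ℕ) (b : Bool) : Prog
  /-- remove the top bit of stack `i` (no effect if it is empty) -/
  | pop (i : ℕ) : Prog
  /-- run `p`, then `q` -/
  | seq (p q : Prog) : Prog
  /-- run `p` if stack `i` is nonempty with top bit `b`, otherwise run `q` -/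
  | ifTop (i : ℕ) (b : Bool) (p q : Prog) : Prog
  /-- run `p` as long as stack `i` is nonempty -/
  | loop (i : ℕ) (p : Prog) : Prog

/-- The contents of all stacks; the top of a stack is the head of its list. -/
abbrev Store : Type := ℕ → List Bool

/-- `Exec p s s' t`: program `p`, started on the stacks `s`, halts after exactly `t` steps with
the stacks `s'`. -/
inductive Exec : Prog → Store → Store → ℕ → Prop
  | skip (s : Store) : Exec .skip s s 1
  | push (i : ℕ) (b : Bool) (s : Store) :
      Exec (.push i b) s (Function.update s i (b :: s i)) 1
  | pop (i : ℕ) (s : Store) :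
      Exec (.pop i) s (Function.update s i (s i).tail) 1
  | seq {p q : Prog} {s s' s'' : Store} {t t' : ℕ} :
      Exec p s s' t → Exec q s' s'' t' → Exec (.seq p q) s s'' (t + t')
  | ifTop_pos {i : ℕ} {b : Bool} {p q : Prog} {s s' : Store} {t : ℕ} :
      (s i).head? = some b → Exec p s s' t → Exec (.ifTop i b p q) s s' (t + 1)
  | ifTop_neg {i : ℕ} {b : Bool} {p q : Prog} {s s' : Store} {t : ℕ} :
      (s i).head? ≠ some b → Exec q s s' t → Exec (.ifTop i b p q) s s' (t + 1)
  | loop_done {i : ℕ} {p : Prog} {s : Store} :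
      s i = [] → Exec (.loop i p) s s 1
  | loop_step {i : ℕ} {p : Prog} {s s' s'' : Store} {t t' : ℕ} :
      s i ≠ [] → Exec p s s' t → Exec (.loop i p) s' s'' t' →
        Exec (.loop i p) s s'' (t + t' + 1)

/-- The initial stacks: the `i`-th argument is on stack `i`, all other stacks are empty. -/
def inputStore (args : List (List Bool)) : Store := fun i => args.getD i []

/-- Program `p` on the arguments `args` halts within `t` steps, with output `out` on stack `0`. -/
def OutputsInTime (p : Prog) (args : List (List Bool)) (out : List Bool) (t : ℕ) : Prop :=
  ∃ (s : Store) (t' : ℕ), t' ≤ t ∧ Exec p (inputStore args) s t' ∧ s 0 = out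

/-- The string `1^lam`. -/
def unary (lam : ℕ) : List Bool := List.replicate lam true

/-- `m` independent fair coins, as a bit string of length `m`. -/
noncomputable def coinFlips (m : ℕ) : PMF (List Bool) :=
  (PMF.uniformOfFintype (Fin m → Bool)).map List.ofFn

/-- A PPT algorithm that takes `1^lam` as input and outputs a bit string: a program that on
`1^lam` and a random seed of polynomial length halts in polynomial time. -/
structure PPTSampler where
  /-- the program -/
  prog : Prog
  /-- the number of random bits -/
  coins : Polynomial ℕ
  /-- the running time -/
  time : Polynomial ℕ
  /-- the output on `1^lam` and a seed -/
  out : ℕ → List Bool → List Bool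
  /-- the program computes the output in polynomial time -/
  computes : ∀ (lam : ℕ) (r : List Bool), r.length = coins.eval lam →
    OutputsInTime prog [unary lam, r] (out lam r) (time.eval lam)

/-- The output distribution of a PPT algorithm on input `1^lam`. -/
noncomputable def PPTSampler.dist (B : PPTSampler) (lam : ℕ) : PMF (List Bool) :=
  (coinFlips (B.coins.eval lam)).map (B.out lam)

/-! ### Quantum circuits

Circuits over the universal gate set consisting of the Hadamard gate, the phase gate
`diag(1, i)`, CNOT and the Toffoli gate. -/

/-- Gates on `n` qubits. -/
inductive Gate (n : ℕ) : Type
  /-- Hadamard gate on qubit `i` -/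
  | had (i : Fin n) : Gate n
  /-- phase gate `diag(1, i)` on qubit `i` -/
  | phase (i : Fin n) : Gate n
  /-- CNOT with control `c` and target `t` -/
  | cnot (c t : Fin n) (h : c ≠ t) : Gate n
  /-- Toffoli gate with controls `c`, `d` and target `t` -/
  | toffoli (c d t : Fin n) (hcd : c ≠ d) (hct : c ≠ t) (hdt : d ≠ t) : Gate n

/-- Vectors of amplitudes in the computational basis of `n` qubits. -/
abbrev QState (n : ℕ) : Type := (Fin n → Bool) → ℂ

/-- Flip bit `t`. -/
def flipBit {n : ℕ} (t : Fin n) (x : Fin n → Bool) : Fin n → Bool :=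
  Function.update x t (!x t)

/-- The unitary of a gate, acting on amplitude vectors. -/
noncomputable def Gate.apply {n : ℕ} : Gate n → QState n → QState n
  | .had i, ψ => fun x =>
      (ψ (Function.update x i false) + (if x i then -1 else 1) * ψ (Function.update x i true))
        / (Real.sqrt 2 : ℂ)
  | .phase i, ψ => fun x => if x i then Complex.I * ψ x else ψ x
  | .cnot c t _, ψ => fun x => ψ (if x c then flipBit t x else x)
  | .toffoli c d t _ _ _, ψ => fun x => ψ (if x c && x d then flipBit t x else x)

/-- The initial state `|0...0⟩`. -/
noncomputable def zeroState (n : ℕ) : QState n := fun x => if x = fun _ => false then 1 else 0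

/-- A quantum circuit: a number of qubits and a list of gates, the first one applied first. -/
structure QCircuit where
  /-- the number of qubits -/
  qubits : ℕ
  /-- the gates -/
  gates : List (Gate qubits)

/-- The state after running the circuit on `|0...0⟩`. -/
noncomputable def QCircuit.finalState (C : QCircuit) : QState C.qubits :=
  C.gates.foldl (fun ψ g => g.apply ψ) (zeroState C.qubits)

theorem flipBit_flipBit {n : ℕ} (t : Fin n) (x : Fin n → Bool) : flipBit t (flipBit t x) = x := by
  simp [flipBit]

theorem sum_controlled {n : ℕ} (t : Fin n) (b : (Fin n → Bool) → Bool)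
    (hb : ∀ x, b (flipBit t x) = b x) (f : (Fin n → Bool) → ℝ) :
    ∑ x, f (if b x then flipBit t x else x) = ∑ x, f x := by
  have hinv : Function.Involutive
      (fun x : Fin n → Bool => if b x then flipBit t x else x) := by
    intro x
    by_cases h : b x = true
    · simp [h, hb, flipBit_flipBit]
    · simp [h]
  exact Equiv.sum_comp hinv.toPerm f

theorem Gate.sum_normSq_apply {n : ℕ} (g : Gate n) (ψ : QState n) :
    ∑ x, Complex.normSq (g.apply ψ x) = ∑ x, Complex.normSq (ψ x) := by
  cases g with
  | phase i =>
    refine Finset.sum_congr rfl fun x _ => ?_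
    by_cases h : x i = true <;> simp [Gate.apply, h]
  | cnot c t h =>
    exact sum_controlled t (fun x => x c) (fun x => by simp [flipBit, h])
      (fun x => Complex.normSq (ψ x))
  | toffoli c d t hcd hct hdt =>
    exact sum_controlled t (fun x => x c && x d) (fun x => by simp [flipBit, hct, hdt])
      (fun x => Complex.normSq (ψ x))
  | had i =>
    have key : ∀ F : (Fin n → Bool) → ℝ,
        2 * ∑ x, F x = ∑ x, (F x + F (flipBit i x)) := by
      intro F
      have h := sum_controlled i (fun _ => true) (fun _ => rfl) F
      simp only [if_true] at h
      rw [Finset.sum_add_distrib, h]; ring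
    have h2 : (Real.sqrt 2 : ℝ) * Real.sqrt 2 = 2 := Real.mul_self_sqrt (by norm_num)
    have hs : ∀ z : ℂ, Complex.normSq (z / (Real.sqrt 2 : ℂ)) = Complex.normSq z / 2 := by
      intro z
      rw [Complex.normSq_div, Complex.normSq_ofReal, h2]
    have e : 2 * ∑ x, Complex.normSq ((Gate.had i).apply ψ x)
        = 2 * ∑ x, Complex.normSq (ψ x) := by
      rw [key, key]
      refine Finset.sum_congr rfl fun x => fun _ => ?_
      cases hx : x i
      · have e1 : Function.update x i false = x := by rw [← hx]; simp
        simp only [Gate.apply, flipBit, hx, hs, e1, Function.update_idem, Function.update_self,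
          Bool.not_false]
        simp only [Complex.normSq_apply]
        simp
        ring
      · have e1 : Function.update x i true = x := by rw [← hx]; simp
        simp only [Gate.apply, flipBit, hx, hs, e1, Function.update_idem, Function.update_self,
          Bool.not_true]
        simp only [Complex.normSq_apply]
        simp
        ring
    linarith

theorem QCircuit.sum_normSq_finalState (C : QCircuit) :
    ∑ x, Complex.normSq (C.finalState x) = 1 := by
  have h : ∀ (gs : List (Gate C.qubits)) (ψ : QState C.qubits),
      ∑ x, Complex.normSq (gs.foldl (fun ψ g => g.apply ψ) ψ x) = ∑ x, Complex.normSq (ψ x) := by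
    intro gs
    induction gs with
    | nil => intro ψ; rfl
    | cons g gs ih => intro ψ; rw [List.foldl_cons, ih, Gate.sum_normSq_apply]
  rw [QCircuit.finalState, h]
  simp [zeroState, apply_ite Complex.normSq]

/-- The distribution of the outcome when all qubits are measured in the computational basis
(Born rule). -/
noncomputable def QCircuit.measure (C : QCircuit) : PMF (Fin C.qubits → Bool) :=
  PMF.ofFintype (fun x => ENNReal.ofReal (Complex.normSq (C.finalState x))) (by
    rw [← ENNReal.ofReal_sum_of_nonneg fun x _ => Complex.normSq_nonneg _,
      C.sum_normSq_finalState, ENNReal.ofReal_one])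

/-- Self-delimiting unary code of a natural number: `1^k 0`. -/
def encodeIndex (k : ℕ) : List Bool := List.replicate k true ++ [false]

/-- The description of a gate: two bits for its kind, then the qubits it acts on. -/
def Gate.encode {n : ℕ} : Gate n → List Bool
  | .had i => [false, false] ++ encodeIndex i
  | .phase i => [false, true] ++ encodeIndex i
  | .cnot c t _ => [true, false] ++ encodeIndex c ++ encodeIndex t
  | .toffoli c d t _ _ _ =>
      [true, true] ++ encodeIndex c ++ encodeIndex d ++ encodeIndex t

/-- The description of a circuit: its number of qubits, followed by its gates. -/
def QCircuit.encode (C : QCircuit) : List Bool :=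
  encodeIndex C.qubits ++ C.gates.flatMap Gate.encode

/-- A QPT algorithm that takes `1^lam` as input and outputs a classical bit string: a
polynomial-time uniform family of quantum circuits on `|0...0⟩`, whose qubits are all measured at
the end, followed by deterministic polynomial-time classical post-processing of the outcome. -/
structure QPTSampler where
  /-- the circuit run on input `1^lam` -/
  circuit : ℕ → QCircuit
  /-- the program that writes down the circuit -/
  genProg : Prog
  /-- the running time of `genProg` -/
  genTime : Polynomial ℕ
  /-- the circuit family is polynomial-time uniform -/
  gen_computes : ∀ lam : ℕ,
    OutputsInTime genProg [unary lam] (circuit lam).encode (genTime.eval lam)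
  /-- the classical post-processing -/
  post : ℕ → List Bool → List Bool
  /-- the program for the post-processing -/
  postProg : Prog
  /-- the running time of `postProg` -/
  postTime : Polynomial ℕ
  /-- the post-processing is computed in polynomial time -/
  post_computes : ∀ (lam : ℕ) (w : List Bool), w.length = (circuit lam).qubits →
    OutputsInTime postProg [unary lam, w] (post lam w) (postTime.eval lam)

/-- The output distribution of a QPT algorithm on input `1^lam`. -/
noncomputable def QPTSampler.dist (A : QPTSampler) (lam : ℕ) : PMF (List Bool) :=
  (A.circuit lam).measure.map fun x => A.post lam (List.ofFn x)

/-! ### Quantum advantage samplers and non-interactive IV-PoQ -/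

/-- Statistical distance `1/2 ∑ |p a - q a|`. -/
noncomputable def statDist {α : Type*} (p q : PMF α) : ℝ :=
  (1 / 2) * ∑' a, |(p a).toReal - (q a).toReal|

/-- A polynomial that is positive on the natural numbers. -/
def IsPositive (p : Polynomial ℝ) : Prop := ∀ n : ℕ, 0 < p.eval (n : ℝ)

/-- `A` is a quantum advantage sampler on `S`. -/
def IsQASOn (S : Set ℕ) (A : QPTSampler) : Prop :=
  ∃ p : Polynomial ℝ, IsPositive p ∧
    ∀ B : PPTSampler, ∃ lam₀ : ℕ, ∀ lam ∈ S, lam₀ ≤ lam →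
      statDist (A.dist lam) (B.dist lam) > 1 / p.eval (lam : ℝ)

/-- `A` is a quantum advantage sampler. -/
def IsQAS (A : QPTSampler) : Prop := IsQASOn Set.univ A

/-- An unbounded verifier: a (possibly randomized) algorithm without any time bound that always
halts and, on input `1^lam` and a string `τ`, accepts or rejects. -/
structure UnboundedVerifier where
  /-- the number of random bits used on input `(1^lam, τ)` -/
  coins : ℕ → List Bool → ℕ
  /-- the verdict on `(1^lam, τ)` with a given random seed -/
  verdict : ℕ → List Bool → List Bool → Bool
  /-- the number of random bits is computable -/
  coins_computable : Computable₂ coins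
  /-- the verdict is computable -/
  verdict_computable :
    Computable fun x : ℕ × List Bool × List Bool => verdict x.1 x.2.1 x.2.2

/-- The distribution of the verdict on `(1^lam, τ)`. -/
noncomputable def UnboundedVerifier.run (V : UnboundedVerifier) (lam : ℕ) (τ : List Bool) :
    PMF Bool :=
  (coinFlips (V.coins lam τ)).map (V.verdict lam τ)

/-- The probability that `V` accepts a string `τ` sampled from `D`. -/
noncomputable def UnboundedVerifier.acceptProb (V : UnboundedVerifier) (lam : ℕ)
    (D : PMF (List Bool)) : ℝ :=
  ((D.bind (V.run lam)) true).toReal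

/-- `(P, V)` is a non-interactive inefficient-verifier proof of quantumness on `S`: the prover
sends a single string and the first verifier does nothing, so the transcript is that string. -/
def IsNonInteractiveIVPoQOn (S : Set ℕ) (P : QPTSampler) (V : UnboundedVerifier) : Prop :=
  ∃ (c s : ℕ → ℝ) (q : Polynomial ℝ), IsPositive q ∧
    (∀ lam : ℕ, c lam - s lam ≥ 1 / q.eval (lam : ℝ)) ∧
    (∃ lam₀ : ℕ, ∀ lam ≥ lam₀, V.acceptProb lam (P.dist lam) ≥ c lam) ∧
    (∀ P' : PPTSampler, ∃ lam₁ : ℕ, ∀ lam ∈ S, lam₁ ≤ lam →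
      V.acceptProb lam (P'.dist lam) ≤ s lam)

/-- `(P, V)` is a non-interactive inefficient-verifier proof of quantumness. -/
def IsNonInteractiveIVPoQ (P : QPTSampler) (V : UnboundedVerifier) : Prop :=
  IsNonInteractiveIVPoQOn Set.univ P V

end QAdv

/-!
From a proof of quantumness to a sampler: if some PPT algorithm had output statistically close to
the prover's, the verifier would accept both with almost the same probability. So the prover is
itself a quantum advantage sampler.

From a sampler `A` to a proof of quantumness: the prover runs `m` independent copies of `A` and
sends all measurement outcomes. Let `M` be the uniform mixture of the outputs of the first
`lam + 1` polynomial-time machines; every PPT algorithm is dominated by `(lam + 1) * M` once `lam`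
is large. Probabilities of outcomes of circuits over this gate set are sums over computation paths
of powers of `i`, divided by powers of `√2`, hence the unbounded verifier can compare likelihoods
exactly, and it accepts `τ` iff `M τ ≤ R * Pr[τ ← prover]`.

* Completeness: the set of rejected strings has mass at most `1 / R` under the prover, since `M`
  has mass at most `1`.
* Soundness: suppose a PPT algorithm is accepted with probability close to `1`. On accepted
  strings its output has density at most `(lam + 1) * R` with respect to the `m`-fold product of
  the outcome distribution of `A`. By an exponential moment bound, a random block of such a string
  is then close to a single sample of `A` as soon as `m` is large compared with
  `log ((lam + 1) * R)`. Choosing a random block takes polynomial time, which contradicts quantum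
  advantage. The block is chosen with a binomially distributed index, which can be sampled exactly
  from fair coins by counting ones.
-/

namespace QAdv

/-! ### Lists of stacks -/

/-- Replace entry `i` of a list of stacks, extending the list by empty stacks if necessary. This
represents `Function.update` on the stores that have only finitely many nonempty stacks. -/
def setStack : List (List Bool) → ℕ → List Bool → List (List Bool)
  | [], 0, v => [v]
  | [], i + 1, v => [] :: setStack [] i v
  | _ :: L, 0, v => v :: L
  | x :: L, i + 1, v => x :: setStack L i v

theorem inputStore_cons_succ (x : List Bool) (L : List (List Bool)) (i : ℕ) :
    inputStore (x :: L) (i + 1) = inputStore L i := rfl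

theorem inputStore_setStack (L : List (List Bool)) (i : ℕ) (v : List Bool) :
    inputStore (setStack L i v) = Function.update (inputStore L) i v := by
  funext j
  fun_induction setStack L i v generalizing j with
  | case1 v => cases j <;> simp [inputStore]
  | case2 i v ih =>
    cases j with
    | zero => simp [inputStore]
    | succ j => simpa [inputStore, Function.update_apply] using ih j
  | case3 x L v => cases j <;> simp [inputStore]
  | case4 x L i v ih =>
    cases j with
    | zero => simp [inputStore]
    | succ j => simpa [inputStore_cons_succ, Function.update_apply] using ih j

theorem setStack_eq_set (L : List (List Bool)) (i : ℕ) (v : List Bool) :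
    setStack L i v = (L ++ List.replicate (i + 1 - L.length) []).set i v := by
  fun_induction setStack L i v <;> simp_all [List.replicate_succ]

/-! ### A primitive recursive interpreter -/

/-- Gödel number of a program. -/
def Prog.code : Prog → ℕ
  | .skip => Nat.pair 0 0
  | .push i b => Nat.pair 1 (Nat.pair i b.toNat)
  | .pop i => Nat.pair 2 i
  | .seq p q => Nat.pair 3 (Nat.pair p.code q.code)
  | .ifTop i b p q => Nat.pair 4 (Nat.pair (Nat.pair i b.toNat) (Nat.pair p.code q.code))
  | .loop i p => Nat.pair 5 (Nat.pair i p.code)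

/-- One step of the interpreter. A configuration consists of the codes of the programs that are
still to be run, and of the stacks. Numbers that are not codes are treated as `Prog.skip`. -/
def interpStep (x : List ℕ × List (List Bool)) : List ℕ × List (List Bool) :=
  let c := x.1.headI
  let k := x.1.tail
  let a := c.unpair.2
  if c.unpair.1 = 1 then
    (k, setStack x.2 a.unpair.1 (a.unpair.2.bodd :: inputStore x.2 a.unpair.1))
  else if c.unpair.1 = 2 then (k, setStack x.2 a (inputStore x.2 a).tail)
  else if c.unpair.1 = 3 then (a.unpair.1 :: a.unpair.2 :: k, x.2)
  else if c.unpair.1 = 4 then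
    if (inputStore x.2 a.unpair.1.unpair.1).head? = some a.unpair.1.unpair.2.bodd then
      (a.unpair.2.unpair.1 :: k, x.2)
    else (a.unpair.2.unpair.2 :: k, x.2)
  else if c.unpair.1 = 5 then
    if inputStore x.2 a.unpair.1 = [] then (k, x.2) else (a.unpair.2 :: c :: k, x.2)
  else (k, x.2)

section

variable (k : List ℕ) (L : List (List Bool)) {i : ℕ} {b : Bool} (p q : Prog)

theorem bodd_toNat (b : Bool) : b.toNat.bodd = b := by cases b <;> rfl

theorem interpStep_skip : interpStep (Prog.skip.code :: k, L) = (k, L) := by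
  simp [interpStep, Prog.code]

theorem interpStep_push (i : ℕ) (b : Bool) : interpStep ((Prog.push i b).code :: k, L) =
    (k, setStack L i (b :: inputStore L i)) := by
  simp [interpStep, Prog.code, bodd_toNat]

theorem interpStep_pop (i : ℕ) : interpStep ((Prog.pop i).code :: k, L) =
    (k, setStack L i (inputStore L i).tail) := by
  simp [interpStep, Prog.code]

theorem interpStep_seq :
    interpStep ((Prog.seq p q).code :: k, L) = (p.code :: q.code :: k, L) := by
  simp [interpStep, Prog.code]

theorem interpStep_ifTop_pos (h : (inputStore L i).head? = some b) :
    interpStep ((Prog.ifTop i b p q).code :: k, L) = (p.code :: k, L) := by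
  simp [interpStep, Prog.code, bodd_toNat, h]

theorem interpStep_ifTop_neg (h : (inputStore L i).head? ≠ some b) :
    interpStep ((Prog.ifTop i b p q).code :: k, L) = (q.code :: k, L) := by
  simp [interpStep, Prog.code, bodd_toNat, h]

theorem interpStep_loop_done (h : inputStore L i = []) :
    interpStep ((Prog.loop i p).code :: k, L) = (k, L) := by
  simp [interpStep, Prog.code, h]

theorem interpStep_loop_step (h : inputStore L i ≠ []) :
    interpStep ((Prog.loop i p).code :: k, L) = (p.code :: (Prog.loop i p).code :: k, L) := by
  simp [interpStep, Prog.code, h]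

end

theorem interpStep_iterate_nil (n : ℕ) (L : List (List Bool)) :
    interpStep^[n] ([], L) = ([], L) :=
  Function.iterate_fixed (by simp [interpStep]) n

/-- The factor `2` pays for the steps in which the interpreter only takes a `Prog.seq` apart:
these are not charged by `Exec`. -/
theorem Exec.exists_iterate_interpStep {p : Prog} {s s' : Store} {t : ℕ} (h : Exec p s s' t)
    (k : List ℕ) {L : List (List Bool)} (hL : inputStore L = s) :
    ∃ n L', n < 2 * t ∧ inputStore L' = s' ∧ interpStep^[n] (p.code :: k, L) = (k, L') := by
  induction h generalizing k L with
  | skip s => exact ⟨1, L, by simp, hL, interpStep_skip k L⟩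
  | push i b s =>
    subst hL
    exact ⟨1, _, by simp, inputStore_setStack .., interpStep_push k L i b⟩
  | pop i s =>
    subst hL
    exact ⟨1, _, by simp, inputStore_setStack .., interpStep_pop k L i⟩
  | @seq p q _ _ _ _ _ _ _ ihp ihq =>
    obtain ⟨n₁, L₁, hn₁, hL₁, hi₁⟩ := ihp (q.code :: k) hL
    obtain ⟨n₂, L₂, hn₂, hL₂, hi₂⟩ := ihq k hL₁
    refine ⟨n₂ + (n₁ + 1), L₂, by omega, hL₂, ?_⟩
    rw [Function.iterate_add_apply, Function.iterate_succ_apply, interpStep_seq, hi₁, hi₂]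
  | ifTop_pos hs _ ih =>
    obtain ⟨n, L', hn, hL', hi⟩ := ih k hL
    refine ⟨n + 1, L', by omega, hL', ?_⟩
    subst hL
    rw [Function.iterate_succ_apply, interpStep_ifTop_pos k L _ _ hs, hi]
  | ifTop_neg hs _ ih =>
    obtain ⟨n, L', hn, hL', hi⟩ := ih k hL
    refine ⟨n + 1, L', by omega, hL', ?_⟩
    subst hL
    rw [Function.iterate_succ_apply, interpStep_ifTop_neg k L _ _ hs, hi]
  | loop_done hs =>
    subst hL
    exact ⟨1, L, by simp, rfl, interpStep_loop_done k L _ hs⟩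
  | @loop_step i p _ _ _ _ _ hs _ _ ihp ihloop =>
    obtain ⟨n₁, L₁, hn₁, hL₁, hi₁⟩ := ihp ((Prog.loop i p).code :: k) hL
    obtain ⟨n₂, L₂, hn₂, hL₂, hi₂⟩ := ihloop k hL₁
    refine ⟨n₂ + (n₁ + 1), L₂, by omega, hL₂, ?_⟩
    subst hL
    rw [Function.iterate_add_apply, Function.iterate_succ_apply, interpStep_loop_step k L p hs,
      hi₁, hi₂]

/-- The contents of stack `0` after `fuel` interpreter steps, for the program with code `c`. -/
def interp (c fuel : ℕ) (args : List (List Bool)) : List Bool :=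
  inputStore (interpStep^[fuel] ([c], args)).2 0

theorem OutputsInTime.interp_eq {p : Prog} {args : List (List Bool)} {out : List Bool} {t : ℕ}
    (h : OutputsInTime p args out t) {fuel : ℕ} (hf : 2 * t ≤ fuel) :
    interp p.code fuel args = out := by
  obtain ⟨s, t', ht, hexec, rfl⟩ := h
  obtain ⟨n, L, hn, rfl, hi⟩ := hexec.exists_iterate_interpStep [] rfl
  obtain ⟨d, rfl⟩ := Nat.exists_eq_add_of_le' (show n ≤ fuel by omega)
  rw [interp, Function.iterate_add_apply, hi, interpStep_iterate_nil]

theorem primrec_replicate {α : Type*} [Primcodable α] :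
    Primrec₂ (List.replicate : ℕ → α → List α) :=
  (Primrec.list_map (Primrec.list_range.comp Primrec.fst)
    (Primrec.snd.comp Primrec.fst).to₂).of_eq fun x => by simp [List.map_const']

theorem primrec_inputStore : Primrec₂ inputStore := Primrec.list_getD []

section

variable {α : Type*} [Primcodable α]

theorem primrec_setStack {f : α → List (List Bool)} {g : α → ℕ} {h : α → List Bool}
    (hf : Primrec f) (hg : Primrec g) (hh : Primrec h) :
    Primrec fun a => setStack (f a) (g a) (h a) := by
  have hpad : Primrec fun a => f a ++ List.replicate (g a + 1 - (f a).length) ([] : List Bool) :=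
    Primrec.list_append.comp hf (primrec_replicate.comp
      (Primrec.nat_sub.comp (Primrec.succ.comp hg) (Primrec.list_length.comp hf))
      (Primrec.const []))
  exact (Primrec.list_set.comp hpad (hg.pair hh)).of_eq fun a => (setStack_eq_set ..).symm

theorem primrec_unpair_fst {f : α → ℕ} (hf : Primrec f) : Primrec fun a => (f a).unpair.1 :=
  Primrec.fst.comp (Primrec.unpair.comp hf)

theorem primrec_unpair_snd {f : α → ℕ} (hf : Primrec f) : Primrec fun a => (f a).unpair.2 :=
  Primrec.snd.comp (Primrec.unpair.comp hf)

theorem primrec_interpStep : Primrec interpStep := by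
  have hcode : Primrec fun x : List ℕ × List (List Bool) => x.1.headI :=
    Primrec.list_headI.comp Primrec.fst
  have hrest : Primrec fun x : List ℕ × List (List Bool) => x.1.tail :=
    Primrec.list_tail.comp Primrec.fst
  have hstacks : Primrec fun x : List ℕ × List (List Bool) => x.2 := Primrec.snd
  have harg := primrec_unpair_snd hcode
  have hi := primrec_unpair_fst harg
  have hii := primrec_unpair_fst hi
  have htag (n : ℕ) : PrimrecPred fun x : List ℕ × List (List Bool) =>
      x.1.headI.unpair.1 = n :=
    Primrec.eq.comp (primrec_unpair_fst hcode) (Primrec.const n)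
  have hget {f : List ℕ × List (List Bool) → ℕ} (hf : Primrec f) :
      Primrec fun x => inputStore x.2 (f x) := primrec_inputStore.comp hstacks hf
  have hcons {f : List ℕ × List (List Bool) → ℕ} (hf : Primrec f) :
      Primrec fun x => f x :: x.1.tail := Primrec.list_cons.comp hf hrest
  have hcons₂ {f g : List ℕ × List (List Bool) → ℕ} (hf : Primrec f) (hg : Primrec g) :
      Primrec fun x => f x :: g x :: x.1.tail := Primrec.list_cons.comp hf (hcons hg)
  have hpush := hrest.pair (primrec_setStack hstacks hi (Primrec.list_cons.comp
    (Primrec.nat_bodd.comp (primrec_unpair_snd harg)) (hget hi)))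
  have hpop := hrest.pair (primrec_setStack hstacks harg (Primrec.list_tail.comp (hget harg)))
  have hseq := (hcons₂ hi (primrec_unpair_snd harg)).pair hstacks
  have htop : PrimrecPred fun x : List ℕ × List (List Bool) =>
      (inputStore x.2 x.1.headI.unpair.2.unpair.1.unpair.1).head?
        = some x.1.headI.unpair.2.unpair.1.unpair.2.bodd :=
    Primrec.eq.comp (Primrec.list_head?.comp (hget hii))
      (Primrec.option_some.comp (Primrec.nat_bodd.comp (primrec_unpair_snd hi)))
  have hifTop := Primrec.ite htop
    ((hcons (primrec_unpair_fst (primrec_unpair_snd harg))).pair hstacks)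
    ((hcons (primrec_unpair_snd (primrec_unpair_snd harg))).pair hstacks)
  have hloop := Primrec.ite (Primrec.eq.comp (hget hi) (Primrec.const []))
    (hrest.pair hstacks) ((hcons₂ (primrec_unpair_snd harg) hcode).pair hstacks)
  exact Primrec.ite (htag 1) hpush <| Primrec.ite (htag 2) hpop <| Primrec.ite (htag 3) hseq <|
    Primrec.ite (htag 4) hifTop <| Primrec.ite (htag 5) hloop (hrest.pair hstacks)

theorem primrec_interp {c fuel : α → ℕ} {args : α → List (List Bool)} (hc : Primrec c)
    (hfuel : Primrec fuel) (hargs : Primrec args) :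
    Primrec fun a => interp (c a) (fuel a) (args a) := by
  have hinit : Primrec fun a => ([c a], args a) :=
    (Primrec.list_cons.comp hc (Primrec.const [])).pair hargs
  have hiter := Primrec.nat_iterate hfuel hinit (primrec_interpStep.comp Primrec.snd).to₂
  exact primrec_inputStore.comp (Primrec.snd.comp hiter) (Primrec.const 0)

end

/-! ### Primitive recursive bookkeeping -/

/-- The value at `n` of the polynomial with the given list of coefficients, lowest degree
first. -/
def evalCoeffs (l : List ℕ) (n : ℕ) : ℕ := l.foldr (fun a v => a + n * v) 0

theorem exists_evalCoeffs_eq_eval (p : Polynomial ℕ) :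
    ∃ l, ∀ n, evalCoeffs l n = p.eval n := by
  induction p using Polynomial.recOnHorner with
  | M0 => exact ⟨[], fun n => by simp [evalCoeffs]⟩
  | MC p a _ _ ih =>
    obtain ⟨l, hl⟩ := ih
    simp only [Polynomial.eval_add, Polynomial.eval_C, ← hl]
    cases l with
    | nil => exact ⟨[a], fun n => by simp [evalCoeffs]⟩
    | cons b l => exact ⟨(b + a) :: l, fun n => by simp only [evalCoeffs, List.foldr_cons]; ring⟩
  | MX p _ ih =>
    obtain ⟨l, hl⟩ := ih
    exact ⟨0 :: l, fun n => by simp [← hl, evalCoeffs, mul_comm]⟩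

theorem primrec_evalCoeffs : Primrec₂ evalCoeffs :=
  Primrec.list_foldr Primrec.fst (Primrec.const 0) (Primrec.nat_add.comp
    (Primrec.fst.comp Primrec.snd)
    (Primrec.nat_mul.comp (Primrec.snd.comp Primrec.fst) (Primrec.snd.comp Primrec.snd))).to₂

theorem primrec_polynomial_eval (p : Polynomial ℕ) : Primrec fun n => p.eval n := by
  obtain ⟨l, hl⟩ := exists_evalCoeffs_eq_eval p
  exact (primrec_evalCoeffs.comp (Primrec.const l) Primrec.id).of_eq hl

theorem primrec_pow : Primrec₂ ((· ^ ·) : ℕ → ℕ → ℕ) :=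
  Primrec₂.unpaired'.1 Nat.Primrec.pow

theorem primrec_unary : Primrec unary := primrec_replicate.comp Primrec.id (Primrec.const true)

theorem primrec_sum_map {α β : Type*} [Primcodable α] [Primcodable β] {f : α → List β}
    {g : α → β → ℕ} (hf : Primrec f) (hg : Primrec₂ g) :
    Primrec fun a => ((f a).map (g a)).sum := by
  refine (Primrec.list_foldr (h := fun a (x : β × ℕ) => g a x.1 + x.2) hf (Primrec.const 0)
    (Primrec.nat_add.comp (hg.comp Primrec.fst (Primrec.fst.comp Primrec.snd))
      (Primrec.snd.comp Primrec.snd)).to₂).of_eq fun a => ?_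
  induction f a with
  | nil => rfl
  | cons b l ih => simp [ih]

/-- All bit strings of length `n`. -/
def bitStrings : ℕ → List (List Bool)
  | 0 => [[]]
  | n + 1 => (bitStrings n).flatMap fun l => [false :: l, true :: l]

theorem primrec_bitStrings : Primrec bitStrings := by
  have hcons (b : Bool) : Primrec fun x : (ℕ × ℕ × List (List Bool)) × List Bool => b :: x.2 :=
    Primrec.list_cons.comp (Primrec.const b) Primrec.snd
  have hstep : Primrec₂ fun (_ : ℕ) (x : ℕ × List (List Bool)) =>
      x.2.flatMap fun l => [false :: l, true :: l] :=
    Primrec.list_flatMap (Primrec.snd.comp Primrec.snd) (Primrec.list_cons.comp (hcons false)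
      (Primrec.list_cons.comp (hcons true) (Primrec.const [])))
  refine (Primrec.nat_rec' Primrec.id (Primrec.const [[]]) hstep).of_eq fun n => ?_
  induction n with
  | zero => rfl
  | succ n ih => simpa only [bitStrings, id_eq] using congrArg _ ih

/-! ### Outcome probabilities of circuits as sums over paths -/

/-- The number whose code `encodeIndex` is at the beginning of a bit string. -/
def readNat (l : List Bool) : ℕ := (l.takeWhile id).length

/-- The part of a bit string that follows the code of a number. -/
def readRest (l : List Bool) : List Bool := (l.dropWhile id).tail

@[simp] theorem readNat_encodeIndex (k : ℕ) (l : List Bool) :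
    readNat (encodeIndex k ++ l) = k := by
  induction k with
  | zero => simp [readNat, encodeIndex]
  | succ k _ => simp [readNat, encodeIndex, List.replicate_succ]

@[simp] theorem readRest_encodeIndex (k : ℕ) (l : List Bool) :
    readRest (encodeIndex k ++ l) = l := by
  induction k with
  | zero => simp [readRest, encodeIndex]
  | succ k _ => simp [readRest, encodeIndex, List.replicate_succ]

/-- A computation path: the basis state it ends in, and the exponent of the imaginary unit in its
amplitude. The normalization by powers of `√2` is the same for all paths and is left out. -/
abbrev Path (n : ℕ) : Type := (Fin n → Bool) × ℕ

/-- The paths that extend a given path by a gate. -/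
def Gate.branch {n : ℕ} : Gate n → Path n → List (Path n)
  | .had i, y => [(Function.update y.1 i false, y.2),
      (Function.update y.1 i true, y.2 + 2 * (y.1 i).toNat)]
  | .phase i, y => [(y.1, y.2 + (y.1 i).toNat)]
  | .cnot c t _, y => [(if y.1 c then flipBit t y.1 else y.1, y.2)]
  | .toffoli c d t _ _ _, y => [(if y.1 c && y.1 d then flipBit t y.1 else y.1, y.2)]

/-- The contribution of a single gate to the number of Hadamard gates of a circuit. -/
def Gate.hadCount {n : ℕ} : Gate n → ℕ
  | .had _ => 1
  | _ => 0

/-- The state, up to normalization, in which each basis state has as its amplitude the sum of the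
amplitudes of the paths that end there. -/
noncomputable def pathSum {n : ℕ} (L : List (Path n)) : QState n :=
  fun x => (L.map fun y => if y.1 = x then Complex.I ^ y.2 else 0).sum

section PathSum

variable {n : ℕ}

theorem pathSum_nil (x : Fin n → Bool) : pathSum [] x = 0 := rfl

theorem pathSum_cons (y : Path n) (L : List (Path n)) (x : Fin n → Bool) :
    pathSum (y :: L) x = (if y.1 = x then Complex.I ^ y.2 else 0) + pathSum L x := by
  simp [pathSum]

theorem pathSum_append (L L' : List (Path n)) (x : Fin n → Bool) :
    pathSum (L ++ L') x = pathSum L x + pathSum L' x := by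
  simp [pathSum]

theorem controlled_eq_iff (t : Fin n) {b : (Fin n → Bool) → Bool}
    (hb : ∀ x, b (flipBit t x) = b x) (x y : Fin n → Bool) :
    (if b y then flipBit t y else y) = x ↔ y = if b x then flipBit t x else x := by
  constructor
  · rintro rfl
    by_cases h : b y = true <;> simp [h, hb, flipBit_flipBit]
  · rintro rfl
    by_cases h : b x = true <;> simp [h, hb, flipBit_flipBit]

theorem update_eq_iff_eq_update (i : Fin n) (b : Bool) (x y : Fin n → Bool) :
    Function.update y i b = x ↔ x i = b ∧ y = Function.update x i (y i) := by
  constructor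
  · rintro rfl
    simp
  · rintro ⟨rfl, h⟩
    rw [h]
    simp

theorem pathSum_branch_had (i : Fin n) (y : Path n) (x : Fin n → Bool) :
    pathSum ((Gate.had i).branch y) x
      = (Real.sqrt 2 : ℂ) * (Gate.had i).apply (pathSum [y]) x := by
  obtain ⟨y, k⟩ := y
  have hne : Function.update x i false ≠ Function.update x i true :=
    (Function.update_injective x i).ne Bool.false_ne_true
  have hupdate (b : Bool) : Function.update y i b = x ↔
      x i = b ∧ (y = Function.update x i false ∨ y = Function.update x i true) := by
    rw [update_eq_iff_eq_update]
    refine and_congr_right fun _ => ⟨fun h => ?_, ?_⟩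
    · cases hy : y i <;> rw [hy] at h <;> simp [← h]
    · rintro (rfl | rfl) <;> simp
  rw [Gate.apply, mul_div_cancel₀ _ (by simp)]
  simp only [Gate.branch, pathSum_cons, pathSum_nil, add_zero, hupdate]
  by_cases h0 : y = Function.update x i false
  · cases hx : x i <;> simp [h0, hne]
  · by_cases h1 : y = Function.update x i true
    · cases hx : x i <;> simp [h1, hne.symm, pow_add]
    · cases hx : x i <;> simp [h0, h1]

theorem pathSum_branch_phase (i : Fin n) (y : Path n) (x : Fin n → Bool) :
    pathSum ((Gate.phase i).branch y) x = (Gate.phase i).apply (pathSum [y]) x := by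
  simp only [Gate.branch, Gate.apply, pathSum_cons, pathSum_nil, add_zero]
  by_cases h : y.1 = x
  · cases hx : x i <;> simp [h, hx, pow_succ']
  · simp [h]

theorem pathSum_branch (g : Gate n) (y : Path n) (x : Fin n → Bool) :
    pathSum (g.branch y) x = (Real.sqrt 2 : ℂ) ^ g.hadCount * g.apply (pathSum [y]) x := by
  cases g with
  | had i => rw [pathSum_branch_had, Gate.hadCount, pow_one]
  | phase i => simp [pathSum_branch_phase, Gate.hadCount]
  | cnot c t hct =>
    simp only [Gate.hadCount, pow_zero, one_mul, Gate.branch, Gate.apply, pathSum_cons,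
      pathSum_nil, controlled_eq_iff t (b := fun x => x c) (fun x => by simp [flipBit, hct])]
  | toffoli c d t hcd hct hdt =>
    simp only [Gate.hadCount, pow_zero, one_mul, Gate.branch, Gate.apply, pathSum_cons,
      pathSum_nil,
      controlled_eq_iff t (b := fun x => x c && x d) (fun x => by simp [flipBit, hct, hdt])]

theorem Gate.apply_add (g : Gate n) (φ ψ : QState n) :
    g.apply (fun x => φ x + ψ x) = fun x => g.apply φ x + g.apply ψ x := by
  funext x
  cases g <;> simp only [Gate.apply]
  · split_ifs <;> ring
  · split_ifs <;> ring

theorem Gate.apply_smul (g : Gate n) (a : ℂ) (ψ : QState n) :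
    g.apply (fun x => a * ψ x) = fun x => a * g.apply ψ x := by
  funext x
  cases g <;> simp only [Gate.apply]
  · ring
  · split_ifs <;> ring

theorem foldl_apply_smul (gs : List (Gate n)) (a : ℂ) (ψ : QState n) :
    gs.foldl (fun ψ g => g.apply ψ) (fun x => a * ψ x)
      = fun x => a * gs.foldl (fun ψ g => g.apply ψ) ψ x := by
  induction gs generalizing ψ with
  | nil => rfl
  | cons g gs ih => rw [List.foldl_cons, Gate.apply_smul, ih, List.foldl_cons]

theorem pathSum_flatMap_branch (g : Gate n) (L : List (Path n)) :
    pathSum (L.flatMap g.branch)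
      = fun x => (Real.sqrt 2 : ℂ) ^ g.hadCount * g.apply (pathSum L) x := by
  induction L with
  | nil =>
    have hzero : g.apply (pathSum []) = fun x => 0 * g.apply (pathSum []) x := by
      rw [← g.apply_smul]
      exact congrArg g.apply (funext fun x => by simp [pathSum_nil])
    funext x
    rw [hzero]
    simp [pathSum_nil]
  | cons y L ih =>
    have hcons : pathSum (y :: L) = fun x => pathSum [y] x + pathSum L x :=
      funext fun x => pathSum_append [y] L x
    funext x
    rw [List.flatMap_cons, pathSum_append, pathSum_branch, ih, hcons, g.apply_add]
    ring

/-- The paths through a list of gates that extend the paths in `L`. -/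
def allPaths (gs : List (Gate n)) (L : List (Path n)) : List (Path n) :=
  gs.foldl (fun L g => L.flatMap g.branch) L

theorem pathSum_allPaths (gs : List (Gate n)) (L : List (Path n)) :
    pathSum (allPaths gs L) = fun x => (Real.sqrt 2 : ℂ) ^ (gs.map Gate.hadCount).sum *
      gs.foldl (fun ψ g => g.apply ψ) (pathSum L) x := by
  induction gs generalizing L with
  | nil => simp [allPaths]
  | cons g gs ih =>
    funext x
    rw [allPaths, List.foldl_cons, ← allPaths, ih, pathSum_flatMap_branch, foldl_apply_smul,
      List.map_cons, List.sum_cons, List.foldl_cons]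
    ring

end PathSum

/-- The state of the enumeration of the paths through a described circuit: the part of the
description not yet read, the number of Hadamard gates read, and the paths, whose basis states are
written as bit strings. -/
abbrev PathConfig : Type := List Bool × ℕ × List (List Bool × ℕ)

/-- Flip bit `t` of `x` if `b` holds. -/
def flipIf (b : Bool) (t : ℕ) (x : List Bool) : List Bool :=
  if b then x.set t (!x.getD t false) else x

/-- Read the description of one gate and extend all paths by it. -/
def pathStep (c : PathConfig) : PathConfig :=
  let r := c.1.tail.tail
  let i := readNat r
  let r₁ := readRest r
  let j := readNat r₁
  let r₂ := readRest r₁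
  let k := readNat r₂
  if c.1 = [] then c
  else if c.1.headI = false then
    if c.1.tail.headI = false then
      (r₁, c.2.1 + 1, c.2.2.flatMap fun y =>
        [(y.1.set i false, y.2), (y.1.set i true, y.2 + 2 * (y.1.getD i false).toNat)])
    else (r₁, c.2.1, c.2.2.map fun y => (y.1, y.2 + (y.1.getD i false).toNat))
  else if c.1.tail.headI = false then
    (r₂, c.2.1, c.2.2.map fun y => (flipIf (y.1.getD i false) j y.1, y.2))
  else (readRest r₂, c.2.1, c.2.2.map fun y =>
    (flipIf (y.1.getD i false && y.1.getD j false) k y.1, y.2))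

/-- Paths with their basis states written as bit strings. -/
def pathList {n : ℕ} (L : List (Path n)) : List (List Bool × ℕ) :=
  L.map fun y => (List.ofFn y.1, y.2)

@[simp] theorem ofFn_set {n : ℕ} (x : Fin n → Bool) (i : Fin n) (b : Bool) :
    (List.ofFn x).set i b = List.ofFn (Function.update x i b) := by
  refine List.ext_getElem (by simp) fun k h1 h2 => ?_
  simp only [List.getElem_set, List.getElem_ofFn, Function.update_apply, Fin.ext_iff, eq_comm]

@[simp] theorem flipIf_ofFn {n : ℕ} (b : Bool) (t : Fin n) (x : Fin n → Bool) :
    flipIf b t (List.ofFn x) = List.ofFn (if b then flipBit t x else x) := by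
  cases b <;> simp [flipIf, flipBit]

theorem pathStep_encode {n : ℕ} (g : Gate n) (l : List Bool) (h : ℕ) (L : List (Path n)) :
    pathStep (g.encode ++ l, h, pathList L)
      = (l, h + g.hadCount, pathList (L.flatMap g.branch)) := by
  cases g <;> simp [pathStep, Gate.encode, Gate.hadCount, pathList, Gate.branch,
    List.map_eq_flatMap, List.flatMap_assoc]

theorem pathStep_nil (h : ℕ) (L : List (List Bool × ℕ)) : pathStep ([], h, L) = ([], h, L) := by
  simp [pathStep]

theorem pathStep_iterate {n : ℕ} (gs : List (Gate n)) (h : ℕ) (L : List (Path n)) :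
    pathStep^[gs.length] (gs.flatMap Gate.encode, h, pathList L)
      = ([], h + (gs.map Gate.hadCount).sum, pathList (allPaths gs L)) := by
  induction gs generalizing h L with
  | nil => rfl
  | cons g gs ih =>
    rw [List.length_cons, Function.iterate_succ_apply, List.flatMap_cons, pathStep_encode, ih]
    simp [allPaths, add_assoc]

/-- Enumerate the paths through the circuit with description `E`, starting in the zero state. -/
def pathRun (E : List Bool) : PathConfig :=
  pathStep^[E.length] (readRest E, 0, [((List.range (readNat E)).map fun _ => false, 0)])

theorem length_le_flatMap_encode {n : ℕ} (gs : List (Gate n)) :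
    gs.length ≤ (gs.flatMap Gate.encode).length := by
  induction gs with
  | nil => simp
  | cons g gs ih =>
    have hg : 1 ≤ g.encode.length := by cases g <;> simp [Gate.encode]
    simp only [List.length_cons, List.flatMap_cons, List.length_append]
    omega

theorem pathRun_encode (C : QCircuit) : pathRun C.encode
    = ([], (C.gates.map Gate.hadCount).sum, pathList (allPaths C.gates [(fun _ => false, 0)])) := by
  have hlength : C.gates.length ≤ C.encode.length := by
    have := length_le_flatMap_encode C.gates
    simp only [QCircuit.encode, List.length_append]
    omega
  have hstart : [((List.range C.qubits).map fun _ => false, 0)]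
      = pathList [((fun _ => false : Fin C.qubits → Bool), 0)] := by
    simp [pathList, List.ofFn_const]
  rw [pathRun, ← Nat.sub_add_cancel hlength, Function.iterate_add_apply]
  simp only [QCircuit.encode, readNat_encodeIndex, readRest_encodeIndex]
  rw [hstart, pathStep_iterate, zero_add]
  exact Function.iterate_fixed (pathStep_nil _ _) _

/-- The number of paths that end in `w` with amplitude `I ^ j`, for `j < 4`. -/
def phaseCount (L : List (List Bool × ℕ)) (w : List Bool) (j : ℕ) : ℕ :=
  (L.map fun y => if y.1 = w ∧ y.2 % 4 = j then 1 else 0).sum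

/-- The square of the difference; one of the two summands is zero because of truncation. -/
def sqDiff (a b : ℕ) : ℕ := (a - b) * (a - b) + (b - a) * (b - a)

theorem cast_sqDiff (a b : ℕ) : (sqDiff a b : ℝ) = ((a : ℝ) - b) ^ 2 := by
  rcases le_total a b with h | h <;>
    simp [sqDiff, Nat.sub_eq_zero_of_le h, Nat.cast_sub h] <;> ring

/-- The numerator of the probability of the outcome `w` of the circuit with description `E`; the
denominator is `2` to the number of Hadamard gates. -/
def outcomeNum (E w : List Bool) : ℕ :=
  sqDiff (phaseCount (pathRun E).2.2 w 0) (phaseCount (pathRun E).2.2 w 2) +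
    sqDiff (phaseCount (pathRun E).2.2 w 1) (phaseCount (pathRun E).2.2 w 3)

theorem pathSum_eq_phaseCount {n : ℕ} (L : List (Path n)) (x : Fin n → Bool) :
    pathSum L x = ⟨(phaseCount (pathList L) (List.ofFn x) 0 : ℝ)
      - phaseCount (pathList L) (List.ofFn x) 2, (phaseCount (pathList L) (List.ofFn x) 1 : ℝ)
      - phaseCount (pathList L) (List.ofFn x) 3⟩ := by
  induction L with
  | nil => simp [pathSum, phaseCount, pathList, Complex.ext_iff]
  | cons y L ih =>
    have hcons (j : ℕ) : phaseCount (pathList (y :: L)) (List.ofFn x) j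
        = (if y.1 = x ∧ y.2 % 4 = j then 1 else 0) + phaseCount (pathList L) (List.ofFn x) j := by
      simp [phaseCount, pathList]
    rw [pathSum_cons, ih]
    simp only [hcons]
    by_cases h : y.1 = x
    · rw [if_pos h, Complex.I_pow_eq_pow_mod]
      have hmod : y.2 % 4 < 4 := Nat.mod_lt _ (by norm_num)
      simp only [h, true_and]
      generalize y.2 % 4 = k at *
      interval_cases k <;> apply Complex.ext <;> simp <;> ring
    · simp [h]

theorem QCircuit.toReal_measure (C : QCircuit) (x : Fin C.qubits → Bool) :
    (C.measure x).toReal = Complex.normSq (C.finalState x) := by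
  rw [QCircuit.measure, PMF.ofFintype_apply, ENNReal.toReal_ofReal (Complex.normSq_nonneg _)]

theorem QCircuit.pathSum_allPaths_gates (C : QCircuit) (x : Fin C.qubits → Bool) :
    pathSum (allPaths C.gates [(fun _ => false, 0)]) x
      = (Real.sqrt 2 : ℂ) ^ (C.gates.map Gate.hadCount).sum * C.finalState x := by
  have hzero : pathSum [((fun _ => false : Fin C.qubits → Bool), 0)] = zeroState C.qubits := by
    funext x
    simp [pathSum, zeroState, eq_comm]
  rw [pathSum_allPaths, hzero, QCircuit.finalState]

theorem QCircuit.toReal_measure_eq_outcomeNum (C : QCircuit) (x : Fin C.qubits → Bool) :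
    (C.measure x).toReal = outcomeNum C.encode (List.ofFn x) / 2 ^ (pathRun C.encode).2.1 := by
  have hnorm := congrArg Complex.normSq (C.pathSum_allPaths_gates x)
  rw [Complex.normSq_mul, map_pow, Complex.normSq_ofReal, Real.mul_self_sqrt (by norm_num),
    pathSum_eq_phaseCount, Complex.normSq_mk] at hnorm
  rw [C.toReal_measure, outcomeNum, pathRun_encode, eq_div_iff (by positivity), mul_comm, ← hnorm]
  push_cast
  rw [cast_sqDiff, cast_sqDiff]
  ring

theorem outcomeNum_encode_eq_zero (C : QCircuit) {w : List Bool}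
    (hw : ∀ x : Fin C.qubits → Bool, w ≠ List.ofFn x) : outcomeNum C.encode w = 0 := by
  have hcount (j : ℕ) : phaseCount (pathRun C.encode).2.2 w j = 0 := by
    rw [pathRun_encode]
    simp only [phaseCount, pathList, List.map_map, List.sum_eq_zero_iff, List.mem_map]
    rintro k ⟨y, -, rfl⟩
    simp [(hw y.1).symm]
  simp [outcomeNum, hcount, sqDiff]

theorem primrec_readNat : Primrec readNat :=
  Primrec.list_length.comp (Primrec.list_takeWhile Primrec.id)

theorem primrec_readRest : Primrec readRest :=
  Primrec.list_tail.comp (Primrec.list_dropWhile Primrec.id)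

section Primrec

variable {α : Type*} [Primcodable α]

theorem primrec_toNat {f : α → Bool} (hf : Primrec f) : Primrec fun a => (f a).toNat :=
  (Primrec.dom_bool Bool.toNat).comp hf

theorem primrec_set {f : α → List Bool} {g : α → ℕ} {h : α → Bool} (hf : Primrec f)
    (hg : Primrec g) (hh : Primrec h) : Primrec fun a => (f a).set (g a) (h a) :=
  Primrec.list_set.comp hf (hg.pair hh)

theorem primrec_getD {f : α → List Bool} {g : α → ℕ} (hf : Primrec f) (hg : Primrec g) :
    Primrec fun a => (f a).getD (g a) false :=
  (Primrec.list_getD false).comp hf hg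

theorem primrec_flipIf {b : α → Bool} {t : α → ℕ} {f : α → List Bool} (hb : Primrec b)
    (ht : Primrec t) (hf : Primrec f) : Primrec fun a => flipIf (b a) (t a) (f a) :=
  Primrec.ite (Primrec.eq.comp hb (Primrec.const true))
    (primrec_set hf ht (Primrec.not.comp (primrec_getD hf ht))) hf

theorem primrec_had_branch {i : α → ℕ} {x : α → List Bool} {k : α → ℕ} (hi : Primrec i)
    (hx : Primrec x) (hk : Primrec k) : Primrec fun a =>
      [((x a).set (i a) false, k a),
        ((x a).set (i a) true, k a + 2 * ((x a).getD (i a) false).toNat)] :=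
  Primrec.list_cons.comp ((primrec_set hx hi (Primrec.const false)).pair hk)
    (Primrec.list_cons.comp ((primrec_set hx hi (Primrec.const true)).pair
      (Primrec.nat_add.comp hk
        (Primrec.nat_double.comp (primrec_toNat (primrec_getD hx hi)))))
      (Primrec.const []))

theorem primrec_sqDiff {f g : α → ℕ} (hf : Primrec f) (hg : Primrec g) :
    Primrec fun a => sqDiff (f a) (g a) :=
  Primrec.nat_add.comp
    (Primrec.nat_mul.comp (Primrec.nat_sub.comp hf hg) (Primrec.nat_sub.comp hf hg))
    (Primrec.nat_mul.comp (Primrec.nat_sub.comp hg hf) (Primrec.nat_sub.comp hg hf))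

theorem primrec_phaseCount {L : α → List (List Bool × ℕ)} {w : α → List Bool} (hL : Primrec L)
    (hw : Primrec w) (j : ℕ) : Primrec fun a => phaseCount (L a) (w a) j := by
  have hend : PrimrecPred fun z : α × List Bool × ℕ => z.2.1 = w z.1 :=
    Primrec.eq.comp (Primrec.fst.comp Primrec.snd) (hw.comp Primrec.fst)
  have hphase : PrimrecPred fun z : α × List Bool × ℕ => z.2.2 % 4 = j :=
    Primrec.eq.comp (Primrec.nat_mod.comp (Primrec.snd.comp Primrec.snd) (Primrec.const 4))
      (Primrec.const j)
  exact primrec_sum_map hL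
    (Primrec.ite (hend.and hphase) (Primrec.const 1) (Primrec.const 0)).to₂

end Primrec

theorem primrec_pathStep : Primrec pathStep := by
  have hr : Primrec fun c : PathConfig => c.1.tail.tail :=
    Primrec.list_tail.comp (Primrec.list_tail.comp Primrec.fst)
  have hr₁ := primrec_readRest.comp hr
  have hr₂ := primrec_readRest.comp hr₁
  have hhads : Primrec fun c : PathConfig => c.2.1 := Primrec.fst.comp Primrec.snd
  have hpaths : Primrec fun c : PathConfig => c.2.2 := Primrec.snd.comp Primrec.snd
  have hx : Primrec fun z : PathConfig × List Bool × ℕ => z.2.1 := Primrec.fst.comp Primrec.snd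
  have hk : Primrec fun z : PathConfig × List Bool × ℕ => z.2.2 := Primrec.snd.comp Primrec.snd
  have hindex {r : PathConfig → List Bool} (h : Primrec r) :
      Primrec fun z : PathConfig × List Bool × ℕ => readNat (r z.1) :=
    (primrec_readNat.comp h).comp Primrec.fst
  have hbit {r : PathConfig → List Bool} (h : Primrec r) :
      Primrec fun z : PathConfig × List Bool × ℕ => z.2.1.getD (readNat (r z.1)) false :=
    primrec_getD hx (hindex h)
  have hhead {r : PathConfig → List Bool} (h : Primrec r) :
      PrimrecPred fun c => (r c).headI = false :=
    Primrec.eq.comp (Primrec.list_headI.comp h) (Primrec.const false)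
  have hsecond := hhead (Primrec.list_tail.comp Primrec.fst)
  refine Primrec.ite (Primrec.eq.comp Primrec.fst (Primrec.const [])) Primrec.id
    (Primrec.ite (hhead Primrec.fst) (Primrec.ite hsecond ?_ ?_) (Primrec.ite hsecond ?_ ?_))
  · exact hr₁.pair ((Primrec.succ.comp hhads).pair
      (Primrec.list_flatMap hpaths (primrec_had_branch (hindex hr) hx hk).to₂))
  · exact hr₁.pair (hhads.pair (Primrec.list_map hpaths
      (hx.pair (Primrec.nat_add.comp hk (primrec_toNat (hbit hr)))).to₂))
  · exact hr₂.pair (hhads.pair (Primrec.list_map hpaths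
      ((primrec_flipIf (hbit hr) (hindex hr₁) hx).pair hk).to₂))
  · exact (primrec_readRest.comp hr₂).pair (hhads.pair (Primrec.list_map hpaths
      ((primrec_flipIf (Primrec.and.comp (hbit hr) (hbit hr₁)) (hindex hr₂) hx).pair hk).to₂))

theorem primrec_pathRun : Primrec pathRun := by
  have hzero : Primrec fun E : List Bool => (List.range (readNat E)).map fun _ => false :=
    Primrec.list_map (Primrec.list_range.comp primrec_readNat) (Primrec₂.const false)
  have hstart : Primrec fun E : List Bool =>
      ((readRest E, 0, [((List.range (readNat E)).map fun _ => false, 0)]) : PathConfig) :=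
    primrec_readRest.pair ((Primrec.const 0).pair
      (Primrec.list_cons.comp (hzero.pair (Primrec.const 0)) (Primrec.const [])))
  exact Primrec.nat_iterate Primrec.list_length hstart (primrec_pathStep.comp Primrec.snd).to₂

theorem primrec_outcomeNum : Primrec₂ outcomeNum := by
  have hcount (j : ℕ) : Primrec fun z : List Bool × List Bool =>
      phaseCount (pathRun z.1).2.2 z.2 j :=
    primrec_phaseCount (Primrec.snd.comp (Primrec.snd.comp (primrec_pathRun.comp Primrec.fst)))
      Primrec.snd j
  exact (Primrec.nat_add.comp (primrec_sqDiff (hcount 0) (hcount 2))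
    (primrec_sqDiff (hcount 1) (hcount 3))).to₂

/-! ### Expectations and the statistical distance -/

/-- The expectation of a test function under a probability distribution. It is only used for test
functions with values in `[0, 1]`, for which the series converges. -/
noncomputable def expectation {α : Type*} (p : PMF α) (r : α → ℝ) : ℝ := ∑' a, (p a).toReal * r a

section Expectation

variable {α β : Type*} (p q : PMF α)

theorem summable_toReal : Summable fun a => (p a).toReal :=
  ENNReal.summable_toReal p.tsum_coe_ne_top

theorem tsum_toReal : ∑' a, (p a).toReal = 1 := by
  rw [← ENNReal.tsum_toReal_eq p.apply_ne_top, p.tsum_coe, ENNReal.toReal_one]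

theorem sum_toReal [Fintype α] : ∑ a, (p a).toReal = 1 :=
  (tsum_fintype _).symm.trans (tsum_toReal p)

theorem sum_toReal_le_one (s : Finset α) : ∑ a ∈ s, (p a).toReal ≤ 1 :=
  ((summable_toReal p).sum_le_tsum s fun _ _ => ENNReal.toReal_nonneg).trans_eq (tsum_toReal p)

theorem summable_toReal_mul {r : α → ℝ} (hr : ∀ a, r a ∈ Set.Icc 0 1) :
    Summable fun a => (p a).toReal * r a :=
  (summable_toReal p).of_nonneg_of_le (fun a => mul_nonneg ENNReal.toReal_nonneg (hr a).1)
    fun a => mul_le_of_le_one_right ENNReal.toReal_nonneg (hr a).2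

theorem expectation_le_expectation_mul_add {r e : α → ℝ} (hr : ∀ a, r a ∈ Set.Icc 0 1)
    (he : ∀ a, e a ∈ Set.Icc 0 1) :
    expectation p r ≤ expectation p (fun a => r a * e a) + (1 - expectation p e) := by
  have hre (a : α) : r a * e a ∈ Set.Icc (0 : ℝ) 1 :=
    ⟨mul_nonneg (hr a).1 (he a).1, mul_le_one₀ (hr a).2 (he a).1 (he a).2⟩
  have hp := summable_toReal p
  have hsum := summable_toReal_mul p hr
  have hsum' := summable_toReal_mul p he
  have hsum'' := summable_toReal_mul p hre
  rw [expectation, expectation, expectation, ← tsum_toReal p, ← hp.tsum_sub hsum',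
    ← hsum''.tsum_add (hp.sub hsum')]
  refine hsum.tsum_le_tsum (fun a => ?_) (hsum''.add (hp.sub hsum'))
  have hpa : 0 ≤ (p a).toReal := ENNReal.toReal_nonneg
  nlinarith [mul_nonneg hpa (mul_nonneg (sub_nonneg.2 (hr a).2) (sub_nonneg.2 (he a).2))]

theorem toReal_map_apply [Fintype α] [DecidableEq β] (f : α → β) (b : β) :
    (p.map f b).toReal = ∑ a, if f a = b then (p a).toReal else 0 := by
  rw [PMF.map_apply, tsum_fintype, ENNReal.toReal_sum]
  · exact Finset.sum_congr rfl fun a _ => by split_ifs <;> simp_all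
  · intro a _
    split_ifs <;> simp [p.apply_ne_top]

theorem expectation_map [Fintype α] (f : α → β) (r : β → ℝ) :
    expectation (p.map f) r = ∑ a, (p a).toReal * r (f a) := by
  classical
  have hterm (b : β) : (p.map f b).toReal * r b
      = ∑ a, if b = f a then (p a).toReal * r (f a) else 0 := by
    rw [toReal_map_apply, Finset.sum_mul]
    refine Finset.sum_congr rfl fun a _ => ?_
    split_ifs with h h' h'
    · rw [h]
    · exact absurd h.symm h'
    · exact absurd h'.symm h
    · exact zero_mul _
  rw [expectation, tsum_congr hterm, Summable.tsum_finsetSum fun a _ =>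
    (hasSum_ite_eq (f a) _).summable]
  exact Finset.sum_congr rfl fun a _ => tsum_ite_eq (f a) _

theorem two_mul_expectation_sub {r : α → ℝ} (hr : ∀ a, r a ∈ Set.Icc 0 1) :
    2 * (expectation p r - expectation q r)
      = ∑' a, ((p a).toReal - (q a).toReal) * (2 * r a - 1) := by
  have hp := summable_toReal_mul p hr
  have hq := summable_toReal_mul q hr
  have hsub := (summable_toReal p).sub (summable_toReal q)
  have hzero : ∑' a, ((p a).toReal - (q a).toReal) = 0 := by
    rw [(summable_toReal p).tsum_sub (summable_toReal q), tsum_toReal, tsum_toReal, sub_self]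
  rw [expectation, expectation, ← hp.tsum_sub hq, ← tsum_mul_left, ← sub_zero (tsum _), ← hzero,
    ← ((hp.sub hq).mul_left 2).tsum_sub hsub]
  exact tsum_congr fun a => by ring

theorem expectation_sub_le_statDist {r : α → ℝ} (hr : ∀ a, r a ∈ Set.Icc 0 1) :
    expectation p r - expectation q r ≤ statDist p q := by
  have habs : Summable fun a => |(p a).toReal - (q a).toReal| :=
    ((summable_toReal p).sub (summable_toReal q)).abs
  have hterm (a : α) :
      |((p a).toReal - (q a).toReal) * (2 * r a - 1)| ≤ |(p a).toReal - (q a).toReal| := by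
    rw [abs_mul]
    exact mul_le_of_le_one_right (abs_nonneg _)
      (abs_le.2 ⟨by linarith [(hr a).1], by linarith [(hr a).2]⟩)
  have hle : ∑' a, ((p a).toReal - (q a).toReal) * (2 * r a - 1)
      ≤ ∑' a, |(p a).toReal - (q a).toReal| :=
    (habs.of_norm_bounded hterm).tsum_le_tsum (fun a => (le_abs_self _).trans (hterm a)) habs
  rw [statDist]
  linarith [two_mul_expectation_sub p q hr]

theorem statDist_le_of_expectation_sub_le {δ : ℝ}
    (h : ∀ r : α → ℝ, (∀ a, r a ∈ Set.Icc 0 1) → expectation p r - expectation q r ≤ δ) :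
    statDist p q ≤ δ := by
  classical
  let r : α → ℝ := fun a => if (q a).toReal ≤ (p a).toReal then 1 else 0
  have hr (a : α) : r a ∈ Set.Icc (0 : ℝ) 1 := by
    simp only [r]
    split_ifs <;> simp
  have habs (a : α) :
      |(p a).toReal - (q a).toReal| = ((p a).toReal - (q a).toReal) * (2 * r a - 1) := by
    simp only [r]
    split_ifs with ha
    · rw [abs_of_nonneg (sub_nonneg.2 ha)]
      ring
    · rw [abs_of_nonpos (by linarith)]
      ring
  rw [statDist, tsum_congr habs, ← two_mul_expectation_sub p q hr]
  linarith [h r hr]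

theorem statDist_comm : statDist p q = statDist q p := by
  simp only [statDist, abs_sub_comm]

theorem toReal_mem_Icc (b : α) : (p b).toReal ∈ Set.Icc (0 : ℝ) 1 :=
  ⟨ENNReal.toReal_nonneg,
    ENNReal.toReal_le_of_le_ofReal zero_le_one (by simpa using p.coe_le_one b)⟩

theorem toReal_bind_apply (f : α → PMF β) (b : β) :
    (p.bind f b).toReal = expectation p fun a => (f a b).toReal := by
  rw [expectation, PMF.bind_apply, ENNReal.tsum_toReal_eq fun a =>
    ENNReal.mul_ne_top (p.apply_ne_top a) ((f a).apply_ne_top b)]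
  exact tsum_congr fun a => ENNReal.toReal_mul

end Expectation

/-! ### From proofs of quantumness to quantum advantage samplers -/

theorem acceptProb_sub_le_statDist (V : UnboundedVerifier) (lam : ℕ) (D E : PMF (List Bool)) :
    V.acceptProb lam D - V.acceptProb lam E ≤ statDist D E := by
  rw [UnboundedVerifier.acceptProb, UnboundedVerifier.acceptProb, toReal_bind_apply,
    toReal_bind_apply]
  exact expectation_sub_le_statDist D E fun τ => toReal_mem_Icc _ true

theorem IsNonInteractiveIVPoQOn.isQASOn {S : Set ℕ} {P : QPTSampler} {V : UnboundedVerifier}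
    (h : IsNonInteractiveIVPoQOn S P V) : IsQASOn S P := by
  obtain ⟨c, s, q, hq, hgap, ⟨lam₀, hcomplete⟩, hsound⟩ := h
  refine ⟨2 * q, fun n => by simpa using hq n, fun B => ?_⟩
  obtain ⟨lam₁, hB⟩ := hsound B
  refine ⟨max lam₀ lam₁, fun lam hlam hle => ?_⟩
  have hlt : 1 / (2 * q).eval (lam : ℝ) < 1 / q.eval (lam : ℝ) := by
    have := hq lam
    refine one_div_lt_one_div_of_lt this ?_
    rw [Polynomial.eval_mul, Polynomial.eval_ofNat]
    linarith
  linarith [hgap lam, hcomplete lam (le_of_max_le_left hle), hB lam hlam (le_of_max_le_right hle),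
    acceptProb_sub_le_statDist V lam (P.dist lam) (B.dist lam)]

/-! ### The likelihood ratio verifier -/

/-- An enumeration of the clocked classical algorithms: the code of a program and the coefficients
of the polynomials that bound its random bits and its running time. -/
def machine (i : ℕ) : ℕ × List ℕ × List ℕ :=
  ((Encodable.decode i : Option (ℕ × List ℕ × List ℕ))).getD (0, [], [])

theorem machine_encode (x : ℕ × List ℕ × List ℕ) : machine (Encodable.encode x) = x := by
  rw [machine, Encodable.encodek, Option.getD_some]

/-- The number of random bits of the `i`-th algorithm. -/
def machineCoins (i lam : ℕ) : ℕ := evalCoeffs (machine i).2.1 lam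

/-- The output of the `i`-th algorithm on the random seed `r`. -/
def machineOut (i lam : ℕ) (r : List Bool) : List Bool :=
  interp (machine i).1 (evalCoeffs (machine i).2.2 lam) [unary lam, r]

/-- The number of seeds for which the `i`-th algorithm outputs `τ`. -/
def seedCount (i lam : ℕ) (τ : List Bool) : ℕ :=
  ((bitStrings (machineCoins i lam)).map fun r => if machineOut i lam r = τ then 1 else 0).sum

/-- An exponent such that the output probabilities of the first `lam + 1` algorithms have the
common denominator `2 ^ mixExp lam`. -/
def mixExp (lam : ℕ) : ℕ := ((List.range (lam + 1)).map fun i => machineCoins i lam).sum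

/-- The numerator of the sum of the probabilities of `τ` under the first `lam + 1` algorithms. -/
def mixNum (lam : ℕ) (τ : List Bool) : ℕ :=
  ((List.range (lam + 1)).map fun i =>
    seedCount i lam τ * 2 ^ (mixExp lam - machineCoins i lam)).sum

/-- Accept `τ` if the uniform mixture of the first `lam + 1` classical algorithms gives it at most
`R` times its probability under the circuit with description `E`. -/
def ratioTest (E : List Bool) (lam R : ℕ) (τ : List Bool) : Bool :=
  decide (mixNum lam τ * 2 ^ (pathRun E).2.1 ≤ (lam + 1) * R * outcomeNum E τ * 2 ^ mixExp lam)

theorem primrec_machine : Primrec machine :=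
  Primrec.option_getD.comp Primrec.decode (Primrec.const _)

theorem primrec_machineCoins : Primrec₂ machineCoins :=
  primrec_evalCoeffs.comp
    (Primrec.fst.comp (Primrec.snd.comp (primrec_machine.comp Primrec.fst))) Primrec.snd

theorem primrec_machineOut :
    Primrec fun z : (ℕ × ℕ) × List Bool => machineOut z.1.1 z.1.2 z.2 := by
  have hmachine : Primrec fun z : (ℕ × ℕ) × List Bool => machine z.1.1 :=
    primrec_machine.comp (Primrec.fst.comp Primrec.fst)
  have hlam : Primrec fun z : (ℕ × ℕ) × List Bool => z.1.2 := Primrec.snd.comp Primrec.fst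
  exact primrec_interp (Primrec.fst.comp hmachine)
    (primrec_evalCoeffs.comp (Primrec.snd.comp (Primrec.snd.comp hmachine)) hlam)
    (Primrec.list_cons.comp (primrec_unary.comp hlam)
      (Primrec.list_cons.comp Primrec.snd (Primrec.const [])))

theorem primrec_seedCount :
    Primrec fun z : (ℕ × ℕ) × List Bool => seedCount z.1.1 z.1.2 z.2 := by
  have hout : Primrec fun z : ((ℕ × ℕ) × List Bool) × List Bool =>
      machineOut z.1.1.1 z.1.1.2 z.2 :=
    (primrec_machineOut.comp (Primrec.pair (Primrec.fst.comp Primrec.fst) Primrec.snd :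
      Primrec fun z : ((ℕ × ℕ) × List Bool) × List Bool => (z.1.1, z.2)) :)
  have hseeds : Primrec fun z : (ℕ × ℕ) × List Bool => bitStrings (machineCoins z.1.1 z.1.2) :=
    primrec_bitStrings.comp (primrec_machineCoins.comp
      (Primrec.fst.comp Primrec.fst) (Primrec.snd.comp Primrec.fst))
  have hindicator : Primrec₂ fun (z : (ℕ × ℕ) × List Bool) (r : List Bool) =>
      if machineOut z.1.1 z.1.2 r = z.2 then 1 else 0 :=
    Primrec.ite (Primrec.eq.comp hout (Primrec.snd.comp Primrec.fst))
      (Primrec.const 1) (Primrec.const 0)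
  exact primrec_sum_map hseeds hindicator

theorem primrec_mixExp : Primrec mixExp :=
  primrec_sum_map (Primrec.list_range.comp Primrec.succ) primrec_machineCoins.swap

theorem primrec_mixNum : Primrec₂ mixNum := by
  have hlam : Primrec fun z : (ℕ × List Bool) × ℕ => z.1.1 := Primrec.fst.comp Primrec.fst
  have hscale : Primrec fun z : (ℕ × List Bool) × ℕ =>
      2 ^ (mixExp z.1.1 - machineCoins z.2 z.1.1) :=
    primrec_pow.comp (Primrec.const 2) (Primrec.nat_sub.comp (primrec_mixExp.comp hlam)
      (primrec_machineCoins.comp Primrec.snd hlam))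
  have hcount : Primrec fun z : (ℕ × List Bool) × ℕ => seedCount z.2 z.1.1 z.1.2 :=
    (primrec_seedCount.comp ((Primrec.snd.pair hlam).pair (Primrec.snd.comp Primrec.fst)) :)
  exact primrec_sum_map (Primrec.list_range.comp (Primrec.succ.comp Primrec.fst))
    (Primrec.nat_mul.comp hcount hscale).to₂

theorem primrec_ratioTest {E : ℕ → List Bool} {R : ℕ → ℕ} (hE : Primrec E) (hR : Primrec R) :
    Primrec fun z : ℕ × List Bool => ratioTest (E z.1) z.1 (R z.1) z.2 := by
  have hleft : Primrec fun z : ℕ × List Bool => mixNum z.1 z.2 * 2 ^ (pathRun (E z.1)).2.1 :=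
    Primrec.nat_mul.comp primrec_mixNum (primrec_pow.comp (Primrec.const 2)
      (Primrec.fst.comp (Primrec.snd.comp (primrec_pathRun.comp (hE.comp Primrec.fst)))))
  have hright : Primrec fun z : ℕ × List Bool =>
      (z.1 + 1) * R z.1 * outcomeNum (E z.1) z.2 * 2 ^ mixExp z.1 :=
    Primrec.nat_mul.comp (Primrec.nat_mul.comp
      (Primrec.nat_mul.comp (Primrec.succ.comp Primrec.fst) (hR.comp Primrec.fst))
      (primrec_outcomeNum.comp (hE.comp Primrec.fst) Primrec.snd))
      (primrec_pow.comp (Primrec.const 2) (primrec_mixExp.comp Primrec.fst))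
  exact (Primrec.nat_le.comp hleft hright).decide

theorem primrec_encode_circuit (P : QPTSampler) :
    Primrec fun lam => (P.circuit lam).encode :=
  (primrec_interp (Primrec.const P.genProg.code)
    (Primrec.nat_double.comp (primrec_polynomial_eval P.genTime))
    (Primrec.list_cons.comp primrec_unary (Primrec.const []))).of_eq
    fun lam => (P.gen_computes lam).interp_eq le_rfl

/-- The deterministic verifier that applies `ratioTest` for the circuits of `P`. -/
def ratioVerifier (P : QPTSampler) (R : Polynomial ℕ) : UnboundedVerifier where
  coins _ _ := 0
  verdict lam τ _ := ratioTest (P.circuit lam).encode lam (R.eval lam) τ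
  coins_computable := Computable.const 0
  verdict_computable :=
    ((primrec_ratioTest (primrec_encode_circuit P) (primrec_polynomial_eval R)).comp
      (Primrec.fst.pair (Primrec.fst.comp Primrec.snd))).to_comp

theorem acceptProb_ratioVerifier (P : QPTSampler) (R : Polynomial ℕ) (lam : ℕ)
    (D : PMF (List Bool)) : (ratioVerifier P R).acceptProb lam D = expectation D fun τ =>
      if ratioTest (P.circuit lam).encode lam (R.eval lam) τ then 1 else 0 := by
  have hrun (τ : List Bool) : (ratioVerifier P R).run lam τ
      = PMF.pure (ratioTest (P.circuit lam).encode lam (R.eval lam) τ) :=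
    PMF.map_const _ _
  rw [UnboundedVerifier.acceptProb, toReal_bind_apply]
  refine congrArg (expectation D) (funext fun τ => ?_)
  rw [hrun, PMF.pure_apply]
  cases ratioTest (P.circuit lam).encode lam (R.eval lam) τ <;> simp

/-! ### The mixture of the first classical algorithms -/

/-- The sum of the probabilities of `τ` under the first `lam + 1` classical algorithms. -/
noncomputable def mixWeight (lam : ℕ) (τ : List Bool) : ℝ := mixNum lam τ / 2 ^ mixExp lam

theorem sum_map_bitStrings_succ (n : ℕ) (f : List Bool → ℕ) : ((bitStrings (n + 1)).map f).sum
    = ((bitStrings n).map fun l => f (false :: l) + f (true :: l)).sum := by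
  rw [bitStrings]
  induction bitStrings n with
  | nil => rfl
  | cons l ls ih =>
    simp only [List.flatMap_cons, List.map_append, List.sum_append, List.map_cons, List.sum_cons,
      ih, List.map_nil, List.sum_nil]
    ring

theorem sum_map_bitStrings (n : ℕ) (f : List Bool → ℕ) :
    ((bitStrings n).map f).sum = ∑ x : Fin n → Bool, f (List.ofFn x) := by
  induction n generalizing f with
  | zero => simp [bitStrings]
  | succ n ih =>
    rw [sum_map_bitStrings_succ, ih, ← (Fin.consEquiv fun _ => Bool).sum_comp,
      Fintype.sum_prod_type, Fintype.sum_bool, add_comm, ← Finset.sum_add_distrib]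
    simp [Fin.consEquiv, List.ofFn_succ]

theorem seedCount_eq_sum (i lam : ℕ) (τ : List Bool) : seedCount i lam τ
    = ∑ x : Fin (machineCoins i lam) → Bool,
        if machineOut i lam (List.ofFn x) = τ then 1 else 0 := by
  rw [seedCount, sum_map_bitStrings]

theorem sum_seedCount_le (i lam : ℕ) (F : Finset (List Bool)) :
    ∑ τ ∈ F, seedCount i lam τ ≤ 2 ^ machineCoins i lam := by
  simp only [seedCount_eq_sum]
  rw [Finset.sum_comm]
  calc _ ≤ ∑ x : Fin (machineCoins i lam) → Bool, 1 := by
        refine Finset.sum_le_sum fun x _ => ?_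
        rw [Finset.sum_ite_eq]
        split_ifs <;> simp
    _ = _ := by simp

theorem machineCoins_le_mixExp {i lam : ℕ} (h : i ≤ lam) : machineCoins i lam ≤ mixExp lam :=
  List.single_le_sum (by simp) _ (List.mem_map.2 ⟨i, List.mem_range.2 (Nat.lt_succ_of_le h), rfl⟩)

theorem mixNum_eq_sum (lam : ℕ) (τ : List Bool) : mixNum lam τ
    = ∑ i ∈ Finset.range (lam + 1), seedCount i lam τ * 2 ^ (mixExp lam - machineCoins i lam) :=
  rfl

theorem sum_mixNum_le (lam : ℕ) (F : Finset (List Bool)) :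
    ∑ τ ∈ F, mixNum lam τ ≤ (lam + 1) * 2 ^ mixExp lam := by
  simp only [mixNum_eq_sum]
  rw [Finset.sum_comm]
  calc _ ≤ ∑ i ∈ Finset.range (lam + 1), 2 ^ mixExp lam := by
        refine Finset.sum_le_sum fun i hi => ?_
        have hle := machineCoins_le_mixExp (Finset.mem_range_succ_iff.1 hi)
        rw [← Finset.sum_mul]
        refine (Nat.mul_le_mul_right _ (sum_seedCount_le i lam F)).trans_eq ?_
        rw [← pow_add, Nat.add_sub_cancel' hle]
    _ = _ := by simp

theorem sum_mixWeight_le (lam : ℕ) (F : Finset (List Bool)) :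
    ∑ τ ∈ F, mixWeight lam τ ≤ lam + 1 := by
  simp only [mixWeight]
  rw [← Finset.sum_div, div_le_iff₀ (by positivity)]
  exact_mod_cast sum_mixNum_le lam F

theorem dist_map_coinFlips {α : Type*} (m : ℕ) (f : List Bool → α) :
    (coinFlips m).map f = (PMF.uniformOfFintype (Fin m → Bool)).map fun x => f (List.ofFn x) := by
  rw [coinFlips, PMF.map_comp]
  rfl

theorem toReal_uniformOfFintype_bool (m : ℕ) (x : Fin m → Bool) :
    (PMF.uniformOfFintype (Fin m → Bool) x).toReal = 1 / 2 ^ m := by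
  simp [PMF.uniformOfFintype_apply]

theorem PPTSampler.exists_machine (B : PPTSampler) : ∃ i,
    (∀ lam, machineCoins i lam = B.coins.eval lam) ∧
      ∀ lam r, r.length = B.coins.eval lam → machineOut i lam r = B.out lam r := by
  obtain ⟨c, hc⟩ := exists_evalCoeffs_eq_eval B.coins
  obtain ⟨t, ht⟩ := exists_evalCoeffs_eq_eval (2 * B.time)
  refine ⟨Encodable.encode (B.prog.code, c, t), fun lam => ?_, fun lam r hr => ?_⟩
  · rw [machineCoins, machine_encode, hc]
  · rw [machineOut, machine_encode]
    exact (B.computes lam r hr).interp_eq (by simp [ht])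

theorem PPTSampler.exists_dist_eq_seedCount (B : PPTSampler) : ∃ i, ∀ lam τ,
    (B.dist lam τ).toReal = seedCount i lam τ / 2 ^ machineCoins i lam := by
  obtain ⟨i, hcoins, hout⟩ := B.exists_machine
  refine ⟨i, fun lam τ => ?_⟩
  rw [PPTSampler.dist, ← hcoins, dist_map_coinFlips, toReal_map_apply, seedCount_eq_sum]
  push_cast
  rw [Finset.sum_div]
  refine Finset.sum_congr rfl fun x _ => ?_
  rw [hout lam _ (by simp [hcoins]), toReal_uniformOfFintype_bool]
  split_ifs <;> simp

theorem PPTSampler.exists_dist_le_mixWeight (B : PPTSampler) :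
    ∃ i, ∀ lam ≥ i, ∀ τ, (B.dist lam τ).toReal ≤ mixWeight lam τ := by
  obtain ⟨i, hi⟩ := B.exists_dist_eq_seedCount
  refine ⟨i, fun lam hle τ => ?_⟩
  have hterm : seedCount i lam τ * 2 ^ (mixExp lam - machineCoins i lam) ≤ mixNum lam τ :=
    Finset.single_le_sum (f := fun i => seedCount i lam τ * 2 ^ (mixExp lam - machineCoins i lam))
      (fun _ _ => Nat.zero_le _) (Finset.mem_range.2 (Nat.lt_succ_of_le hle))
  have hscaled := Nat.mul_le_mul_right (2 ^ machineCoins i lam) hterm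
  rw [mul_assoc, ← pow_add, Nat.sub_add_cancel (machineCoins_le_mixExp hle)] at hscaled
  rw [hi, mixWeight, div_le_div_iff₀ (by positivity) (by positivity)]
  exact_mod_cast hscaled

section RatioTest

variable (C : QCircuit) {lam R : ℕ}

theorem ratioTest_ofFn_iff (x : Fin C.qubits → Bool) :
    ratioTest C.encode lam R (List.ofFn x) = true ↔
      mixWeight lam (List.ofFn x) ≤ (lam + 1) * R * (C.measure x).toReal := by
  rw [ratioTest, decide_eq_true_iff, mixWeight, C.toReal_measure_eq_outcomeNum, ← mul_div_assoc,
    div_le_div_iff₀ (by positivity) (by positivity)]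
  exact_mod_cast Iff.rfl

theorem mixWeight_eq_zero_of_ratioTest {w : List Bool}
    (h : w ∉ Set.range (List.ofFn (n := C.qubits)))
    (hw : ratioTest C.encode lam R w = true) : mixWeight lam w = 0 := by
  rw [ratioTest, decide_eq_true_iff, outcomeNum_encode_eq_zero C fun x hx => h ⟨x, hx.symm⟩] at hw
  simpa [mixWeight] using hw

theorem sum_measure_rejected_le (hR : 0 < R) :
    ∑ x, (C.measure x).toReal * (if ratioTest C.encode lam R (List.ofFn x) then 0 else 1)
      ≤ 1 / (R : ℝ) := by
  have hscale : (0 : ℝ) < (lam + 1) * R := by positivity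
  have hterm (x : Fin C.qubits → Bool) :
      (C.measure x).toReal * (if ratioTest C.encode lam R (List.ofFn x) then 0 else 1)
        ≤ mixWeight lam (List.ofFn x) / ((lam + 1) * R) := by
    split_ifs with h
    · rw [mul_zero]
      exact div_nonneg (div_nonneg (Nat.cast_nonneg _) (by positivity)) hscale.le
    · rw [ratioTest_ofFn_iff, not_le] at h
      rw [le_div_iff₀ hscale]
      linarith
  calc _ ≤ ∑ x : Fin C.qubits → Bool, mixWeight lam (List.ofFn x) / ((lam + 1) * R) :=
        Finset.sum_le_sum fun x _ => hterm x
    _ = (∑ τ ∈ Finset.univ.map ⟨_, List.ofFn_injective (n := C.qubits)⟩, mixWeight lam τ)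
          / ((lam + 1) * R) := by
        rw [Finset.sum_map, Finset.sum_div]
        rfl
    _ ≤ (lam + 1) / ((lam + 1) * R) :=
        div_le_div_of_nonneg_right (sum_mixWeight_le lam _) hscale.le
    _ = 1 / (R : ℝ) := by rw [div_mul_cancel_left₀ (by positivity), one_div]

end RatioTest

theorem acceptProb_ratioVerifier_ge {P : QPTSampler} (hP : ∀ lam w, P.post lam w = w)
    (R : Polynomial ℕ) {lam : ℕ} (hR : 0 < R.eval lam) :
    (ratioVerifier P R).acceptProb lam (P.dist lam) ≥ 1 - 1 / ((R.eval lam : ℕ) : ℝ) := by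
  rw [acceptProb_ratioVerifier, QPTSampler.dist, expectation_map]
  simp only [hP]
  have hrejected := sum_measure_rejected_le (P.circuit lam) (lam := lam) hR
  have htotal := sum_toReal (P.circuit lam).measure
  have hsplit : ∀ x, ((P.circuit lam).measure x).toReal
      = ((P.circuit lam).measure x).toReal * (if ratioTest (P.circuit lam).encode lam (R.eval lam)
          (List.ofFn x) then 1 else 0)
        + ((P.circuit lam).measure x).toReal * (if ratioTest (P.circuit lam).encode lam (R.eval lam)
          (List.ofFn x) then 0 else 1) := fun x => by split_ifs <;> simp
  rw [Finset.sum_congr rfl fun x _ => hsplit x, Finset.sum_add_distrib] at htotal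
  linarith

/-! ### Independent copies of a circuit -/

section Copies

variable {m n : ℕ}

/-- The gate `g` acting on the `j`-th of `m` blocks of `n` qubits. -/
def Gate.block (j : Fin m) : Gate n → Gate (m * n)
  | .had i => .had (finProdFinEquiv (j, i))
  | .phase i => .phase (finProdFinEquiv (j, i))
  | .cnot c t h => .cnot (finProdFinEquiv (j, c)) (finProdFinEquiv (j, t)) (by simpa using h)
  | .toffoli c d t hcd hct hdt => .toffoli (finProdFinEquiv (j, c)) (finProdFinEquiv (j, d))
      (finProdFinEquiv (j, t)) (by simpa using hcd) (by simpa using hct) (by simpa using hdt)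

/-- The decomposition of a basis state of `m * n` qubits into `m` blocks of `n` qubits. -/
def blocksEquiv : (Fin (m * n) → Bool) ≃ (Fin m → Fin n → Bool) :=
  (Equiv.arrowCongr finProdFinEquiv.symm (Equiv.refl Bool)).trans (Equiv.curry _ _ _)

theorem blocksEquiv_apply (x : Fin (m * n) → Bool) (j : Fin m) (i : Fin n) :
    blocksEquiv x j i = x (finProdFinEquiv (j, i)) := rfl

/-- The product of states of the blocks. -/
noncomputable def prodState (ψ : Fin m → QState n) : QState (m * n) :=
  fun x => ∏ j, ψ j (blocksEquiv x j)

theorem blocksEquiv_update (x : Fin (m * n) → Bool) (j : Fin m) (i : Fin n) (b : Bool) :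
    blocksEquiv (Function.update x (finProdFinEquiv (j, i)) b)
      = Function.update (blocksEquiv x) j (Function.update (blocksEquiv x j) i b) := by
  funext k l
  rcases eq_or_ne k j with rfl | hk
  · simp [blocksEquiv_apply, Function.update_apply]
  · simp [blocksEquiv_apply, hk]

theorem blocksEquiv_flipBit (x : Fin (m * n) → Bool) (j : Fin m) (i : Fin n) :
    blocksEquiv (flipBit (finProdFinEquiv (j, i)) x)
      = Function.update (blocksEquiv x) j (flipBit i (blocksEquiv x j)) :=
  blocksEquiv_update x j i _

theorem prodState_eq_mul_of_blocksEquiv (ψ : Fin m → QState n) {x y : Fin (m * n) → Bool}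
    {j : Fin m} {v : Fin n → Bool} (h : blocksEquiv y = Function.update (blocksEquiv x) j v) :
    prodState ψ y = ψ j v * ∏ k ∈ Finset.univ.erase j, ψ k (blocksEquiv x k) := by
  rw [prodState, ← Finset.mul_prod_erase _ _ (Finset.mem_univ j), h, Function.update_self]
  congr 1
  refine Finset.prod_congr rfl fun k hk => ?_
  rw [Function.update_of_ne (Finset.ne_of_mem_erase hk)]

theorem prodState_eq_mul (ψ : Fin m → QState n) (j : Fin m) (x : Fin (m * n) → Bool) :
    prodState ψ x
      = ψ j (blocksEquiv x j) * ∏ k ∈ Finset.univ.erase j, ψ k (blocksEquiv x k) :=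
  prodState_eq_mul_of_blocksEquiv ψ (Function.update_eq_self _ _).symm

theorem prodState_update (ψ : Fin m → QState n) (j : Fin m) (φ : QState n)
    (x : Fin (m * n) → Bool) : prodState (Function.update ψ j φ) x
      = φ (blocksEquiv x j) * ∏ k ∈ Finset.univ.erase j, ψ k (blocksEquiv x k) := by
  rw [prodState_eq_mul _ j, Function.update_self]
  congr 1
  refine Finset.prod_congr rfl fun k hk => ?_
  rw [Function.update_of_ne (Finset.ne_of_mem_erase hk)]

theorem Gate.apply_block_prodState (j : Fin m) (g : Gate n) (ψ : Fin m → QState n) :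
    (g.block j).apply (prodState ψ) = prodState (Function.update ψ j (g.apply (ψ j))) := by
  funext x
  have hbit (i : Fin n) : x (finProdFinEquiv (j, i)) = blocksEquiv x j i := rfl
  have hupdate (i : Fin n) (b : Bool) :=
    prodState_eq_mul_of_blocksEquiv ψ (blocksEquiv_update x j i b)
  have hflip (i : Fin n) := prodState_eq_mul_of_blocksEquiv ψ (blocksEquiv_flipBit x j i)
  rw [prodState_update]
  cases g with
  | had i =>
    simp only [Gate.block, Gate.apply, hupdate, hbit]
    ring
  | phase i =>
    simp only [Gate.block, Gate.apply, prodState_eq_mul ψ j, hbit]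
    split_ifs <;> ring
  | cnot c t h =>
    simp only [Gate.block, Gate.apply, hbit]
    split_ifs
    · exact hflip t
    · exact prodState_eq_mul ψ j x
  | toffoli c d t hcd hct hdt =>
    simp only [Gate.block, Gate.apply, hbit]
    split_ifs
    · exact hflip t
    · exact prodState_eq_mul ψ j x

theorem foldl_apply_block (j : Fin m) (gs : List (Gate n)) (ψ : Fin m → QState n) :
    (gs.map (Gate.block j)).foldl (fun ψ g => g.apply ψ) (prodState ψ)
      = prodState (Function.update ψ j (gs.foldl (fun ψ g => g.apply ψ) (ψ j))) := by
  induction gs generalizing ψ with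
  | nil => simp
  | cons g gs ih =>
    rw [List.map_cons, List.foldl_cons, Gate.apply_block_prodState, ih]
    simp

theorem foldl_apply_blocks (gs : List (Gate n)) (l : List (Fin m)) (hl : l.Nodup)
    (ψ : Fin m → QState n) :
    (l.flatMap fun j => gs.map (Gate.block j)).foldl (fun ψ g => g.apply ψ) (prodState ψ)
      = prodState fun j => if j ∈ l then gs.foldl (fun ψ g => g.apply ψ) (ψ j) else ψ j := by
  induction l generalizing ψ with
  | nil => simp
  | cons j l ih =>
    rw [List.nodup_cons] at hl
    rw [List.flatMap_cons, List.foldl_append, foldl_apply_block, ih hl.2]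
    congr 1
    funext k
    rcases eq_or_ne k j with rfl | hk
    · simp [hl.1]
    · simp [hk]

theorem prodState_zeroState : prodState (fun _ : Fin m => zeroState n) = zeroState (m * n) := by
  funext x
  by_cases h : x = fun _ => false
  · subst h
    exact (Finset.prod_eq_one fun j _ => if_pos rfl).trans (if_pos rfl).symm
  · obtain ⟨k, hk⟩ : ∃ k, x k ≠ false := Function.ne_iff.1 h
    rw [zeroState, if_neg h]
    refine Finset.prod_eq_zero (Finset.mem_univ (finProdFinEquiv.symm k).1)
      (if_neg fun hblock => hk ?_)
    rw [← finProdFinEquiv.apply_symm_apply k]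
    exact congrFun hblock _

/-- `m` independent copies of a circuit. -/
def QCircuit.copies (m : ℕ) (C : QCircuit) : QCircuit :=
  ⟨m * C.qubits, (List.finRange m).flatMap fun j => C.gates.map (Gate.block j)⟩

theorem QCircuit.finalState_copies (m : ℕ) (C : QCircuit) :
    (C.copies m).finalState = prodState (fun _ : Fin m => C.finalState) := by
  have h := foldl_apply_blocks C.gates (List.finRange m) (List.nodup_finRange m)
    fun _ => zeroState _
  rw [prodState_zeroState] at h
  refine h.trans ?_
  simp only [List.mem_finRange, if_true]
  rfl

theorem QCircuit.measure_copies (m : ℕ) (C : QCircuit) (x : Fin (m * C.qubits) → Bool) :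
    ((C.copies m).measure x).toReal = ∏ j, (C.measure (blocksEquiv x j)).toReal := by
  rw [QCircuit.toReal_measure (C.copies m) x, QCircuit.finalState_copies]
  simp only [QCircuit.toReal_measure, prodState, map_prod]

theorem take_drop_ofFn (x : Fin (m * n) → Bool) (j : Fin m) :
    ((List.ofFn x).drop (j * n)).take n = List.ofFn (blocksEquiv x j) := by
  have hj : (j : ℕ) * n + n ≤ m * n := by
    have := Nat.mul_le_mul_right n j.isLt
    rwa [Nat.succ_mul] at this
  refine List.ext_getElem (by simp; omega) fun k _ _ => ?_
  simp only [List.getElem_take, List.getElem_drop, List.getElem_ofFn, blocksEquiv_apply]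
  congr 1
  ext
  simp [finProdFinEquiv, mul_comm, add_comm]

end Copies

/-! ### Averages of independent variables under dominated weights -/

theorem sum_mul_exp_le {β : Type*} [Fintype β] {p f : β → ℝ} (hp : p ∈ stdSimplex ℝ β)
    (hf : ∀ b, f b ∈ Set.Icc 0 1) {u : ℝ} (hu : u ∈ Set.Icc 0 1) :
    ∑ b, p b * Real.exp (u * (f b - ∑ b, p b * f b)) ≤ Real.exp (u ^ 2) := by
  set μ := ∑ b, p b * f b with hμ
  have hμ0 : 0 ≤ μ := Finset.sum_nonneg fun b _ => mul_nonneg (hp.1 b) (hf b).1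
  have hμ1 : μ ≤ 1 :=
    (Finset.sum_le_sum fun b _ => mul_le_of_le_one_right (hp.1 b) (hf b).2).trans_eq hp.2
  have hterm (b : β) : p b * Real.exp (u * (f b - μ))
      ≤ p b * (1 + u ^ 2) + u * (p b * f b) - u * μ * p b := by
    have hdev : |f b - μ| ≤ 1 := abs_le.2 ⟨by linarith [(hf b).1], by linarith [(hf b).2]⟩
    have hdev_sq : (f b - μ) ^ 2 ≤ 1 := (sq_le_one_iff_abs_le_one _).2 hdev
    have hprod : |u * (f b - μ)| ≤ 1 := by
      rw [abs_mul, abs_of_nonneg hu.1]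
      exact mul_le_one₀ hu.2 (abs_nonneg _) hdev
    have hexp := (abs_le.1 (Real.abs_exp_sub_one_sub_id_le hprod)).2
    have hquad : Real.exp (u * (f b - μ)) ≤ 1 + u * (f b - μ) + u ^ 2 := by
      nlinarith [sq_nonneg u]
    linarith [mul_le_mul_of_nonneg_left hquad (hp.1 b)]
  calc _ ≤ ∑ b, (p b * (1 + u ^ 2) + u * (p b * f b) - u * μ * p b) :=
        Finset.sum_le_sum fun b _ => hterm b
    _ = u ^ 2 + 1 := by
        rw [Finset.sum_sub_distrib, Finset.sum_add_distrib, ← Finset.sum_mul, ← Finset.mul_sum,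
          ← Finset.mul_sum, hp.2, ← hμ]
        ring
    _ ≤ _ := Real.add_one_le_exp (u ^ 2)

theorem sum_prod_mul_exp_sum_le {ι β : Type*} [Fintype ι] [DecidableEq ι] [Fintype β]
    {p f : β → ℝ} (hp : p ∈ stdSimplex ℝ β) (hf : ∀ b, f b ∈ Set.Icc 0 1) {u : ι → ℝ}
    (hu : ∀ j, u j ∈ Set.Icc 0 1) :
    ∑ x : ι → β, (∏ j, p (x j)) * Real.exp (∑ j, u j * (f (x j) - ∑ b, p b * f b))
      ≤ Real.exp (∑ j, u j ^ 2) := by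
  set μ := ∑ b, p b * f b
  calc _ = ∏ j, ∑ b, p b * Real.exp (u j * (f b - μ)) := by
        rw [Finset.prod_univ_sum, Fintype.piFinset_univ]
        exact Finset.sum_congr rfl fun x _ => by rw [Real.exp_sum, Finset.prod_mul_distrib]
    _ ≤ ∏ j, Real.exp (u j ^ 2) :=
        Finset.prod_le_prod
          (fun j _ => Finset.sum_nonneg fun b _ => mul_nonneg (hp.1 b) (Real.exp_nonneg _))
          fun j _ => sum_mul_exp_le hp hf (hu j)
    _ = _ := (Real.exp_sum _ _).symm

theorem sum_mul_exp_sum_le {ι β : Type*} [Fintype ι] [DecidableEq ι] [Fintype β]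
    {p f : β → ℝ} (hp : p ∈ stdSimplex ℝ β) (hf : ∀ b, f b ∈ Set.Icc 0 1) {u : ι → ℝ}
    (hu : ∀ j, u j ∈ Set.Icc 0 1) {C : ℝ} (hC : 0 ≤ C) {D : (ι → β) → ℝ}
    (hDC : ∀ x, D x ≤ C * ∏ j, p (x j)) :
    ∑ x, D x * Real.exp (∑ j, u j * (f (x j) - ∑ b, p b * f b))
      ≤ C * Real.exp (∑ j, u j ^ 2) := by
  calc _ ≤ ∑ x : ι → β,
          C * ((∏ j, p (x j)) * Real.exp (∑ j, u j * (f (x j) - ∑ b, p b * f b))) := by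
        refine Finset.sum_le_sum fun x _ => ?_
        rw [← mul_assoc]
        exact mul_le_mul_of_nonneg_right (hDC x) (Real.exp_nonneg _)
    _ ≤ C * Real.exp (∑ j, u j ^ 2) := by
        rw [← Finset.mul_sum]
        exact mul_le_mul_of_nonneg_left (sum_prod_mul_exp_sum_le hp hf hu) hC

theorem sum_mul_le_one_add_log {α : Type*} [Fintype α] {D S : α → ℝ} {M : ℝ}
    (hD : ∀ x, 0 ≤ D x) (hD_sum : ∑ x, D x ≤ 1) (hM : 1 ≤ M)
    (h : ∑ x, D x * Real.exp (S x) ≤ M) : ∑ x, D x * S x ≤ 1 + Real.log M := by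
  have hM0 : 0 < M := zero_lt_one.trans_le hM
  have hterm (x : α) : D x * S x ≤ D x * Real.exp (S x) / M + D x * Real.log M := by
    have hexp := Real.add_one_le_exp (S x - Real.log M)
    rw [Real.exp_sub, Real.exp_log hM0] at hexp
    have := mul_le_mul_of_nonneg_left hexp (hD x)
    rw [mul_div_assoc]
    linarith [hD x]
  calc _ ≤ ∑ x, (D x * Real.exp (S x) / M + D x * Real.log M) :=
        Finset.sum_le_sum fun x _ => hterm x
    _ = (∑ x, D x * Real.exp (S x)) / M + (∑ x, D x) * Real.log M := by
        rw [Finset.sum_add_distrib, Finset.sum_div, Finset.sum_mul]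
    _ ≤ 1 + Real.log M :=
        add_le_add ((div_le_one hM0).2 h)
          (mul_le_of_le_one_left (Real.log_nonneg hM) hD_sum)

theorem sum_weighted_mean_le {ι β : Type*} [Fintype ι] [DecidableEq ι] [Fintype β] {p f : β → ℝ}
    (hp : p ∈ stdSimplex ℝ β) (hf : ∀ b, f b ∈ Set.Icc 0 1) {q : ι → ℝ}
    (hq : q ∈ stdSimplex ℝ ι) {t C : ℝ} (ht : 1 ≤ t) (hqt : ∀ j, q j ≤ 1 / t ^ 2) (hC : 1 ≤ C)
    {D : (ι → β) → ℝ} (hD : ∀ x, 0 ≤ D x) (hD_sum : ∑ x, D x ≤ 1)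
    (hDC : ∀ x, D x ≤ C * ∏ j, p (x j)) :
    ∑ x, D x * ∑ j, q j * f (x j) ≤ ∑ b, p b * f b + (2 + Real.log C) / t := by
  set μ := ∑ b, p b * f b
  have hμ0 : 0 ≤ μ := Finset.sum_nonneg fun b _ => mul_nonneg (hp.1 b) (hf b).1
  have ht0 : 0 < t := zero_lt_one.trans_le ht
  have hqt_mul (j : ι) : t * (t * q j) ≤ 1 := by
    have := (le_div_iff₀ (by positivity)).1 (hqt j)
    linarith
  have hu (j : ι) : t * q j ∈ Set.Icc (0 : ℝ) 1 := by
    have := mul_nonneg ht0.le (hq.1 j)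
    exact ⟨this, by nlinarith [hqt_mul j]⟩
  have hsq : ∑ j, (t * q j) ^ 2 ≤ 1 :=
    (Finset.sum_le_sum fun j _ => by nlinarith [hqt_mul j, hq.1 j]).trans_eq hq.2
  have hmoment : ∑ x, D x * Real.exp (∑ j, t * q j * (f (x j) - μ)) ≤ C * Real.exp 1 :=
    (sum_mul_exp_sum_le hp hf hu (by linarith) hDC).trans
      (mul_le_mul_of_nonneg_left (Real.exp_le_exp.2 hsq) (by linarith))
  have hdev := sum_mul_le_one_add_log hD hD_sum
    (one_le_mul_of_one_le_of_one_le hC (Real.one_le_exp zero_le_one)) hmoment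
  rw [Real.log_mul (by positivity) (Real.exp_ne_zero _), Real.log_exp] at hdev
  have hmean (x : ι → β) : ∑ j, t * q j * (f (x j) - μ) = t * ∑ j, q j * f (x j) - t * μ := by
    simp only [mul_sub, Finset.sum_sub_distrib, ← Finset.sum_mul, ← Finset.mul_sum, hq.2,
      mul_assoc]
    ring
  have hsplit : ∑ x, D x * ∑ j, t * q j * (f (x j) - μ)
      = t * ∑ x, D x * ∑ j, q j * f (x j) - (∑ x, D x) * (t * μ) := by
    rw [Finset.mul_sum, Finset.sum_mul, ← Finset.sum_sub_distrib]
    exact Finset.sum_congr rfl fun x _ => by rw [hmean]; ring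
  have htotal : (∑ x, D x) * (t * μ) ≤ t * μ := mul_le_of_le_one_left (by positivity) hD_sum
  rw [← sub_le_iff_le_add', le_div_iff₀ ht0]
  linarith

/-! ### The binomial distribution on blocks -/

theorem centralBinom_sq_le (k : ℕ) : k.centralBinom ^ 2 * (2 * k + 1) ≤ 16 ^ k := by
  induction k with
  | zero => simp
  | succ k ih =>
    have hscaled : (k + 1) ^ 2 * ((k + 1).centralBinom ^ 2 * (2 * (k + 1) + 1))
        = (4 * (2 * k + 1) * (2 * k + 3)) * (k.centralBinom ^ 2 * (2 * k + 1)) := by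
      calc _ = ((k + 1) * (k + 1).centralBinom) ^ 2 * (2 * (k + 1) + 1) := by ring
        _ = _ := by rw [Nat.succ_mul_centralBinom_succ]; ring
    have hfactor : 4 * (2 * k + 1) * (2 * k + 3) ≤ 16 * (k + 1) ^ 2 := by ring_nf; omega
    refine Nat.le_of_mul_le_mul_left ?_ (show 0 < (k + 1) ^ 2 by positivity)
    rw [hscaled]
    calc _ ≤ 16 * (k + 1) ^ 2 * 16 ^ k := Nat.mul_le_mul hfactor ih
      _ = _ := by ring

theorem choose_div_le {k j t : ℕ} (h : t ^ 4 ≤ 2 * k + 1) (ht : 0 < t) :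
    ((2 * k).choose j : ℝ) / 2 ^ (2 * k) ≤ 1 / (t : ℝ) ^ 2 := by
  have hsq : ((2 * k).choose j * t ^ 2) ^ 2 ≤ (2 ^ (2 * k)) ^ 2 :=
    calc _ = ((2 * k).choose j) ^ 2 * t ^ 4 := by ring
      _ ≤ k.centralBinom ^ 2 * (2 * k + 1) :=
        Nat.mul_le_mul (Nat.pow_le_pow_left (Nat.choose_le_centralBinom j k) 2) h
      _ ≤ 16 ^ k := centralBinom_sq_le k
      _ = _ := by rw [← pow_mul, show (16 : ℕ) = 2 ^ 4 by norm_num, ← pow_mul]; ring_nf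
  rw [div_le_div_iff₀ (by positivity) (by positivity), one_mul]
  exact_mod_cast (Nat.pow_le_pow_iff_left two_ne_zero).1 hsq

theorem sum_ite_count_true_eq (n j : ℕ) :
    (∑ x : Fin n → Bool, if (List.ofFn x).count true = j then 1 else 0) = n.choose j := by
  induction n generalizing j with
  | zero => cases j <;> simp
  | succ n ih =>
    rw [← (Fin.consEquiv fun _ => Bool).sum_comp, Fintype.sum_prod_type, Fintype.sum_bool]
    cases j with
    | zero => simpa [Fin.consEquiv, List.ofFn_succ] using ih 0
    | succ j =>
      rw [Nat.choose_succ_succ, ← ih j, ← ih (j + 1)]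
      simp [Fin.consEquiv, List.ofFn_succ]

/-! ### Running programs within time bounds -/

/-- Program `p` leads from the stacks `s` to the stacks `s'` within `T` steps. -/
def Runs (p : Prog) (s s' : Store) (T : ℕ) : Prop := ∃ t ≤ T, Exec p s s' t

namespace Runs

variable {p q : Prog} {s s' s'' : Store} {T T' i : ℕ} {b : Bool}

theorem mono (h : Runs p s s' T) (hT : T ≤ T') : Runs p s s' T' :=
  let ⟨t, ht, he⟩ := h
  ⟨t, ht.trans hT, he⟩

theorem congr (h : Runs p s s' T) (hs : s' = s'') (hT : T ≤ T') : Runs p s s'' T' :=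
  hs ▸ h.mono hT

theorem skip (s : Store) : Runs .skip s s 1 := ⟨1, le_rfl, .skip s⟩

theorem push (s : Store) (i : ℕ) (b : Bool) :
    Runs (.push i b) s (Function.update s i (b :: s i)) 1 := ⟨1, le_rfl, .push i b s⟩

theorem pop (s : Store) (i : ℕ) : Runs (.pop i) s (Function.update s i (s i).tail) 1 :=
  ⟨1, le_rfl, .pop i s⟩

theorem pop_cons {l : List Bool} (hs : s i = b :: l) :
    Runs (.pop i) s (Function.update s i l) 1 := by
  simpa only [hs, List.tail_cons] using Runs.pop s i

theorem seq (hp : Runs p s s' T) (hq : Runs q s' s'' T') : Runs (.seq p q) s s'' (T + T') :=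
  let ⟨_, ht, he⟩ := hp
  let ⟨_, ht', he'⟩ := hq
  ⟨_, Nat.add_le_add ht ht', .seq he he'⟩

theorem ifTop_pos (hs : (s i).head? = some b) (h : Runs p s s' T) :
    Runs (.ifTop i b p q) s s' (T + 1) :=
  let ⟨_, ht, he⟩ := h
  ⟨_, Nat.add_le_add_right ht 1, .ifTop_pos hs he⟩

theorem ifTop_neg (hs : (s i).head? ≠ some b) (h : Runs q s s' T) :
    Runs (.ifTop i b p q) s s' (T + 1) :=
  let ⟨_, ht, he⟩ := h
  ⟨_, Nat.add_le_add_right ht 1, .ifTop_neg hs he⟩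

theorem loop_done (hs : s i = []) : Runs (.loop i p) s s 1 := ⟨1, le_rfl, .loop_done hs⟩

theorem loop_step (hs : s i ≠ []) (hp : Runs p s s' T) (hloop : Runs (.loop i p) s' s'' T') :
    Runs (.loop i p) s s'' (T + T' + 1) :=
  let ⟨_, ht, he⟩ := hp
  let ⟨_, ht', he'⟩ := hloop
  ⟨_, Nat.add_le_add_right (Nat.add_le_add ht ht') 1, .loop_step hs he he'⟩

theorem loop (σ : ℕ → Store) (n : ℕ) (hne : ∀ k < n, σ k i ≠ []) (hn : σ n i = [])
    (h : ∀ k < n, Runs p (σ k) (σ (k + 1)) T) :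
    Runs (.loop i p) (σ 0) (σ n) (n * (T + 1) + 1) := by
  induction n generalizing σ with
  | zero => simpa using loop_done hn
  | succ n ih =>
    have hrest := ih (fun k => σ (k + 1)) (fun k hk => hne _ (by omega)) hn
      (fun k hk => h _ (by omega))
    exact (loop_step (hne 0 (by omega)) (h 0 (by omega)) hrest).mono (by ring_nf; omega)

theorem push_inputStore (L : List (List Bool)) (i : ℕ) (b : Bool) :
    Runs (.push i b) (inputStore L) (inputStore (setStack L i (b :: L.getD i []))) 1 :=
  inputStore_setStack L i _ ▸ Runs.push (inputStore L) i b

theorem pop_inputStore (L : List (List Bool)) (i : ℕ) :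
    Runs (.pop i) (inputStore L) (inputStore (setStack L i (L.getD i []).tail)) 1 :=
  inputStore_setStack L i _ ▸ Runs.pop (inputStore L) i

end Runs

theorem inputStore_append_replicate_nil (L : List (List Bool)) (n : ℕ) :
    inputStore (L ++ List.replicate n []) = inputStore L := by
  funext i
  simp only [inputStore, List.getD_eq_getElem?_getD]
  rcases lt_or_ge i L.length with h | h
  · rw [List.getElem?_append_left h]
  · rw [List.getElem?_append_right h, List.getElem?_eq_none h, List.getElem?_replicate]
    split_ifs <;> rfl

/-! ### Elementary subroutines -/

section Subroutines

variable {a b c : ℕ}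

/-- The program that moves stack `a` onto stack `b`, which reverses the order. -/
def moveProg (a b : ℕ) : Prog :=
  .loop a (.seq (.ifTop a true (.push b true) (.push b false)) (.pop a))

theorem runs_moveStep (hab : a ≠ b) {s : Store} {x : Bool} {l : List Bool} (hs : s a = x :: l) :
    Runs (.seq (.ifTop a true (.push b true) (.push b false)) (.pop a)) s
      (Function.update (Function.update s b (x :: s b)) a l) 3 := by
  have hpush : Runs (.ifTop a true (.push b true) (.push b false)) s
      (Function.update s b (x :: s b)) 2 := by
    cases x
    · exact .ifTop_neg (by simp [hs]) (.push s b false)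
    · exact .ifTop_pos (by simp [hs]) (.push s b true)
  exact hpush.seq (.pop_cons ((Function.update_of_ne hab _ _).trans hs))

theorem runs_moveProg (hab : a ≠ b) (s : Store) :
    Runs (moveProg a b) s (Function.update (Function.update s b ((s a).reverse ++ s b)) a [])
      (4 * (s a).length + 1) := by
  induction hs : s a generalizing s with
  | nil =>
    refine (Runs.loop_done hs).congr ?_ (by simp)
    rw [List.reverse_nil, List.nil_append, Function.update_eq_self, ← hs, Function.update_eq_self]
  | cons x l ih =>
    have hrest := ih _ (Function.update_self a l (Function.update s b (x :: s b)))
    refine (Runs.loop_step (by simp [hs]) (runs_moveStep hab hs) hrest).congr ?_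
      (by simp only [List.length_cons]; omega)
    funext i
    simp only [Function.update_apply]
    split_ifs <;> simp_all

theorem runs_moveProg_inputStore (hab : a ≠ b) (L : List (List Bool)) :
    Runs (moveProg a b) (inputStore L)
      (inputStore (setStack (setStack L b ((L.getD a []).reverse ++ L.getD b [])) a []))
      (4 * (L.getD a []).length + 1) := by
  simp only [inputStore_setStack]
  exact runs_moveProg hab (inputStore L)

/-- The program that moves stack `c` onto both stacks `a` and `b`. -/
def dupProg (c a b : ℕ) : Prog :=
  .loop c (.seq (.ifTop c true (.seq (.push a true) (.push b true))
    (.seq (.push a false) (.push b false))) (.pop c))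

theorem runs_dupStep (hca : c ≠ a) (hcb : c ≠ b) (hab : a ≠ b) {s : Store} {x : Bool}
    {l : List Bool} (hs : s c = x :: l) :
    Runs (.seq (.ifTop c true (.seq (.push a true) (.push b true))
      (.seq (.push a false) (.push b false))) (.pop c)) s
      (Function.update (Function.update (Function.update s a (x :: s a)) b (x :: s b)) c l) 4 := by
  have hpush (y : Bool) : Runs (.seq (.push a y) (.push b y)) s
      (Function.update (Function.update s a (y :: s a)) b (y :: s b)) 2 := by
    have h := Runs.push (Function.update s a (y :: s a)) b y
    rw [Function.update_of_ne hab.symm] at h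
    exact (Runs.push s a y).seq h
  have hdup : Runs (.ifTop c true (.seq (.push a true) (.push b true))
      (.seq (.push a false) (.push b false))) s
      (Function.update (Function.update s a (x :: s a)) b (x :: s b)) 3 := by
    cases x
    · exact .ifTop_neg (by simp [hs]) (hpush false)
    · exact .ifTop_pos (by simp [hs]) (hpush true)
  refine hdup.seq (.pop_cons (b := x) ?_)
  rw [Function.update_of_ne hcb, Function.update_of_ne hca, hs]

theorem runs_dupProg (hca : c ≠ a) (hcb : c ≠ b) (hab : a ≠ b) (s : Store) :
    Runs (dupProg c a b) s
      (Function.update (Function.update (Function.update s a ((s c).reverse ++ s a)) b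
        ((s c).reverse ++ s b)) c []) (5 * (s c).length + 1) := by
  induction hs : s c generalizing s with
  | nil =>
    refine (Runs.loop_done hs).congr ?_ (by simp)
    simp only [List.reverse_nil, List.nil_append, Function.update_eq_self]
    rw [← hs, Function.update_eq_self]
  | cons x l ih =>
    have hrest := ih _ (Function.update_self c l
      (Function.update (Function.update s a (x :: s a)) b (x :: s b)))
    refine (Runs.loop_step (by simp [hs]) (runs_dupStep hca hcb hab hs) hrest).congr ?_
      (by simp only [List.length_cons]; omega)
    funext i
    simp only [Function.update_apply]
    split_ifs <;> simp_all

/-- The program that copies stack `a` onto stack `b`, using the empty stack `c`. -/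
def copyProg (a b c : ℕ) : Prog := .seq (moveProg a c) (dupProg c a b)

theorem runs_copyProg (hab : a ≠ b) (hac : a ≠ c) (hbc : b ≠ c) (s : Store) (hc : s c = []) :
    Runs (copyProg a b c) s (Function.update s b (s a ++ s b)) (9 * (s a).length + 2) := by
  have hmove := runs_moveProg hac s
  have hdup := runs_dupProg hac.symm hbc.symm hab
    (Function.update (Function.update s c ((s a).reverse ++ s c)) a [])
  refine (hmove.seq hdup).congr ?_ ?_
  · funext i
    simp only [Function.update_apply]
    split_ifs <;> simp_all
  · rw [Function.update_of_ne hac.symm, Function.update_self, hc, List.append_nil,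
      List.length_reverse]
    omega

theorem runs_copyProg_inputStore (hab : a ≠ b) (hac : a ≠ c) (hbc : b ≠ c)
    (L : List (List Bool)) (hc : L.getD c [] = []) :
    Runs (copyProg a b c) (inputStore L) (inputStore (setStack L b (L.getD a [] ++ L.getD b [])))
      (9 * (L.getD a []).length + 2) := by
  simp only [inputStore_setStack]
  exact runs_copyProg hab hac hbc (inputStore L) hc

/-- The program that empties stack `a`. -/
def clearProg (a : ℕ) : Prog := .loop a (.pop a)

theorem runs_clearProg (a : ℕ) (s : Store) :
    Runs (clearProg a) s (Function.update s a []) (2 * (s a).length + 1) := by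
  induction hs : s a generalizing s with
  | nil =>
    refine (Runs.loop_done hs).congr ?_ (by simp)
    rw [← hs, Function.update_eq_self]
  | cons x l ih =>
    have hrest := ih _ (Function.update_self a l s)
    rw [Function.update_idem] at hrest
    exact (Runs.loop_step (by simp [hs]) (.pop_cons hs) hrest).mono
      (by simp only [List.length_cons]; omega)

theorem runs_clearProg_inputStore (a : ℕ) (L : List (List Bool)) :
    Runs (clearProg a) (inputStore L) (inputStore (setStack L a []))
      (2 * (L.getD a []).length + 1) := by
  simp only [inputStore_setStack]
  exact runs_clearProg a (inputStore L)

/-- One step of `readProg`; the flag on stack `c` says that the end of the number has not been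
reached. -/
def readStepProg (a b c : ℕ) : Prog :=
  .ifTop a true (.seq (.pop a) (.push b true)) (.seq (.pop a) (.pop c))

/-- The program that reads a self-delimiting number from stack `a` and adds it to the unary number
on stack `b`, using the empty stack `c`. -/
def readProg (a b c : ℕ) : Prog := .seq (.push c true) (.loop c (readStepProg a b c))

theorem runs_readStepProg_true (hab : a ≠ b) {s : Store} {r : List Bool} (hs : s a = true :: r) :
    Runs (readStepProg a b c) s (Function.update (Function.update s a r) b (true :: s b)) 3 := by
  have hpush := Runs.push (Function.update s a r) b true
  rw [Function.update_of_ne hab.symm] at hpush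
  exact .ifTop_pos (by simp [hs]) ((Runs.pop_cons hs).seq hpush)

theorem runs_readStepProg_false (hac : a ≠ c) {s : Store} {r : List Bool}
    (hs : s a = false :: r) (hc : s c = [true]) :
    Runs (readStepProg a b c) s (Function.update (Function.update s a r) c []) 3 :=
  .ifTop_neg (by simp [hs])
    ((Runs.pop_cons hs).seq (.pop_cons ((Function.update_of_ne hac.symm _ _).trans hc)))

theorem runs_readLoop (hab : a ≠ b) (hac : a ≠ c) (hbc : b ≠ c) (k : ℕ) (r : List Bool)
    (s : Store) (hs : s a = encodeIndex k ++ r) (hc : s c = [true]) :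
    Runs (.loop c (readStepProg a b c)) s
      (Function.update (Function.update (Function.update s b (unary k ++ s b)) a r) c [])
      (4 * k + 5) := by
  have hne : s c ≠ [] := by simp [hc]
  induction k generalizing s with
  | zero =>
    have hstep := runs_readStepProg_false (b := b) hac (r := r) (by simp [hs, encodeIndex]) hc
    refine (Runs.loop_step hne hstep (.loop_done (by simp))).congr ?_ (by omega)
    funext i
    simp only [Function.update_apply]
    split_ifs <;> simp_all [unary]
  | succ k ih =>
    have hstep := runs_readStepProg_true (c := c) hab (s := s) (r := encodeIndex k ++ r)
      (by simp [hs, encodeIndex, List.replicate_succ])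
    have hrest := ih (Function.update (Function.update s a (encodeIndex k ++ r)) b (true :: s b))
      (by rw [Function.update_of_ne hab, Function.update_self])
      (by rw [Function.update_of_ne hbc.symm, Function.update_of_ne hac.symm, hc])
      (by rwa [Function.update_of_ne hbc.symm, Function.update_of_ne hac.symm])
    refine (Runs.loop_step hne hstep hrest).congr ?_ (by omega)
    have unary_succ : unary (k + 1) = unary k ++ [true] := by simp [unary, List.replicate_succ']
    funext i
    simp only [Function.update_apply]
    split_ifs <;> simp_all

theorem runs_readProg (hab : a ≠ b) (hac : a ≠ c) (hbc : b ≠ c) (k : ℕ) (r : List Bool)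
    (s : Store) (hs : s a = encodeIndex k ++ r) (hc : s c = []) :
    Runs (readProg a b c) s
      (Function.update (Function.update s b (unary k ++ s b)) a r) (4 * k + 6) := by
  have hloop := runs_readLoop hab hac hbc k r (Function.update s c (true :: s c))
    (by rw [Function.update_of_ne hac, hs]) (by simp [hc])
  refine ((Runs.push s c true).seq hloop).congr ?_ (by omega)
  funext i
  simp only [Function.update_apply]
  split_ifs <;> simp_all

theorem runs_readProg_inputStore (hab : a ≠ b) (hac : a ≠ c) (hbc : b ≠ c)
    (L : List (List Bool)) (k : ℕ) (r : List Bool) (ha : L.getD a [] = encodeIndex k ++ r)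
    (hc : L.getD c [] = []) :
    Runs (readProg a b c) (inputStore L)
      (inputStore (setStack (setStack L b (unary k ++ L.getD b [])) a r)) (4 * k + 6) := by
  simp only [inputStore_setStack]
  exact runs_readProg hab hac hbc k r (inputStore L) ha hc

end Subroutines

/-! ### Renaming of stacks -/

/-- The program obtained by adding `k` to all stack numbers. -/
def Prog.shift (k : ℕ) : Prog → Prog
  | .skip => .skip
  | .push i b => .push (k + i) b
  | .pop i => .pop (k + i)
  | .seq p q => .seq (p.shift k) (q.shift k)
  | .ifTop i b p q => .ifTop (k + i) b (p.shift k) (q.shift k)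
  | .loop i p => .loop (k + i) (p.shift k)

/-- The first `k` stacks of `u` followed by the stacks of `s`. -/
def joinStore (k : ℕ) (u s : Store) : Store := fun i => if i < k then u i else s (i - k)

theorem joinStore_add (k : ℕ) (u s : Store) (i : ℕ) : joinStore k u s (k + i) = s i := by
  simp [joinStore]

theorem joinStore_update (k : ℕ) (u s : Store) (i : ℕ) (v : List Bool) :
    joinStore k u (Function.update s i v) = Function.update (joinStore k u s) (k + i) v := by
  funext j
  simp only [joinStore, Function.update_apply]
  grind

theorem Exec.shift {p : Prog} {s s' : Store} {t : ℕ} (h : Exec p s s' t) (k : ℕ) (u : Store) :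
    Exec (p.shift k) (joinStore k u s) (joinStore k u s') t := by
  induction h with
  | skip s => exact .skip _
  | push i b s =>
    rw [joinStore_update]
    have := Exec.push (k + i) b (joinStore k u s)
    rwa [joinStore_add] at this
  | pop i s =>
    rw [joinStore_update]
    have := Exec.pop (k + i) (joinStore k u s)
    rwa [joinStore_add] at this
  | seq _ _ ihp ihq => exact .seq ihp ihq
  | ifTop_pos hs _ ih => exact .ifTop_pos (by rwa [joinStore_add]) ih
  | ifTop_neg hs _ ih => exact .ifTop_neg (by rwa [joinStore_add]) ih
  | loop_done hs => exact .loop_done (by rwa [joinStore_add])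
  | loop_step hs _ _ ihp ihloop => exact .loop_step (by rwa [joinStore_add]) ihp ihloop

theorem joinStore_inputStore (L A : List (List Bool)) :
    joinStore L.length (inputStore L) (inputStore A) = inputStore (L ++ A) := by
  funext i
  simp only [joinStore, inputStore, List.getD_eq_getElem?_getD]
  split_ifs with h
  · rw [List.getElem?_append_left h]
  · rw [List.getElem?_append_right (not_lt.1 h)]

theorem Runs.shift {p : Prog} {A B : List (List Bool)} {T : ℕ}
    (h : Runs p (inputStore A) (inputStore B) T) (L : List (List Bool)) :
    Runs (p.shift L.length) (inputStore (L ++ A)) (inputStore (L ++ B)) T := by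
  obtain ⟨t, ht, he⟩ := h
  have := he.shift L.length (inputStore L)
  rw [joinStore_inputStore, joinStore_inputStore] at this
  exact ⟨t, ht, this⟩

/-! ### Cleaning up after a program -/

/-- A strict bound for the numbers of the stacks that a program mentions. -/
def Prog.bound : Prog → ℕ
  | .skip => 0
  | .push i _ => i + 1
  | .pop i => i + 1
  | .seq p q => max p.bound q.bound
  | .ifTop _ _ p q => max p.bound q.bound
  | .loop _ p => p.bound

theorem Exec.eq_of_bound_le {p : Prog} {s s' : Store} {t : ℕ} (h : Exec p s s' t) {i : ℕ}
    (hi : p.bound ≤ i) : s' i = s i := by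
  induction h with
  | skip s => rfl
  | push j b s => exact Function.update_of_ne (by simp only [Prog.bound] at hi; omega) _ _
  | pop j s => exact Function.update_of_ne (by simp only [Prog.bound] at hi; omega) _ _
  | seq _ _ ihp ihq =>
    simp only [Prog.bound] at hi
    rw [ihq (by omega), ihp (by omega)]
  | ifTop_pos _ _ ih => exact ih (by simp only [Prog.bound] at hi; omega)
  | ifTop_neg _ _ ih => exact ih (by simp only [Prog.bound] at hi; omega)
  | loop_done _ => rfl
  | loop_step _ _ _ ihp ihloop => rw [ihloop hi, ihp hi]

theorem Exec.length_le {p : Prog} {s s' : Store} {t : ℕ} (h : Exec p s s' t) (i : ℕ) :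
    (s' i).length ≤ (s i).length + t := by
  induction h with
  | skip s => omega
  | push j b s =>
    by_cases hi : i = j
    · simp [hi]
    · simp [hi]
  | pop j s =>
    by_cases hi : i = j
    · simp only [hi, Function.update_self, List.length_tail]
      omega
    · simp [hi]
  | seq _ _ ihp ihq => omega
  | ifTop_pos _ _ ih => omega
  | ifTop_neg _ _ ih => omega
  | loop_done _ => omega
  | loop_step _ _ _ ihp ihloop => omega

/-- The program that empties the stacks `1, ..., n`. -/
def clearUpTo : ℕ → Prog
  | 0 => .skip
  | n + 1 => .seq (clearUpTo n) (clearProg (n + 1))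

theorem runs_clearUpTo (n T : ℕ) (s : Store) (hs : ∀ i, (s i).length ≤ T) :
    Runs (clearUpTo n) s (fun i => if 1 ≤ i ∧ i ≤ n then [] else s i)
      (n * (2 * T + 1) + 1) := by
  induction n with
  | zero => exact (Runs.skip s).congr (funext fun i => by rw [if_neg (by omega)]) (by simp)
  | succ n ih =>
    refine (ih.seq (runs_clearProg (n + 1) _)).congr ?_ ?_
    · funext i
      simp only [Function.update_apply]
      split_ifs <;> first | rfl | omega
    · have := hs (n + 1)
      rw [if_neg (by omega), Nat.add_mul n 1]
      omega

theorem length_inputStore_le {args : List (List Bool)} {M : ℕ}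
    (hM : ∀ a ∈ args, a.length ≤ M) (i : ℕ) : (inputStore args i).length ≤ M := by
  simp only [inputStore, List.getD_eq_getElem?_getD]
  rcases lt_or_ge i args.length with hi | hi
  · rw [List.getElem?_eq_getElem hi]
    exact hM _ (List.getElem_mem hi)
  · simp [List.getElem?_eq_none hi]

/-- The program that runs `p` and then empties all stacks but the output stack `0`, where `p` is
started on at most `n` arguments. -/
def Prog.clean (p : Prog) (n : ℕ) : Prog := .seq p (clearUpTo (max p.bound n))

theorem OutputsInTime.runs_clean {p : Prog} {args : List (List Bool)} {out : List Bool} {T M : ℕ}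
    (h : OutputsInTime p args out T) (hM : ∀ a ∈ args, a.length ≤ M) {n : ℕ}
    (hn : args.length ≤ n) : Runs (p.clean n) (inputStore args) (inputStore [out])
      (T + (max p.bound n * (2 * (M + T) + 1) + 1)) := by
  obtain ⟨s, t, ht, he, hout⟩ := h
  have hlength (i : ℕ) : (s i).length ≤ M + T :=
    (he.length_le i).trans (Nat.add_le_add (length_inputStore_le hM i) ht)
  refine (Runs.seq ⟨t, ht, he⟩ (runs_clearUpTo (max p.bound n) _ _ hlength)).congr ?_ le_rfl
  funext i
  cases i with
  | zero => simp [inputStore, hout]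
  | succ i =>
    split_ifs with hi
    · rfl
    · have hargs : args.length ≤ i + 1 := by omega
      rw [he.eq_of_bound_le (by omega)]
      exact List.getD_eq_default _ _ hargs

theorem OutputsInTime.length_le {p : Prog} {args : List (List Bool)} {out : List Bool} {T : ℕ}
    (h : OutputsInTime p args out T) : out.length ≤ (args.getD 0 []).length + T := by
  obtain ⟨s, t, ht, he, h0⟩ := h
  have := he.length_le 0
  rw [h0] at this
  exact this.trans (Nat.add_le_add_left ht _)

/-! ### Polynomial time -/

section PolynomialTime

variable {ι κ : Type*} {sz : ι → ℕ}

/-- `f` is bounded by a polynomial in `sz`. -/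
def PolyBdd (sz f : ι → ℕ) : Prop := ∃ P : Polynomial ℕ, ∀ i, f i ≤ P.eval (sz i)

theorem PolyBdd.eval (sz : ι → ℕ) (P : Polynomial ℕ) : PolyBdd sz fun i => P.eval (sz i) :=
  ⟨P, fun _ => le_rfl⟩

theorem PolyBdd.const (sz : ι → ℕ) (c : ℕ) : PolyBdd sz fun _ => c :=
  ⟨Polynomial.C c, fun _ => by simp⟩

theorem PolyBdd.self (sz : ι → ℕ) : PolyBdd sz sz := ⟨Polynomial.X, fun _ => by simp⟩

theorem PolyBdd.mono {f g : ι → ℕ} (h : PolyBdd sz g) (hfg : ∀ i, f i ≤ g i) : PolyBdd sz f :=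
  let ⟨P, hP⟩ := h
  ⟨P, fun i => (hfg i).trans (hP i)⟩

theorem PolyBdd.add {f g : ι → ℕ} (hf : PolyBdd sz f) (hg : PolyBdd sz g) :
    PolyBdd sz fun i => f i + g i :=
  let ⟨P, hP⟩ := hf
  let ⟨Q, hQ⟩ := hg
  ⟨P + Q, fun i => by simpa using Nat.add_le_add (hP i) (hQ i)⟩

theorem PolyBdd.mul {f g : ι → ℕ} (hf : PolyBdd sz f) (hg : PolyBdd sz g) :
    PolyBdd sz fun i => f i * g i :=
  let ⟨P, hP⟩ := hf
  let ⟨Q, hQ⟩ := hg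
  ⟨P * Q, fun i => by simpa using Nat.mul_le_mul (hP i) (hQ i)⟩

theorem PolyBdd.comp {f : ι → ℕ} (h : PolyBdd sz f) (e : κ → ι) :
    PolyBdd (fun k => sz (e k)) fun k => f (e k) :=
  let ⟨P, hP⟩ := h
  ⟨P, fun k => hP (e k)⟩

/-- Program `p` leads from the stacks `A i` to the stacks `B i` in time polynomial in `sz i`. -/
def PolyRuns (sz : ι → ℕ) (p : Prog) (A B : ι → List (List Bool)) : Prop :=
  ∃ P : Polynomial ℕ, ∀ i, Runs p (inputStore (A i)) (inputStore (B i)) (P.eval (sz i))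

theorem PolyRuns.of {p : Prog} {A B : ι → List (List Bool)} {T : ι → ℕ} (hT : PolyBdd sz T)
    (h : ∀ i, Runs p (inputStore (A i)) (inputStore (B i)) (T i)) : PolyRuns sz p A B :=
  let ⟨P, hP⟩ := hT
  ⟨P, fun i => (h i).mono (hP i)⟩

theorem PolyRuns.congr {p : Prog} {A B A' B' : ι → List (List Bool)} (h : PolyRuns sz p A B)
    (hA : ∀ i, inputStore (A i) = inputStore (A' i))
    (hB : ∀ i, inputStore (B i) = inputStore (B' i)) : PolyRuns sz p A' B' :=
  let ⟨P, hP⟩ := h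
  ⟨P, fun i => by rw [← hA, ← hB]; exact hP i⟩

theorem PolyRuns.comp {p : Prog} {A B : ι → List (List Bool)} (h : PolyRuns sz p A B)
    (e : κ → ι) : PolyRuns (fun k => sz (e k)) p (fun k => A (e k)) fun k => B (e k) :=
  let ⟨P, hP⟩ := h
  ⟨P, fun k => hP (e k)⟩

theorem PolyRuns.seq {p q : Prog} {A B C : ι → List (List Bool)} (h : PolyRuns sz p A B)
    (h' : PolyRuns sz q B C) : PolyRuns sz (.seq p q) A C :=
  let ⟨P, hP⟩ := h
  let ⟨Q, hQ⟩ := h'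
  ⟨P + Q, fun i => ((hP i).seq (hQ i)).mono (by simp)⟩

theorem PolyRuns.loop {r : ℕ} {p : Prog} (n : ι → ℕ) (hn : PolyBdd sz n)
    (σ : ι → ℕ → List (List Bool)) (hne : ∀ i, ∀ k < n i, (σ i k).getD r [] ≠ [])
    (h0 : ∀ i, (σ i (n i)).getD r [] = [])
    (h : PolyRuns (fun x : Σ i, Fin (n i) => sz x.1) p (fun x => σ x.1 x.2)
      fun x => σ x.1 (x.2 + 1)) :
    PolyRuns sz (.loop r p) (fun i => σ i 0) fun i => σ i (n i) := by
  obtain ⟨P, hP⟩ := h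
  refine PolyRuns.of ((hn.mul ((PolyBdd.eval sz P).add (.const sz 1))).add (.const sz 1))
    fun i => ?_
  exact Runs.loop (fun k => inputStore (σ i k)) (n i) (hne i) (h0 i) fun k hk => hP ⟨i, k, hk⟩

theorem PolyRuns.skip (A : ι → List (List Bool)) : PolyRuns sz .skip A A :=
  .of (.const sz 1) fun _ => .skip _

theorem PolyRuns.push (A : ι → List (List Bool)) (j : ℕ) (b : Bool) :
    PolyRuns sz (.push j b) A fun i => setStack (A i) j (b :: (A i).getD j []) :=
  .of (.const sz 1) fun i => .push_inputStore (A i) j b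

theorem PolyRuns.pop (A : ι → List (List Bool)) (j : ℕ) :
    PolyRuns sz (.pop j) A fun i => setStack (A i) j ((A i).getD j []).tail :=
  .of (.const sz 1) fun i => .pop_inputStore (A i) j

theorem PolyRuns.move {a b : ℕ} (hab : a ≠ b) (A : ι → List (List Bool))
    (h : PolyBdd sz fun i => ((A i).getD a []).length) : PolyRuns sz (moveProg a b) A fun i =>
      setStack (setStack (A i) b (((A i).getD a []).reverse ++ (A i).getD b [])) a [] :=
  .of (((PolyBdd.const sz 4).mul h).add (.const sz 1)) fun i => runs_moveProg_inputStore hab (A i)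

theorem PolyRuns.copy {a b c : ℕ} (hab : a ≠ b) (hac : a ≠ c) (hbc : b ≠ c)
    (A : ι → List (List Bool)) (hc : ∀ i, (A i).getD c [] = [])
    (h : PolyBdd sz fun i => ((A i).getD a []).length) :
    PolyRuns sz (copyProg a b c) A fun i => setStack (A i) b ((A i).getD a [] ++ (A i).getD b []) :=
  .of (((PolyBdd.const sz 9).mul h).add (.const sz 2)) fun i =>
    runs_copyProg_inputStore hab hac hbc (A i) (hc i)

theorem PolyRuns.clear (a : ℕ) (A : ι → List (List Bool))
    (h : PolyBdd sz fun i => ((A i).getD a []).length) :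
    PolyRuns sz (clearProg a) A fun i => setStack (A i) a [] :=
  .of (((PolyBdd.const sz 2).mul h).add (.const sz 1)) fun i => runs_clearProg_inputStore a (A i)

theorem PolyRuns.read {a b c : ℕ} (hab : a ≠ b) (hac : a ≠ c) (hbc : b ≠ c)
    (A : ι → List (List Bool)) (k : ι → ℕ) (r : ι → List Bool)
    (ha : ∀ i, (A i).getD a [] = encodeIndex (k i) ++ r i) (hc : ∀ i, (A i).getD c [] = [])
    (h : PolyBdd sz k) : PolyRuns sz (readProg a b c) A fun i =>
      setStack (setStack (A i) b (unary (k i) ++ (A i).getD b [])) a (r i) :=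
  .of (((PolyBdd.const sz 4).mul h).add (.const sz 6)) fun i =>
    runs_readProg_inputStore hab hac hbc (A i) (k i) (r i) (ha i) (hc i)

theorem PolyRuns.shift {p : Prog} {A B : ι → List (List Bool)} (h : PolyRuns sz p A B) (k : ℕ)
    (L : ι → List (List Bool)) (hL : ∀ i, (L i).length = k) :
    PolyRuns sz (p.shift k) (fun i => L i ++ A i) fun i => L i ++ B i :=
  let ⟨P, hP⟩ := h
  ⟨P, fun i => by rw [← hL i]; exact (hP i).shift (L i)⟩

theorem PolyRuns.clean {p : Prog} {args : ι → List (List Bool)} {out : ι → List Bool}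
    {T : ι → ℕ} (hT : PolyBdd sz T) (h : ∀ i, OutputsInTime p (args i) (out i) (T i))
    {M : ι → ℕ} (hM : PolyBdd sz M) (ha : ∀ i, ∀ a ∈ args i, a.length ≤ M i) (n : ℕ)
    (hn : ∀ i, (args i).length ≤ n) : PolyRuns sz (p.clean n) args fun i => [out i] :=
  .of (hT.add (((PolyBdd.const sz _).mul (((PolyBdd.const sz 2).mul (hM.add hT)).add
    (.const sz 1))).add (.const sz 1))) fun i => (h i).runs_clean (ha i) (hn i)

end PolynomialTime

@[simp] theorem length_unary (n : ℕ) : (unary n).length = n := by simp [unary]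

theorem unary_add (m n : ℕ) : unary m ++ unary n = unary (m + n) := by simp [unary]

theorem unary_ne_nil {n : ℕ} (h : 0 < n) : unary n ≠ [] := by
  simp [unary]
  omega

theorem tail_unary (n : ℕ) : (unary n).tail = unary (n - 1) := by simp [unary]

/-! ### Computing polynomials in unary -/

theorem exists_pushProg (f : ℕ → ℕ) (a : ℕ) : ∃ q, PolyRuns (fun lam => lam) q
    (fun lam => [unary lam, unary (f lam)]) fun lam => [unary lam, unary (f lam + a)] := by
  induction a with
  | zero => exact ⟨.skip, .skip _⟩
  | succ a ih =>
    obtain ⟨q, hq⟩ := ih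
    exact ⟨.seq q (.push 1 true), hq.seq (.push _ _ _)⟩
/-- The program that multiplies the unary number on stack `1` by the one on stack `0`, using the
empty stacks `2` and `3`. -/
def mulProg : Prog := .seq (moveProg 1 2) (.loop 2 (.seq (.pop 2) (copyProg 0 1 3)))

theorem polyRuns_mulProg {ι : Type*} {sz a f : ι → ℕ} (ha : PolyBdd sz a) (hf : PolyBdd sz f) :
    PolyRuns sz mulProg (fun i => [unary (a i), unary (f i)])
      fun i => [unary (a i), unary (f i * a i)] := by
  have hmove : PolyRuns sz (moveProg 1 2) (fun i => [unary (a i), unary (f i)])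
      fun i => [unary (a i), [], (unary (f i)).reverse ++ []] :=
    .move (by decide) _ (hf.mono fun i => by simp)
  have hloop : PolyRuns sz (.loop 2 (.seq (.pop 2) (copyProg 0 1 3)))
      (fun i => [unary (a i), unary (0 * a i), unary (f i - 0)])
      fun i => [unary (a i), unary (f i * a i), unary (f i - f i)] := by
    refine .loop f hf (fun i k => [unary (a i), unary (k * a i), unary (f i - k)])
      (fun i k hk => unary_ne_nil (Nat.sub_pos_of_lt hk)) (fun i => by simp [unary]) ?_
    refine (PolyRuns.pop _ 2).seq ((PolyRuns.copy (by decide) (by decide) (by decide) _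
      (fun _ => rfl) ?_).congr (fun _ => rfl) ?_)
    · exact (ha.comp Sigma.fst).mono fun x => by simp [setStack]
    · rintro ⟨i, k, hk⟩
      simp [setStack, tail_unary, unary_add, Nat.sub_sub, Nat.succ_mul, add_comm (a i)]
  refine (hmove.congr (fun _ => rfl) fun i => ?_).seq (hloop.congr (fun _ => rfl) fun i => ?_)
  · simp [unary]
  · simpa [unary] using inputStore_append_replicate_nil [unary (a i), unary (f i * a i)] 1

theorem exists_polyProg (p : Polynomial ℕ) : ∃ q, PolyRuns (fun lam => lam) q
    (fun lam => [unary lam]) fun lam => [unary lam, unary (p.eval lam)] := by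
  induction p using Polynomial.recOnHorner with
  | M0 =>
    refine ⟨.skip, (PolyRuns.skip _).congr (fun _ => rfl) fun lam => ?_⟩
    simpa [unary] using (inputStore_append_replicate_nil [unary lam] 1).symm
  | MC p a _ _ ih =>
    obtain ⟨q, hq⟩ := ih
    obtain ⟨r, hr⟩ := exists_pushProg (fun lam => p.eval lam) a
    exact ⟨.seq q r, (hq.seq hr).congr (fun _ => rfl) fun lam => by simp⟩
  | MX p _ ih =>
    obtain ⟨q, hq⟩ := ih
    refine ⟨.seq q mulProg,
      (hq.seq (polyRuns_mulProg (.self _) (.eval _ p))).congr (fun _ => rfl) fun lam => ?_⟩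
    simp

/-! ### Writing down several copies of a circuit -/

/-- The description of a gate all of whose qubits are shifted by `o`. -/
def Gate.shiftEncode {n : ℕ} (o : ℕ) : Gate n → List Bool
  | .had i => [false, false] ++ encodeIndex (o + i)
  | .phase i => [false, true] ++ encodeIndex (o + i)
  | .cnot c t _ => [true, false] ++ encodeIndex (o + c) ++ encodeIndex (o + t)
  | .toffoli c d t _ _ _ =>
      [true, true] ++ encodeIndex (o + c) ++ encodeIndex (o + d) ++ encodeIndex (o + t)

theorem Gate.encode_block {m n : ℕ} (j : Fin m) (g : Gate n) :
    (g.block j).encode = g.shiftEncode (j * n) := by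
  cases g <;> simp [Gate.block, Gate.encode, Gate.shiftEncode, finProdFinEquiv, mul_comm, add_comm]

theorem reverse_encodeIndex (k : ℕ) : (encodeIndex k).reverse = false :: unary k := by
  simp [encodeIndex, unary]

/-- The program that moves a number from stack `4` to stack `7`, where its description appears in
reverse, after adding the unary number on stack `6` to it. -/
def indexProg : Prog := .seq (copyProg 6 7 5) (.seq (readProg 4 7 5) (.push 7 false))
theorem runs_indexProg (a b c d r O : List Bool) (o i : ℕ) :
    Runs indexProg (inputStore [a, b, c, d, encodeIndex i ++ r, [], unary o, O])
      (inputStore [a, b, c, d, r, [], unary o, (encodeIndex (o + i)).reverse ++ O])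
      (9 * o + 4 * i + 9) := by
  have hcopy := runs_copyProg_inputStore (a := 6) (b := 7) (c := 5) (by decide) (by decide)
    (by decide) [a, b, c, d, encodeIndex i ++ r, [], unary o, O] rfl
  have hread := runs_readProg_inputStore (a := 4) (b := 7) (c := 5) (by decide) (by decide)
    (by decide) [a, b, c, d, encodeIndex i ++ r, [], unary o, unary o ++ O] i r rfl rfl
  have hpush := Runs.push_inputStore [a, b, c, d, r, [], unary o, unary i ++ (unary o ++ O)] 7 false
  refine (hcopy.seq (hread.seq hpush)).congr ?_ (by simp; omega)
  rw [reverse_encodeIndex, ← unary_add, ← List.append_assoc, unary_add, add_comm, ← unary_add]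
  rfl

/-- The program that moves the bit `b` from stack `4` to stack `7`. -/
def bitProg (b : Bool) : Prog := .seq (.pop 4) (.push 7 b)

theorem runs_bitProg (a b c d r o O : List Bool) (x : Bool) :
    Runs (bitProg x) (inputStore [a, b, c, d, x :: r, [], o, O])
      (inputStore [a, b, c, d, r, [], o, x :: O]) 2 :=
  (Runs.pop_inputStore _ 4).seq (Runs.push_inputStore _ 7 x)

/-- The program that moves the description of a gate from stack `4` to stack `7`, where it appears
in reverse, after adding the unary number on stack `6` to the numbers of the qubits. -/
def gateProg : Prog :=
  .ifTop 4 true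
    (.seq (bitProg true) (.ifTop 4 true
      (.seq (bitProg true) (.seq indexProg (.seq indexProg indexProg)))
      (.seq (bitProg false) (.seq indexProg indexProg))))
    (.seq (bitProg false) (.ifTop 4 true
      (.seq (bitProg true) indexProg) (.seq (bitProg false) indexProg)))

theorem runs_gateProg {n : ℕ} (a b c d r O : List Bool) (o : ℕ) (g : Gate n) :
    Runs gateProg (inputStore [a, b, c, d, g.encode ++ r, [], unary o, O])
      (inputStore [a, b, c, d, r, [], unary o, (g.shiftEncode o).reverse ++ O])
      (27 * o + 12 * n + 40) := by
  cases g with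
  | had i =>
    refine (Runs.ifTop_neg (by simp [inputStore]) ((runs_bitProg ..).seq
      (Runs.ifTop_neg (by simp [inputStore]) ((runs_bitProg ..).seq
        (runs_indexProg a b c d r _ o i))))).congr ?_ (by omega)
    simp [Gate.shiftEncode]
  | phase i =>
    refine (Runs.ifTop_neg (by simp [inputStore]) ((runs_bitProg ..).seq
      (Runs.ifTop_pos (by simp [inputStore]) ((runs_bitProg ..).seq
        (runs_indexProg a b c d r _ o i))))).congr ?_ (by omega)
    simp [Gate.shiftEncode]
  | cnot i j h =>
    have hencode : (Gate.cnot i j h).encode ++ r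
        = true :: false :: (encodeIndex i ++ (encodeIndex j ++ r)) := by simp [Gate.encode]
    rw [hencode]
    refine (Runs.ifTop_pos (by simp [inputStore]) ((runs_bitProg ..).seq
      (Runs.ifTop_neg (by simp [inputStore]) ((runs_bitProg ..).seq
        ((runs_indexProg a b c d _ _ o i).seq (runs_indexProg a b c d r _ o j)))))).congr ?_
      (by omega)
    simp [Gate.shiftEncode]
  | toffoli i j k hij hik hjk =>
    have hencode : (Gate.toffoli i j k hij hik hjk).encode ++ r
        = true :: true :: (encodeIndex i ++ (encodeIndex j ++ (encodeIndex k ++ r))) := by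
      simp [Gate.encode]
    rw [hencode]
    refine (Runs.ifTop_pos (by simp [inputStore]) ((runs_bitProg ..).seq
      (Runs.ifTop_pos (by simp [inputStore]) ((runs_bitProg ..).seq
        ((runs_indexProg a b c d _ _ o i).seq ((runs_indexProg a b c d _ _ o j).seq
          (runs_indexProg a b c d r _ o k))))))).congr ?_ (by omega)
    simp [Gate.shiftEncode]

theorem runs_gatesProg {n : ℕ} (a b c d O : List Bool) (o : ℕ) (gs : List (Gate n)) :
    Runs (.loop 4 gateProg)
      (inputStore [a, b, c, d, gs.flatMap Gate.encode, [], unary o, O])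
      (inputStore [a, b, c, d, [], [], unary o, (gs.flatMap (Gate.shiftEncode o)).reverse ++ O])
      (gs.length * (27 * o + 12 * n + 41) + 1) := by
  have h := Runs.loop (i := 4) (p := gateProg) (T := 27 * o + 12 * n + 40)
    (fun k => inputStore [a, b, c, d, (gs.drop k).flatMap Gate.encode, [], unary o,
      ((gs.take k).flatMap (Gate.shiftEncode o)).reverse ++ O]) gs.length
    (fun k hk => ?_) (by simp [inputStore]) (fun k hk => ?_)
  · simpa using h
  · change (gs.drop k).flatMap Gate.encode ≠ []
    rw [List.drop_eq_getElem_cons hk, List.flatMap_cons]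
    cases gs[k] <;> simp [Gate.encode]
  · rw [List.drop_eq_getElem_cons hk, List.flatMap_cons, List.take_succ_eq_append_getElem hk,
      List.flatMap_append, List.reverse_append, List.append_assoc]
    simpa using runs_gateProg a b c d ((gs.drop (k + 1)).flatMap Gate.encode)
      (((gs.take k).flatMap (Gate.shiftEncode o)).reverse ++ O) o gs[k]
/-- The descriptions of the gates of `k` copies. -/
def copiesEncode {n : ℕ} (gs : List (Gate n)) (k : ℕ) : List Bool :=
  (List.range k).flatMap fun j => gs.flatMap (Gate.shiftEncode (j * n))

theorem copiesEncode_succ {n : ℕ} (gs : List (Gate n)) (k : ℕ) : copiesEncode gs (k + 1)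
    = copiesEncode gs k ++ gs.flatMap (Gate.shiftEncode (k * n)) := by
  simp [copiesEncode, List.range_succ]

theorem QCircuit.encode_copies (m : ℕ) (C : QCircuit) :
    (C.copies m).encode = encodeIndex (m * C.qubits) ++ copiesEncode C.gates m := by
  rw [QCircuit.encode, copiesEncode, ← List.map_coe_finRange_eq_range, List.flatMap_map]
  simp only [QCircuit.copies, List.flatMap_assoc, List.flatMap_map, Gate.encode_block]

theorem length_shiftEncode_le {n : ℕ} (o : ℕ) (g : Gate n) :
    (g.shiftEncode o).length ≤ 3 * (o + n) + 5 := by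
  cases g <;> simp only [Gate.shiftEncode, encodeIndex, List.length_append, List.length_replicate,
    List.length_cons, List.length_nil] <;> omega

theorem length_flatMap_le {α β : Type*} {f : α → List β} {l : List α} {c : ℕ}
    (h : ∀ a ∈ l, (f a).length ≤ c) : (l.flatMap f).length ≤ l.length * c := by
  rw [List.length_flatMap]
  simpa using List.sum_le_card_nsmul (l.map fun a => (f a).length) c (by simpa using h)

theorem length_copiesEncode_le {n : ℕ} (gs : List (Gate n)) (k : ℕ) :
    (copiesEncode gs k).length ≤ k * (gs.length * (3 * (k * n + n) + 5)) := by
  refine (length_flatMap_le (c := gs.length * (3 * (k * n + n) + 5)) fun j hj => ?_).trans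
    (by rw [List.length_range])
  refine length_flatMap_le fun g _ => (length_shiftEncode_le (j * n) g).trans ?_
  have := Nat.mul_le_mul_right n (List.mem_range.1 hj).le
  omega

/-- The stacks when `k` copies of the circuit `C` have been written, in reverse, on stack `7` and
`l` copies remain to be written. -/
def copiesStacks (a : List Bool) (C : QCircuit) (l k : ℕ) : List (List Bool) :=
  [a, unary l, C.gates.flatMap Gate.encode, unary C.qubits, [], [], unary (k * C.qubits),
    (copiesEncode C.gates k).reverse]

/-- The program that writes a copy of the gates on stack `2`. -/
def copyStepProg : Prog :=
  .seq (.pop 1) (.seq (copyProg 2 4 5) (.seq (.loop 4 gateProg) (copyProg 3 6 5)))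

theorem runs_copyStepProg (a : List Bool) (C : QCircuit) (l k : ℕ) :
    Runs copyStepProg (inputStore (copiesStacks a C (l + 1) k))
      (inputStore (copiesStacks a C l (k + 1)))
      (1 + (9 * (C.gates.flatMap Gate.encode).length + 2
        + (C.gates.length * (27 * (k * C.qubits) + 12 * C.qubits + 41) + 1
          + (9 * C.qubits + 2)))) := by
  set G := C.gates.flatMap Gate.encode
  set o := k * C.qubits with ho
  set O := (copiesEncode C.gates k).reverse with hO
  have hpop := Runs.pop_inputStore (copiesStacks a C (l + 1) k) 1
  have hcopy : Runs (copyProg 2 4 5)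
      (inputStore [a, unary l, G, unary C.qubits, [], [], unary o, O])
      (inputStore [a, unary l, G, unary C.qubits, G, [], unary o, O]) (9 * G.length + 2) :=
    (runs_copyProg_inputStore (by decide) (by decide) (by decide) _ rfl).congr
      (by simp [setStack]) le_rfl
  have hgates := runs_gatesProg a (unary l) G (unary C.qubits) O o C.gates
  have hoffset := runs_copyProg_inputStore (a := 3) (b := 6) (c := 5) (by decide) (by decide)
    (by decide) [a, unary l, G, unary C.qubits, [], [], unary o,
      (C.gates.flatMap (Gate.shiftEncode o)).reverse ++ O] rfl
  refine (hpop.seq (hcopy.seq (hgates.seq hoffset))).congr ?_ (by simp)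
  rw [copiesStacks, copiesEncode_succ]
  simp [setStack, unary_add, Nat.succ_mul, add_comm C.qubits, G, ho, hO]

/-- The program that prepends the description of the unary number on stack `6` to the reverse of
stack `7` and leaves the result on stack `0`. -/
def assembleProg : Prog :=
  .seq (clearProg 0) (.seq (moveProg 7 0) (.seq (.push 0 false) (moveProg 6 0)))

/-- The program that writes the description of several copies of a circuit: stack `0` is discarded,
stack `1` holds the number of copies and stack `2` the description of the circuit. -/
def copiesProg : Prog := .seq (readProg 2 3 4) (.seq (.loop 1 copyStepProg) assembleProg)

section CopiesTime

variable {ι : Type*} {sz : ι → ℕ} {a : ι → List Bool} {C : ι → QCircuit} {m : ι → ℕ}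

theorem polyRuns_assembleProg {b c d e f w : ι → List Bool}
    (ha : PolyBdd sz fun i => (a i).length) (hm : PolyBdd sz m)
    (hw : PolyBdd sz fun i => (w i).length) :
    PolyRuns sz assembleProg
      (fun i => [a i, b i, c i, d i, e i, f i, unary (m i), (w i).reverse])
      fun i => [encodeIndex (m i) ++ w i, b i, c i, d i, e i, f i, [], []] := by
  have hmove : PolyRuns sz (moveProg 7 0)
      (fun i => [[], b i, c i, d i, e i, f i, unary (m i), (w i).reverse])
      fun i => [(w i).reverse.reverse ++ [], b i, c i, d i, e i, f i, unary (m i), []] :=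
    .move (by decide) _ (hw.mono fun i => by simp)
  have hmove_number : PolyRuns sz (moveProg 6 0)
      (fun i => [false :: ((w i).reverse.reverse ++ []), b i, c i, d i, e i, f i, unary (m i), []])
      fun i => [(unary (m i)).reverse ++ (false :: ((w i).reverse.reverse ++ [])), b i, c i, d i,
        e i, f i, [], []] :=
    .move (by decide) _ (hm.mono fun i => by simp)
  refine ((PolyRuns.clear 0 _ ha).seq (hmove.seq ((PolyRuns.push _ 0 false).seq
    hmove_number))).congr (fun _ => rfl) fun i => ?_
  simp [encodeIndex, unary]

theorem PolyBdd.qubits (hC : PolyBdd sz fun i => (C i).encode.length) :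
    PolyBdd sz fun i => (C i).qubits :=
  hC.mono fun i => by
    simp only [QCircuit.encode, encodeIndex, List.length_append, List.length_replicate]
    omega

theorem PolyBdd.length_flatMap_encode (hC : PolyBdd sz fun i => (C i).encode.length) :
    PolyBdd sz fun i => ((C i).gates.flatMap Gate.encode).length :=
  hC.mono fun i => by
    simp only [QCircuit.encode, List.length_append]
    omega

theorem PolyBdd.length_gates (hC : PolyBdd sz fun i => (C i).encode.length) :
    PolyBdd sz fun i => (C i).gates.length :=
  hC.length_flatMap_encode.mono fun _ => length_le_flatMap_encode _

theorem PolyBdd.length_copiesEncode (hC : PolyBdd sz fun i => (C i).encode.length)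
    (hm : PolyBdd sz m) : PolyBdd sz fun i => (copiesEncode (C i).gates (m i)).length :=
  (hm.mul (hC.length_gates.mul (((PolyBdd.const sz 3).mul ((hm.mul hC.qubits).add hC.qubits)).add
    (.const sz 5)))).mono fun i => length_copiesEncode_le (C i).gates (m i)

theorem polyRuns_copiesLoop (hC : PolyBdd sz fun i => (C i).encode.length) (hm : PolyBdd sz m) :
    PolyRuns sz (.loop 1 copyStepProg) (fun i => copiesStacks (a i) (C i) (m i) 0)
      fun i => copiesStacks (a i) (C i) 0 (m i) := by
  have htime : PolyBdd sz fun i => 1 + (9 * ((C i).gates.flatMap Gate.encode).length + 2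
      + ((C i).gates.length * (27 * (m i * (C i).qubits) + 12 * (C i).qubits + 41) + 1
        + (9 * (C i).qubits + 2))) :=
    (PolyBdd.const sz 1).add ((((PolyBdd.const sz 9).mul hC.length_flatMap_encode).add
      (.const sz 2)).add (((hC.length_gates.mul ((((PolyBdd.const sz 27).mul
        (hm.mul hC.qubits)).add ((PolyBdd.const sz 12).mul hC.qubits)).add (.const sz 41))).add
          (.const sz 1)).add (((PolyBdd.const sz 9).mul hC.qubits).add (.const sz 2))))
  have hloop : PolyRuns sz (.loop 1 copyStepProg)
      (fun i => copiesStacks (a i) (C i) (m i - 0) 0)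
      fun i => copiesStacks (a i) (C i) (m i - m i) (m i) := by
    refine .loop m hm (fun i k => copiesStacks (a i) (C i) (m i - k) k)
      (fun i k hk => unary_ne_nil (Nat.sub_pos_of_lt hk)) (fun i => by simp [copiesStacks, unary])
      (.of (htime.comp Sigma.fst) ?_)
    rintro ⟨i, k, hk⟩
    have hremaining : m i - k = m i - (k + 1) + 1 := by omega
    simp only [hremaining]
    refine (runs_copyStepProg (a i) (C i) (m i - (k + 1)) k).mono ?_
    have := Nat.mul_le_mul_right (C i).qubits hk.le
    gcongr
  simpa only [Nat.sub_zero, Nat.sub_self] using hloop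

theorem polyRuns_copiesProg (ha : PolyBdd sz fun i => (a i).length) (hm : PolyBdd sz m)
    (hC : PolyBdd sz fun i => (C i).encode.length) :
    PolyRuns sz copiesProg (fun i => [a i, unary (m i), (C i).encode])
      fun i => [((C i).copies (m i)).encode, [], (C i).gates.flatMap Gate.encode,
        unary (C i).qubits] := by
  have hread : PolyRuns sz (readProg 2 3 4) (fun i => [a i, unary (m i), (C i).encode])
      fun i => copiesStacks (a i) (C i) (m i) 0 :=
    (PolyRuns.read (by decide) (by decide) (by decide) _ (fun i => (C i).qubits) _
      (fun _ => rfl) (fun _ => rfl) hC.qubits).congr (fun _ => rfl) fun i => by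
        simpa [copiesStacks, copiesEncode, unary, setStack] using
          (inputStore_append_replicate_nil [a i, unary (m i), (C i).gates.flatMap Gate.encode,
            unary (C i).qubits] 4).symm
  have hassemble := polyRuns_assembleProg
    (b := fun _ => []) (c := fun i => (C i).gates.flatMap Gate.encode)
    (d := fun i => unary (C i).qubits) (e := fun _ => []) (f := fun _ => []) ha
    (hm.mul hC.qubits) (hC.length_copiesEncode hm)
  refine (hread.seq ((polyRuns_copiesLoop hC hm).seq hassemble)).congr (fun _ => rfl) fun i => ?_
  rw [QCircuit.encode_copies]
  exact inputStore_append_replicate_nil [_, [], (C i).gates.flatMap Gate.encode,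
    unary (C i).qubits] 4

end CopiesTime

theorem PolyRuns.outputs {p : Prog} {A B : ℕ → List (List Bool)}
    (h : PolyRuns (fun lam => lam) p A B) :
    ∃ T : Polynomial ℕ, ∀ lam, OutputsInTime p (A lam) ((B lam).getD 0 []) (T.eval lam) :=
  let ⟨P, hP⟩ := h
  ⟨P, fun lam => let ⟨t, ht, he⟩ := hP lam; ⟨_, t, ht, he, rfl⟩⟩

theorem polyBdd_length_encode (A : QPTSampler) :
    PolyBdd (fun lam => lam) fun lam => (A.circuit lam).encode.length :=
  ((PolyBdd.self _).add (.eval _ A.genTime)).mono fun lam => by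
    simpa using (A.gen_computes lam).length_le

theorem polyRuns_genProg (A : QPTSampler) : PolyRuns (fun lam => lam) (A.genProg.clean 1)
    (fun lam => [unary lam]) fun lam => [(A.circuit lam).encode] :=
  .clean (.eval _ A.genTime) A.gen_computes (.self _) (by simp) 1 (by simp)

theorem exists_copiesGen (A : QPTSampler) (M : Polynomial ℕ) :
    ∃ (p : Prog) (T : Polynomial ℕ), ∀ lam, OutputsInTime p [unary lam]
      ((A.circuit lam).copies (M.eval lam)).encode (T.eval lam) := by
  obtain ⟨q, hq⟩ := exists_polyProg M
  have hcopy : PolyRuns (fun lam => lam) (copyProg 0 2 3)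
      (fun lam => [unary lam, unary (M.eval lam)])
      fun lam => [unary lam, unary (M.eval lam), unary lam] := by
    simpa [setStack] using PolyRuns.copy (a := 0) (b := 2) (c := 3) (by decide) (by decide)
      (by decide) (fun lam => [unary lam, unary (M.eval lam)]) (fun _ => rfl)
      ((PolyBdd.self _).mono fun lam => by simp)
  have hgen := (polyRuns_genProg A).shift 2 (fun lam => [unary lam, unary (M.eval lam)])
    fun _ => rfl
  have hcopies := polyRuns_copiesProg (a := unary) ((PolyBdd.self fun lam => lam).mono fun lam =>
    by simp) (.eval _ M) (polyBdd_length_encode A)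
  obtain ⟨T, hT⟩ := (hq.seq (hcopy.seq (hgen.seq hcopies))).outputs
  exact ⟨_, T, hT⟩

/-! ### The sampler that measures several copies of a circuit -/

/-- The program that discards stack `0` and moves stack `1` there, using stack `2` as scratch. -/
def returnProg : Prog := .seq (clearProg 0) (.seq (moveProg 1 2) (moveProg 2 0))

theorem runs_returnProg (a w : List Bool) : Runs returnProg (inputStore [a, w])
    (inputStore [w, [], []]) (2 * a.length + 8 * w.length + 3) := by
  have hclear := runs_clearProg_inputStore 0 [a, w]
  have hmove := runs_moveProg_inputStore (a := 1) (b := 2) (by decide) [[], w]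
  have hmove_back := runs_moveProg_inputStore (a := 2) (b := 0) (by decide)
    [[], [], w.reverse ++ []]
  refine (hclear.seq (hmove.seq hmove_back)).congr ?_ (by simp; omega)
  simp [setStack]

theorem exists_copiesSampler (A : QPTSampler) (M : Polynomial ℕ) : ∃ P : QPTSampler,
    (∀ lam, P.circuit lam = (A.circuit lam).copies (M.eval lam)) ∧ ∀ lam w, P.post lam w = w := by
  obtain ⟨p, T, hT⟩ := exists_copiesGen A M
  obtain ⟨Q, hQ⟩ := (polyBdd_length_encode A).qubits
  refine ⟨⟨fun lam => (A.circuit lam).copies (M.eval lam), p, T, hT, fun _ w => w, returnProg,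
    2 * .X + 8 * (M * Q) + 3, fun lam w hw => ?_⟩, fun _ => rfl, fun _ _ => rfl⟩
  obtain ⟨t, ht, hexec⟩ := runs_returnProg (unary lam) w
  refine ⟨_, t, ht.trans ?_, hexec, rfl⟩
  have hw_le : w.length ≤ M.eval lam * Q.eval lam := hw.trans_le (Nat.mul_le_mul_left _ (hQ lam))
  simp only [unary, List.length_replicate, Polynomial.eval_add, Polynomial.eval_mul,
    Polynomial.eval_X, Polynomial.eval_ofNat]
  omega

/-! ### Splitting off bits of a stack -/

/-- The program that moves the top bit of stack `a` to stack `b`, where an empty stack `a` counts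
as holding the bit `false`. -/
def takeBitProg (a b : ℕ) : Prog :=
  .seq (.ifTop a true (.push b true) (.push b false)) (.pop a)

/-- The program that moves one bit from stack `a` to stack `b`, as in `takeBitProg`, for each
entry of stack `c`. -/
def takeBitsProg (a b c : ℕ) : Prog := .loop c (.seq (.pop c) (takeBitProg a b))

/-- The program that pops one bit from stack `a` for each entry of stack `c`. -/
def dropBitsProg (a c : ℕ) : Prog := .loop c (.seq (.pop c) (.pop a))

section Bits

variable {a b c : ℕ}

theorem runs_takeBitProg (hab : a ≠ b) (s : Store) : Runs (takeBitProg a b) s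
    (Function.update (Function.update s b ((s a).headD false :: s b)) a (s a).tail) 3 := by
  have hpop (x : Bool) : Runs (.pop a) (Function.update s b (x :: s b))
      (Function.update (Function.update s b (x :: s b)) a (s a).tail) 1 := by
    simpa only [Function.update_of_ne hab] using Runs.pop (Function.update s b (x :: s b)) a
  rcases hs : s a with _ | ⟨_ | _, l⟩ <;> rw [hs] at hpop
  · exact (Runs.ifTop_neg (by simp [hs]) (.push s b false)).seq (hpop false)
  · exact (Runs.ifTop_neg (by simp [hs]) (.push s b false)).seq (hpop false)
  · exact (Runs.ifTop_pos (by simp [hs]) (.push s b true)).seq (hpop true)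

theorem runs_takeBitsProg (hab : a ≠ b) (hac : a ≠ c) (hbc : b ≠ c) {n : ℕ} (s : Store)
    (hs : s c = unary n) :
    Runs (takeBitsProg a b c) s (Function.update (Function.update (Function.update s
      b (((s a).takeD n false).reverse ++ s b)) a ((s a).drop n)) c []) (5 * n + 1) := by
  induction n generalizing s with
  | zero =>
    refine (Runs.loop_done hs).congr ?_ le_rfl
    funext i
    simp only [Function.update_apply]
    split_ifs <;> simp_all [unary]
  | succ n ih =>
    have hrest := ih (Function.update (Function.update (Function.update s c (unary n))
      b ((s a).headD false :: s b)) a (s a).tail) (by simp [hac.symm, hbc.symm])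
    have htake := runs_takeBitProg hab (Function.update s c (unary n))
    rw [Function.update_of_ne hac, Function.update_of_ne hbc] at htake
    refine (Runs.loop_step (by simp [hs, unary])
      ((Runs.pop_cons hs).seq htake) hrest).congr ?_ (by omega)
    funext i
    simp only [Function.update_apply]
    split_ifs <;> simp_all

theorem runs_dropBitsProg (hac : a ≠ c) {n : ℕ} (s : Store) (hs : s c = unary n) :
    Runs (dropBitsProg a c) s (Function.update (Function.update s a ((s a).drop n)) c [])
      (3 * n + 1) := by
  induction n generalizing s with
  | zero =>
    refine (Runs.loop_done hs).congr ?_ le_rfl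
    funext i
    simp only [Function.update_apply]
    split_ifs <;> simp_all [unary]
  | succ n ih =>
    have hrest := ih (Function.update (Function.update s c (unary n)) a (s a).tail)
      (by simp [hac.symm])
    have hpop := Runs.pop (Function.update s c (unary n)) a
    rw [Function.update_of_ne hac] at hpop
    refine (Runs.loop_step (by simp [hs, unary])
      ((Runs.pop_cons hs).seq hpop) hrest).congr ?_ (by omega)
    funext i
    simp only [Function.update_apply]
    split_ifs <;> simp_all

theorem runs_dropBitsProg_inputStore (hac : a ≠ c) {n : ℕ} (L : List (List Bool))
    (hL : L.getD c [] = unary n) :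
    Runs (dropBitsProg a c) (inputStore L)
      (inputStore (setStack (setStack L a ((L.getD a []).drop n)) c [])) (3 * n + 1) := by
  simp only [inputStore_setStack]
  exact runs_dropBitsProg hac (inputStore L) hL

theorem PolyRuns.takeBits {ι : Type*} {sz n : ι → ℕ} (hab : a ≠ b) (hac : a ≠ c) (hbc : b ≠ c)
    (A : ι → List (List Bool)) (hA : ∀ i, (A i).getD c [] = unary (n i)) (hn : PolyBdd sz n) :
    PolyRuns sz (takeBitsProg a b c) A fun i => setStack (setStack (setStack (A i)
      b ((((A i).getD a []).takeD (n i) false).reverse ++ (A i).getD b []))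
        a (((A i).getD a []).drop (n i))) c [] :=
  .of (((PolyBdd.const sz 5).mul hn).add (.const sz 1)) fun i => by
    simp only [inputStore_setStack]
    exact runs_takeBitsProg hab hac hbc (inputStore (A i)) (hA i)

end Bits

/-! ### The classical algorithm that extracts a random block -/

/-- Block number `j` of length `n` of a bit string, padded by zeros. -/
def selectBlock (n j : ℕ) (τ : List Bool) : List Bool := (τ.drop (n * j)).takeD n false

theorem selectBlock_ofFn {m n : ℕ} (x : Fin (m * n) → Bool) (j : Fin m) :
    selectBlock n j (List.ofFn x) = List.ofFn (blocksEquiv x j) := by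
  have hj : (j + 1) * n ≤ m * n := Nat.mul_le_mul_right n j.isLt
  rw [← take_drop_ofFn x j, selectBlock, mul_comm n, List.takeD_eq_take]
  rw [add_one_mul] at hj
  rw [List.length_drop, List.length_ofFn]
  omega

/-- The program that pops as many bits from stack `2` as stack `4` has entries if the top bit of
stack `1` is set, and pops that bit. -/
def skipBlockProg : Prog :=
  .seq (.ifTop 1 true (.seq (copyProg 4 3 5) (dropBitsProg 2 3)) .skip) (.pop 1)

theorem runs_skipBlockProg (a r τ : List Bool) (n : ℕ) (x : Bool) :
    Runs skipBlockProg (inputStore [a, x :: r, τ, [], unary n])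
      (inputStore [a, r, τ.drop (n * x.toNat), [], unary n]) (12 * n + 5) := by
  have hpop (t : List Bool) : Runs (.pop 1) (inputStore [a, x :: r, t, [], unary n])
    (inputStore [a, r, t, [], unary n]) 1 := .pop_inputStore _ 1
  cases x
  · refine ((Runs.ifTop_neg (by simp [inputStore]) (.skip _)).seq (hpop τ)).congr ?_ (by omega)
    simp
  · have hcopy := runs_copyProg_inputStore (a := 4) (b := 3) (c := 5) (by decide) (by decide)
      (by decide) [a, true :: r, τ, [], unary n] rfl
    have hdrop := runs_dropBitsProg_inputStore (a := 2) (c := 3) (n := n) (by decide)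
      [a, true :: r, τ, unary n ++ [], unary n] (by simp)
    refine ((Runs.ifTop_pos (by simp [inputStore]) (hcopy.seq hdrop)).seq (hpop _)).congr ?_
      (by simp; omega)
    simp

/-- With a bit string on stack `2` and a block length in unary on stack `4`, the program that
leaves on stack `1` the block whose number is the number of ones on stack `1`. -/
def selectBlockProg : Prog :=
  .seq (.loop 1 skipBlockProg) (.seq (takeBitsProg 2 3 4) (.seq (clearProg 2) (moveProg 3 1)))

section

variable {ι : Type*} {sz : ι → ℕ} {a r τ : ι → List Bool} {n : ι → ℕ}

theorem polyRuns_split (hn : PolyBdd sz n) :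
    PolyRuns sz (.seq (takeBitsProg 1 4 3) (moveProg 4 3))
      (fun i => [a i, r i, τ i, unary (n i)])
      fun i => [a i, (r i).drop (n i), τ i, (r i).takeD (n i) false] := by
  have htake := PolyRuns.takeBits (sz := sz) (a := 1) (b := 4) (c := 3) (by decide) (by decide)
    (by decide) (fun i => [a i, r i, τ i, unary (n i)]) (fun _ => rfl) hn
  refine (htake.seq (.move (by decide) _ (hn.mono fun i => ?_))).congr (fun _ => rfl) fun i => ?_
  · simp [setStack]
  · simpa [setStack] using
      inputStore_append_replicate_nil [a i, (r i).drop (n i), τ i, (r i).takeD (n i) false] 1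

theorem polyRuns_skipBlocks (hn : PolyBdd sz n) (hr : PolyBdd sz fun i => (r i).length) :
    PolyRuns sz (.loop 1 skipBlockProg)
      (fun i => [a i, r i, τ i, [], unary (n i)])
      fun i => [a i, [], (τ i).drop (n i * (r i).count true), [], unary (n i)] := by
  have hloop : PolyRuns sz (.loop 1 skipBlockProg)
      (fun i => [a i, (r i).drop 0, (τ i).drop (n i * ((r i).take 0).count true), [],
        unary (n i)])
      fun i => [a i, (r i).drop (r i).length,
        (τ i).drop (n i * ((r i).take (r i).length).count true), [], unary (n i)] := by
    refine .loop (fun i => (r i).length) hr (fun i k => [a i, (r i).drop k,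
      (τ i).drop (n i * ((r i).take k).count true), [], unary (n i)]) (fun i k hk => ?_)
      (fun i => by simp) (.of ((((PolyBdd.const sz 12).mul hn).add (.const sz 5)).comp
        Sigma.fst) ?_)
    · simpa using hk
    · rintro ⟨i, k, hk⟩
      simp only [List.drop_eq_getElem_cons hk, List.take_succ_eq_append_getElem hk]
      refine (runs_skipBlockProg _ _ _ _ _).congr ?_ le_rfl
      rw [List.drop_drop, ← mul_add, List.count_append]
      cases (r i)[k] <;> simp
  simpa using hloop

theorem polyRuns_selectBlockProg (hn : PolyBdd sz n) (hr : PolyBdd sz fun i => (r i).length)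
    (hτ : PolyBdd sz fun i => (τ i).length) :
    PolyRuns sz selectBlockProg (fun i => [a i, r i, τ i, [], unary (n i)])
      fun i => [a i, selectBlock (n i) ((r i).count true) (τ i)] := by
  have htake := PolyRuns.takeBits (sz := sz) (a := 2) (b := 3) (c := 4) (by decide) (by decide)
    (by decide) (fun i => [a i, [], (τ i).drop (n i * (r i).count true), [], unary (n i)])
    (fun _ => rfl) hn
  refine ((polyRuns_skipBlocks hn hr).seq (htake.seq ((PolyRuns.clear 2 _ (hτ.mono fun i => ?_)).seq
    (.move (by decide) _ (hn.mono fun i => ?_))))).congr (fun _ => rfl) fun i => ?_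
  · simp only [setStack, List.getD_cons_succ, List.getD_cons_zero, List.length_drop]
    omega
  · simp [setStack]
  · simpa [setStack, selectBlock] using
      inputStore_append_replicate_nil [a i, selectBlock (n i) ((r i).count true) (τ i)] 3

end

section

variable {ι : Type*} {lam : ι → ℕ} {r τ : ι → List Bool}

theorem exists_runOnPrefix (B : PPTSampler) (hr : ∀ i, B.coins.eval (lam i) ≤ (r i).length) :
    ∃ p, PolyRuns lam p (fun i => [unary (lam i), r i]) fun i => [unary (lam i),
      (r i).drop (B.coins.eval (lam i)), B.out (lam i) ((r i).take (B.coins.eval (lam i)))] := by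
  obtain ⟨q, hq⟩ := exists_polyProg B.coins
  have hcopy : PolyRuns lam (copyProg 0 2 3) (fun i => [unary (lam i), r i])
      fun i => [unary (lam i), r i, unary (lam i)] := by
    simpa [setStack] using PolyRuns.copy (a := 0) (b := 2) (c := 3) (by decide) (by decide)
      (by decide) (fun i => [unary (lam i), r i]) (fun _ => rfl)
      ((PolyBdd.self lam).mono fun i => by simp)
  have hcoins : PolyRuns lam (q.shift 2) (fun i => [unary (lam i), r i, unary (lam i)])
      fun i => [unary (lam i), r i, unary (lam i), unary (B.coins.eval (lam i))] :=
    (hq.comp lam).shift 2 (fun i => [unary (lam i), r i]) fun _ => rfl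
  have hsplit := polyRuns_split (a := fun i => unary (lam i)) (r := r) (τ := fun i => unary (lam i))
    (PolyBdd.eval lam B.coins)
  have hlength (i : ι) : ((r i).takeD (B.coins.eval (lam i)) false).length
      = B.coins.eval (lam i) := List.takeD_length _ _ _
  have hrun := (PolyRuns.clean (.eval lam B.time) (fun i => B.computes _ _ (hlength i))
    (M := fun i => lam i + B.coins.eval (lam i)) ((PolyBdd.self lam).add (.eval lam B.coins))
    (fun i => by simp) 2 (by simp)).shift 2
    (fun i => [unary (lam i), (r i).drop (B.coins.eval (lam i))]) fun _ => rfl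
  refine ⟨_, (hcopy.seq (hcoins.seq (hsplit.seq hrun))).congr (fun _ => rfl) fun i => ?_⟩
  rw [List.takeD_eq_take _ (hr i)]
  rfl

theorem exists_writeQubits (A : QPTSampler) :
    ∃ p, PolyRuns lam p (fun i => [unary (lam i), r i, τ i])
      fun i => [unary (lam i), r i, τ i, [], unary (A.circuit (lam i)).qubits] := by
  have hsize := (polyBdd_length_encode A).comp lam
  have hcopy : PolyRuns lam (copyProg 0 3 4) (fun i => [unary (lam i), r i, τ i])
      fun i => [unary (lam i), r i, τ i, unary (lam i)] := by
    simpa [setStack] using PolyRuns.copy (a := 0) (b := 3) (c := 4) (by decide) (by decide)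
      (by decide) (fun i => [unary (lam i), r i, τ i]) (fun _ => rfl)
      ((PolyBdd.self lam).mono fun i => by simp)
  have hgen := ((polyRuns_genProg A).comp lam).shift 3 (fun i => [unary (lam i), r i, τ i])
    fun _ => rfl
  have hread := PolyRuns.read (a := 3) (b := 4) (c := 5) (by decide) (by decide) (by decide)
    (fun i => [unary (lam i), r i, τ i, (A.circuit (lam i)).encode])
    (fun i => (A.circuit (lam i)).qubits) _ (fun _ => rfl) (fun _ => rfl) hsize.qubits
  refine ⟨_, (hcopy.seq (hgen.seq (hread.seq (.clear 3 _ hsize.length_flatMap_encode)))).congr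
    (fun _ => rfl) fun i => ?_⟩
  simp [setStack]

end

theorem exists_extractBlock (A : QPTSampler) (B : PPTSampler) (N : Polynomial ℕ) :
    ∃ p, PolyRuns (fun i : {x : ℕ × List Bool // x.2.length = (B.coins + N).eval x.1} => i.1.1) p
      (fun i => [unary i.1.1, i.1.2]) fun i => [unary i.1.1,
        selectBlock (A.circuit i.1.1).qubits ((i.1.2.drop (B.coins.eval i.1.1)).count true)
          (B.out i.1.1 (i.1.2.take (B.coins.eval i.1.1)))] := by
  set lam := fun i : {x : ℕ × List Bool // x.2.length = (B.coins + N).eval x.1} => i.1.1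
  have hseed (i) : i.1.2.length = B.coins.eval (lam i) + N.eval (lam i) := by
    simpa [lam] using i.2
  obtain ⟨p, hp⟩ := exists_runOnPrefix (lam := lam) (r := fun i => i.1.2) B
    fun i => by rw [hseed]; exact Nat.le_add_right _ _
  obtain ⟨q, hq⟩ := exists_writeQubits (lam := lam)
    (r := fun i => i.1.2.drop (B.coins.eval (lam i)))
    (τ := fun i => B.out (lam i) (i.1.2.take (B.coins.eval (lam i)))) A
  have hlength (i) : (i.1.2.take (B.coins.eval (lam i))).length = B.coins.eval (lam i) := by
    rw [List.length_take, hseed, min_eq_left (Nat.le_add_right _ _)]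
  have hselect := polyRuns_selectBlockProg (sz := lam) (a := fun i => unary (lam i))
    (r := fun i => i.1.2.drop (B.coins.eval (lam i)))
    (τ := fun i => B.out (lam i) (i.1.2.take (B.coins.eval (lam i))))
    ((polyBdd_length_encode A).comp lam).qubits
    ((PolyBdd.eval lam N).mono fun i => by simp [hseed])
    (((PolyBdd.self lam).add (.eval lam B.time)).mono fun i => by
      simpa using (B.computes _ _ (hlength i)).length_le)
  exact ⟨_, hp.seq (hq.seq hselect)⟩

theorem exists_blockSampler (A : QPTSampler) (B : PPTSampler) (N : Polynomial ℕ) :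
    ∃ B' : PPTSampler, B'.coins = B.coins + N ∧ ∀ lam r, B'.out lam r
      = A.post lam (selectBlock (A.circuit lam).qubits ((r.drop (B.coins.eval lam)).count true)
          (B.out lam (r.take (B.coins.eval lam)))) := by
  obtain ⟨p, T, hT⟩ := exists_extractBlock A B N
  refine ⟨⟨.seq p A.postProg, B.coins + N, T + A.postTime, fun lam r => A.post lam
    (selectBlock (A.circuit lam).qubits ((r.drop (B.coins.eval lam)).count true)
      (B.out lam (r.take (B.coins.eval lam)))), fun lam r hr => ?_⟩, rfl, fun _ _ => rfl⟩
  obtain ⟨t, ht, hexec⟩ := hT ⟨(lam, r), hr⟩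
  obtain ⟨s, t', ht', hexec_post, hs⟩ := A.post_computes lam _ (List.takeD_length _ _ _)
  exact ⟨s, t + t', by simpa using Nat.add_le_add ht ht', .seq hexec hexec_post, hs⟩

/-! ### Sampling by a random block of an accepted string -/

/-- The probability that `N` fair coins show exactly `j` ones. -/
noncomputable def binomialWeight (N : ℕ) (j : Fin (N + 1)) : ℝ := N.choose j / 2 ^ N

theorem binomialWeight_mem_stdSimplex (N : ℕ) :
    binomialWeight N ∈ stdSimplex ℝ (Fin (N + 1)) := by
  refine ⟨fun j => by unfold binomialWeight; positivity, ?_⟩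
  simp only [binomialWeight]
  rw [← Finset.sum_div, Fin.sum_univ_eq_sum_range fun j => (N.choose j : ℝ),
    div_eq_one_iff_eq (by positivity)]
  exact_mod_cast Nat.sum_range_choose N

theorem sum_count_true_div (N : ℕ) (g : ℕ → ℝ) :
    (∑ v : Fin N → Bool, g ((List.ofFn v).count true)) / 2 ^ N
      = ∑ j, binomialWeight N j * g j := by
  have hfiber (v : Fin N → Bool) : g ((List.ofFn v).count true)
      = ∑ j : Fin (N + 1), (if (List.ofFn v).count true = j then 1 else 0) * g j := by
    have hv : (List.ofFn v).count true < N + 1 :=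
      Nat.lt_succ_of_le (List.count_le_length.trans_eq (by simp))
    rw [Finset.sum_eq_single ⟨_, hv⟩ (fun j _ hj => ?_) (by simp)]
    · simp
    · rw [if_neg fun h => hj (Fin.ext h.symm), zero_mul]
  simp only [hfiber, binomialWeight, div_mul_eq_mul_div]
  rw [Finset.sum_comm, Finset.sum_div]
  refine Finset.sum_congr rfl fun j _ => ?_
  rw [← Finset.sum_mul, ← sum_ite_count_true_eq]
  push_cast
  rfl

theorem expectation_map_coinFlips {α : Type*} (m : ℕ) (f : List Bool → α) (r : α → ℝ) :
    expectation ((coinFlips m).map f) r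
      = (∑ x : Fin m → Bool, r (f (List.ofFn x))) / 2 ^ m := by
  simp only [dist_map_coinFlips, expectation_map, toReal_uniformOfFintype_bool, ← Finset.mul_sum]
  ring

theorem sum_ofFn_add (a b : ℕ) (g : List Bool → ℝ) :
    ∑ x : Fin (a + b) → Bool, g (List.ofFn x)
      = ∑ u : Fin a → Bool, ∑ v : Fin b → Bool, g (List.ofFn u ++ List.ofFn v) := by
  rw [← (Fin.appendEquiv a b).sum_comp, Fintype.sum_prod_type]
  simp [Fin.appendEquiv, List.ofFn_fin_append]

theorem expectation_dist_of_count {B B' : PPTSampler} {lam N : ℕ} {h : List Bool → ℕ → List Bool}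
    (hcoins : B'.coins.eval lam = B.coins.eval lam + N)
    (hout : ∀ s, B'.out lam s
      = h (B.out lam (s.take (B.coins.eval lam))) ((s.drop (B.coins.eval lam)).count true))
    (r : List Bool → ℝ) :
    expectation (B'.dist lam) r
      = expectation (B.dist lam) fun τ => ∑ j, binomialWeight N j * r (h τ j) := by
  rw [PPTSampler.dist, PPTSampler.dist, expectation_map_coinFlips, expectation_map_coinFlips,
    hcoins, sum_ofFn_add _ _ fun s => r (B'.out lam s), pow_add, mul_comm ((2 : ℝ) ^ _),
    ← div_div, Finset.sum_div]
  refine congrArg (· / _) (Finset.sum_congr rfl fun u _ => ?_)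
  rw [← sum_count_true_div N fun j => r (h (B.out lam (List.ofFn u)) j)]
  simp [hout]

theorem expectation_eq_sum_ofFn {n : ℕ} {D : PMF (List Bool)} {r : List Bool → ℝ}
    (h : ∀ τ ∉ Set.range (List.ofFn (n := n)), (D τ).toReal * r τ = 0) :
    expectation D r = ∑ x : Fin n → Bool, (D (List.ofFn x)).toReal * r (List.ofFn x) := by
  rw [expectation, ← tsum_fintype (L := .unconditional _)]
  refine (List.ofFn_injective.tsum_eq fun τ hτ => ?_).symm
  by_contra hrange
  exact hτ (h τ hrange)

theorem sum_toReal_ofFn_le_one (n : ℕ) (D : PMF (List Bool)) :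
    ∑ x : Fin n → Bool, (D (List.ofFn x)).toReal ≤ 1 := by
  simpa using sum_toReal_le_one D (Finset.univ.map ⟨List.ofFn (n := n), List.ofFn_injective⟩)

theorem sum_mul_randomBlock_le (C : QCircuit) {k t : ℕ} (ht : 0 < t) (htk : t ^ 4 ≤ 2 * k + 1)
    {K : ℝ} (hK : 1 ≤ K) {w : (Fin ((2 * k + 1) * C.qubits) → Bool) → ℝ} (hw : ∀ x, 0 ≤ w x)
    (hw_sum : ∑ x, w x ≤ 1) (hwK : ∀ x, w x ≤ K * ((C.copies (2 * k + 1)).measure x).toReal)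
    {r : List Bool → ℝ} (hr : ∀ τ, r τ ∈ Set.Icc 0 1) :
    ∑ x, w x * ∑ j, binomialWeight (2 * k) j * r (selectBlock C.qubits j (List.ofFn x))
      ≤ ∑ y, (C.measure y).toReal * r (List.ofFn y) + (2 + Real.log K) / t := by
  have hmean := sum_weighted_mean_le (p := fun y => (C.measure y).toReal)
    (f := fun y => r (List.ofFn y)) ⟨fun _ => ENNReal.toReal_nonneg, sum_toReal C.measure⟩
    (fun y => hr _) (binomialWeight_mem_stdSimplex (2 * k)) (t := t) (by exact_mod_cast ht)
    (fun j => choose_div_le htk ht) hK (D := fun z => w (blocksEquiv.symm z)) (fun z => hw _)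
    ((Equiv.sum_comp blocksEquiv.symm w).trans_le hw_sum) fun z => by
      simpa only [QCircuit.measure_copies, Equiv.apply_symm_apply] using
        hwK (blocksEquiv.symm z)
  rw [← Equiv.sum_comp blocksEquiv] at hmean
  simpa only [Equiv.symm_apply_apply, ← selectBlock_ofFn] using hmean

theorem expectation_randomBlock_mul_ratioTest_le (C : QCircuit) {lam k t R : ℕ} (ht : 0 < t)
    (htk : t ^ 4 ≤ 2 * k + 1) (hR : 0 < R) {D : PMF (List Bool)}
    (hD : ∀ τ, (D τ).toReal ≤ mixWeight lam τ) {r : List Bool → ℝ}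
    (hr : ∀ τ, r τ ∈ Set.Icc 0 1) :
    (expectation D fun τ => (∑ j, binomialWeight (2 * k) j * r (selectBlock C.qubits j τ)) *
        if ratioTest (C.copies (2 * k + 1)).encode lam R τ then 1 else 0)
      ≤ ∑ y, (C.measure y).toReal * r (List.ofFn y)
        + (2 + Real.log ((lam + 1) * R)) / t := by
  rw [expectation_eq_sum_ofFn (n := (2 * k + 1) * C.qubits) fun τ hτ => ?_]
  · have hRlam : (1 : ℝ) ≤ (lam + 1) * R := by
      exact_mod_cast Nat.mul_pos lam.succ_pos hR
    refine (Finset.sum_congr rfl fun x _ => ?_).trans_le (sum_mul_randomBlock_le C ht htk hRlam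
      (w := fun x => if ratioTest (C.copies (2 * k + 1)).encode lam R (List.ofFn x)
        then (D (List.ofFn x)).toReal else 0) (fun x => ?_)
      ((Finset.sum_le_sum fun x _ => ?_).trans (sum_toReal_ofFn_le_one _ D)) (fun x => ?_) hr)
    · split_ifs <;> simp
    · split_ifs <;> simp
    · split_ifs <;> simp
    · split_ifs with haccept
      · exact (hD _).trans ((ratioTest_ofFn_iff (C.copies (2 * k + 1)) x).1 haccept)
      · positivity
  · split_ifs with haccept
    · have hzero : (D τ).toReal = 0 := ((hD τ).trans_eq
        (mixWeight_eq_zero_of_ratioTest (C.copies (2 * k + 1)) hτ haccept)).antisymm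
          ENNReal.toReal_nonneg
      rw [hzero, zero_mul]
    · rw [mul_zero, mul_zero]

theorem statDist_blockSampler_le {A : QPTSampler} {B B' : PPTSampler} {lam k t R : ℕ}
    (hcoins : B'.coins.eval lam = B.coins.eval lam + 2 * k)
    (hout : ∀ s, B'.out lam s = A.post lam (selectBlock (A.circuit lam).qubits
      ((s.drop (B.coins.eval lam)).count true) (B.out lam (s.take (B.coins.eval lam)))))
    (ht : 0 < t) (htk : t ^ 4 ≤ 2 * k + 1) (hR : 0 < R)
    (hB : ∀ τ, (B.dist lam τ).toReal ≤ mixWeight lam τ) :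
    statDist (A.dist lam) (B'.dist lam) ≤ (2 + Real.log ((lam + 1) * R)) / t
      + (1 - expectation (B.dist lam) fun τ =>
        if ratioTest ((A.circuit lam).copies (2 * k + 1)).encode lam R τ then 1 else 0) := by
  rw [statDist_comm]
  refine statDist_le_of_expectation_sub_le _ _ fun r hr => ?_
  have hB' := expectation_dist_of_count
    (h := fun τ j => A.post lam (selectBlock (A.circuit lam).qubits j τ)) hcoins hout r
  have hA : expectation (A.dist lam) r
      = ∑ y, ((A.circuit lam).measure y).toReal * r (A.post lam (List.ofFn y)) :=
    expectation_map _ _ r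
  have hmean (τ : List Bool) : ∑ j, binomialWeight (2 * k) j *
      r (A.post lam (selectBlock (A.circuit lam).qubits j τ)) ∈ Set.Icc 0 1 :=
    (convex_Icc (0 : ℝ) 1).sum_mem (fun j _ => (binomialWeight_mem_stdSimplex _).1 j)
      (binomialWeight_mem_stdSimplex _).2 fun j _ => hr _
  have hsplit := expectation_le_expectation_mul_add (B.dist lam) hmean (e := fun τ =>
    if ratioTest ((A.circuit lam).copies (2 * k + 1)).encode lam R τ then 1 else 0)
    fun τ => by split_ifs <;> simp
  have haccepted := expectation_randomBlock_mul_ratioTest_le (A.circuit lam) ht htk hR hB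
    fun τ => hr (A.post lam τ)
  linarith

/-! ### From quantum advantage samplers to proofs of quantumness -/

theorem exists_nat_polynomial_ge (p : Polynomial ℝ) : ∃ Q : Polynomial ℕ,
    ∀ n : ℕ, p.eval (n : ℝ) ≤ ((Q.eval n : ℕ) : ℝ) := by
  induction p using Polynomial.induction_on' with
  | add p q hp hq =>
    obtain ⟨P, hP⟩ := hp
    obtain ⟨Q, hQ⟩ := hq
    exact ⟨P + Q, fun n => by simpa using add_le_add (hP n) (hQ n)⟩
  | monomial k a =>
    refine ⟨Polynomial.monomial k ⌈a⌉₊, fun n => ?_⟩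
    rw [Polynomial.eval_monomial, Polynomial.eval_monomial]
    push_cast
    exact mul_le_mul_of_nonneg_right (Nat.le_ceil a) (by positivity)

theorem exists_ratioTest_parameters {p : Polynomial ℝ} (hp : IsPositive p) :
    ∃ R t : Polynomial ℕ, ∀ n : ℕ, 0 < R.eval n ∧ 0 < t.eval n ∧
      (2 + Real.log ((n + 1) * (R.eval n : ℕ))) / (t.eval n : ℕ) + 2 / (R.eval n : ℕ)
        ≤ 1 / p.eval (n : ℝ) := by
  obtain ⟨Q, hQ⟩ := exists_nat_polynomial_ge p
  refine ⟨4 * Q, 2 * Q * (2 + (.X + 1) * (4 * Q)), fun n => ?_⟩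
  have hpn : 0 < p.eval (n : ℝ) := hp n
  have hQpos : (0 : ℝ) < (Q.eval n : ℕ) := hpn.trans_le (hQ n)
  have hQpos_nat : 0 < Q.eval n := by exact_mod_cast hQpos
  simp only [Polynomial.eval_mul, Polynomial.eval_add, Polynomial.eval_X, Polynomial.eval_one,
    Polynomial.eval_ofNat]
  refine ⟨by positivity, by positivity, ?_⟩
  push_cast
  set q : ℝ := ((Q.eval n : ℕ) : ℝ)
  calc (2 + Real.log ((n + 1) * (4 * q))) / (2 * q * (2 + (n + 1) * (4 * q))) + 2 / (4 * q)
      ≤ (2 + (n + 1) * (4 * q)) / (2 * q * (2 + (n + 1) * (4 * q))) + 2 / (4 * q) := by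
        gcongr
        exact Real.log_le_self (by positivity)
    _ = 1 / q := by
        field_simp
        norm_num
    _ ≤ 1 / p.eval (n : ℝ) := one_div_le_one_div_of_le hpn (hQ n)

theorem IsQASOn.exists_isNonInteractiveIVPoQOn {S : Set ℕ} {A : QPTSampler} (h : IsQASOn S A) :
    ∃ (P : QPTSampler) (V : UnboundedVerifier), IsNonInteractiveIVPoQOn S P V := by
  obtain ⟨p, hp, hA⟩ := h
  obtain ⟨R, t, hRt⟩ := exists_ratioTest_parameters hp
  obtain ⟨P, hP_circuit, hP_post⟩ := exists_copiesSampler A (2 * t ^ 4 + 1)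
  refine ⟨P, ratioVerifier P R, fun lam => 1 - 1 / ((R.eval lam : ℕ) : ℝ),
    fun lam => 1 - 2 / ((R.eval lam : ℕ) : ℝ), R.map (Nat.castRingHom ℝ), fun n => ?_,
    fun lam => ?_, ⟨0, fun lam _ => acceptProb_ratioVerifier_ge hP_post R (hRt lam).1⟩,
    fun B => ?_⟩
  · simpa [Polynomial.eval_natCast_map] using (hRt n).1
  · rw [Polynomial.eval_natCast_map]
    exact (by ring : (1 - 1 / ((R.eval lam : ℕ) : ℝ)) - (1 - 2 / ((R.eval lam : ℕ) : ℝ))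
      = 1 / ((R.eval lam : ℕ) : ℝ)).ge
  · obtain ⟨B', hB'_coins, hB'_out⟩ := exists_blockSampler A B (2 * t ^ 4)
    obtain ⟨lam₀, hlam₀⟩ := hA B'
    obtain ⟨i, hi⟩ := B.exists_dist_le_mixWeight
    refine ⟨max lam₀ i, fun lam hlam hle => ?_⟩
    have hfar := hlam₀ lam hlam ((le_max_left _ _).trans hle)
    obtain ⟨hR, ht, hparameters⟩ := hRt lam
    have hclose := statDist_blockSampler_le (k := t.eval lam ^ 4) (by simp [hB'_coins])
      (hB'_out lam) ht (by omega) hR (hi lam ((le_max_right _ _).trans hle))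
    have hcopies : (2 * t ^ 4 + 1).eval lam = 2 * t.eval lam ^ 4 + 1 := by simp
    rw [acceptProb_ratioVerifier, hP_circuit, hcopies]
    linarith

theorem exists_isQASOn_iff (S : Set ℕ) : (∃ A : QPTSampler, IsQASOn S A) ↔
    ∃ (P : QPTSampler) (V : UnboundedVerifier), IsNonInteractiveIVPoQOn S P V :=
  ⟨fun ⟨_, h⟩ => h.exists_isNonInteractiveIVPoQOn, fun ⟨P, _, h⟩ => ⟨P, h.isQASOn⟩⟩

end QAdv

theorem mainTheorem5 :
    ((∃ A : QAdv.QPTSampler, QAdv.IsQAS A) ↔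
      ∃ (P : QAdv.QPTSampler) (V : QAdv.UnboundedVerifier), QAdv.IsNonInteractiveIVPoQ P V) ∧
    (∀ S : Set ℕ, S.Infinite →
      ((∃ A : QAdv.QPTSampler, QAdv.IsQASOn S A) ↔
        ∃ (P : QAdv.QPTSampler) (V : QAdv.UnboundedVerifier),
          QAdv.IsNonInteractiveIVPoQOn S P V)) :=
  ⟨QAdv.exists_isQASOn_iff Set.univ, fun S _ => QAdv.exists_isQASOn_iff S⟩
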